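/- Let $E/\mathbf{Q}_p$ be a finite extension with ring of integers $\mathcal{O}_E$, uniformizer $\pi$ and residue field $\mathbf{F}_q$, and let $F$ be a perfectoid field of characteristic $p$ containing $\mathbf{F}_q$ (a perfect field, complete with respect to a nontrivial absolute value $|\cdot|\colon F\to\mathbf{R}_{\geq 0}$), with ring of integers $\mathcal{O}_F$ and residue field $k_F$. For an $\mathbf{F}_q$-algebra $R$ put $W_{\mathcal{O}_E}(R)=W(R)\otimes_{W(\mathbf{F}_q)}\mathcal{O}_E$. Let $B^{b,+}=W_{\mathcal{O}_E}(\mathcal{O}_F)$ with its $([\varpi],\pi)$-adic topology, where $\varpi\in\mathcal{O}_F$ is an element with $0<|\varpi|<1$, and let $B^b\subset W_{\mathcal{O}_E}(F)[1/\pi]$ be the subring of those $x=\sum_{n\gg-\infty}[x_n]\pi^n$ for which $|x_n|$ is bounded. For a nonempty closed interval $I\subset(0,1)$ put $|x|_I=\sup_{\rho\in I}\sup_n|x_n|\rho^n$, let $B_I$ be the completion of $B^b$ with respect to $|\cdot|_I$, and let $B_I^\circ=\{x\in B_I : |x|_I\leq 1\}$. For $I\subset J$ the identity of $B^b$ extends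 to a homomorphism $(B_J,B_J^\circ)\to(B_I,B_I^\circ)$. Consider general adic spaces in the sense of Scholze–Weinstein, as sheaves on the site of complete affinoid rings (with the coverings given by covering families of rational subsets); $\mathrm{Spa}(A,A^+)$ is the sheaf associated with $(T,T^+)\mapsto\mathrm{Hom}((A,A^+),(T,T^+))$. Let $(\mathrm{Spf}\,B^{b,+})^{\mathrm{ad}}_E=\mathrm{Spa}(B^{b,+},B^{b,+})\times_{\mathrm{Spa}(\mathcal{O}_E,\mathcal{O}_E)}\mathrm{Spa}(E,\mathcal{O}_E)$ be the adic generic fibre, and let $$Y^{\mathrm{ad}}=(\mathrm{Spf}\,B^{b,+})^{\mathrm{ad}}_E\setminus\{0\},$$ where $0$ is the valuation on $B^{b,+}$ pulled back from the $\pi$-adic valuation on $W_{\mathcal{O}_E}(k_F)$. Then every $(B_I,B_I^\circ)$ is a complete affinoid ring, and as general adic spaces $$Y^{\mathrm{ad}}=\varinjlim_I\mathrm{Spa}(B_I,B_I^\circ),$$ where $I$ runs over the closed intervals in $(0,1)$. More precisely, there are monomorphisms $\mathrm{Spa}(B_I,B_I^\circ)\to Y^{\mathrm{ad}}$, compatible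 with the transition maps for $I\subset J$ and with the maps to $\mathrm{Spa}(B^{b,+},B^{b,+})$ (those on $\mathrm{Spa}(B_I,B_I^\circ)$ being induced by $B^{b,+}\subset B^b\to B_I$), which make $Y^{\mathrm{ad}}$ the colimit of the inductive system of the $\mathrm{Spa}(B_I,B_I^\circ)$. -/

import Mathlib

open CategoryTheory Opposite Topology
open scoped NormedField Valued

universe u

set_option linter.unusedSectionVars false

namespace AdicSpaces

/-! ### Affinoid rings -/

/-- A topological ring together with a subring `plus`; the pairs `(A, A⁺)` from which affinoid
rings are singled out by `IsAffinoid`. -/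
structure Pair : Type (u + 1) where
  carrier : Type u
  [commRing : CommRing carrier]
  [topology : TopologicalSpace carrier]
  [isTopologicalRing : IsTopologicalRing carrier]
  plus : Subring carrier

attribute [instance] Pair.commRing Pair.topology Pair.isTopologicalRing

/-- A morphism `(A, A⁺) → (B, B⁺)`: a continuous ring homomorphism mapping `A⁺` into `B⁺`. -/
@[ext]
structure Pair.Hom (A B : Pair.{u}) where
  toRingHom : A.carrier →+* B.carrier
  continuous' : Continuous toRingHom
  map_plus' : ∀ a ∈ A.plus, toRingHom a ∈ B.plus

instance : Category Pair.{u} where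
  Hom := Pair.Hom
  id A := ⟨RingHom.id _, continuous_id, fun _ h => h⟩
  comp f g := ⟨g.toRingHom.comp f.toRingHom, g.continuous'.comp f.continuous',
    fun a h => g.map_plus' _ (f.map_plus' a h)⟩

section

variable (A : Type u) [CommRing A] [TopologicalSpace A]

/-- `A` is f-adic: it has an open subring whose topology is the `I`-adic one for a finitely
generated ideal `I`. -/
def IsFAdic : Prop :=
  ∃ A₀ : Subring A, IsOpen (A₀ : Set A) ∧ ∃ I : Ideal A₀, I.FG ∧ IsAdic I

variable {A} in
/-- `a` is power-bounded: the set of its powers is bounded. -/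
def IsPowerBounded (a : A) : Prop :=
  ∀ U ∈ 𝓝 (0 : A), ∃ V ∈ 𝓝 (0 : A), ∀ v ∈ V, ∀ n : ℕ, v * a ^ n ∈ U

end

/-- `(A, A⁺)` is an affinoid ring: `A` is f-adic and `A⁺` is an open and integrally closed subring
of power-bounded elements. -/
structure Pair.IsAffinoid (A : Pair.{u}) : Prop where
  isFAdic : IsFAdic A.carrier
  isOpen : IsOpen (A.plus : Set A.carrier)
  integrallyClosed : ∀ a : A.carrier, IsIntegral A.plus a → a ∈ A.plus
  powerBounded : ∀ a ∈ A.plus, IsPowerBounded a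

/-- `A` is complete (and Hausdorff) for the uniform structure of its additive group. -/
structure Pair.IsComplete (A : Pair.{u}) : Prop where
  t2 : T2Space A.carrier
  complete : @CompleteSpace A.carrier (IsTopologicalAddGroup.rightUniformSpace A.carrier)

/-- Complete affinoid rings. -/
abbrev CompleteAffinoid : Type (u + 1) :=
  ObjectProperty.FullSubcategory (fun A : Pair.{u} => A.IsAffinoid ∧ A.IsComplete)

/-! ### Points of `Spa(A, A⁺)` -/

/-- Pullback of (an equivalence class of) a valuation along a ring homomorphism. -/
@[reducible] def comapValuation {A B : Type u} [CommRing A] [CommRing B] (f : A →+* B) (x : ValuativeRel B) :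
    ValuativeRel A where
  vle a b := x.vle (f a) (f b)
  vle_total a b := x.vle_total _ _
  vle_trans h h' := x.vle_trans h h'
  vle_add h h' := by rw [map_add]; exact x.vle_add h h'
  mul_vle_mul_left h c := by rw [map_mul, map_mul]; exact x.mul_vle_mul_left h _
  vle_mul_cancel h h' := by
    rw [map_zero] at h
    rw [map_mul, map_mul] at h'
    exact x.vle_mul_cancel h h'
  not_vle_one_zero := by rw [map_one, map_zero]; exact x.not_vle_one_zero
  vle_mul_comm := by intro a b; rw [map_mul, map_mul]; exact x.vle_mul_comm

/-- The set underlying `Spa(A, A⁺)`: equivalence classes of valuations on `A` which are continuous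
(`{a | |a| < |b| / |c|}` is open for all `b`, `c` with `|b|, |c| ≠ 0`) and satisfy `|A⁺| ≤ 1`. -/
def Pair.points (A : Pair.{u}) : Set (ValuativeRel A.carrier) :=
  {x | (∀ b c : A.carrier, ¬ x.vle b 0 → ¬ x.vle c 0 → IsOpen {a | ¬ x.vle b (a * c)}) ∧
    ∀ a ∈ A.plus, x.vle a 1}

theorem Pair.Hom.comap_mem_points {A B : Pair.{u}} (f : A ⟶ B) {x : ValuativeRel B.carrier}
    (hx : x ∈ B.points) : comapValuation (Pair.Hom.toRingHom f) x ∈ A.points := by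
  refine ⟨fun b c hb hc => ?_, fun a ha => ?_⟩
  · have := (hx.1 (f.toRingHom b) (f.toRingHom c)
      (fun h => hb (show x.vle (f.toRingHom b) (f.toRingHom 0) by rwa [map_zero]))
      (fun h => hc (show x.vle (f.toRingHom c) (f.toRingHom 0) by rwa [map_zero]))).preimage
      f.continuous'
    have h : {a | ¬ x.vle (f.toRingHom b) (f.toRingHom (a * c))} =
        f.toRingHom ⁻¹' {a | ¬ x.vle (f.toRingHom b) (a * f.toRingHom c)} := by
      ext a
      simp only [map_mul, Set.mem_ofPred_eq, Set.mem_preimage]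
    exact h ▸ this
  · change x.vle (f.toRingHom a) (f.toRingHom 1)
    rw [map_one]
    exact hx.2 _ (f.map_plus' a ha)

/-- The rational subset `{x | |f| ≤ |g| ≠ 0 for all f ∈ s}` of `Spa(A, A⁺)`. -/
def Pair.rationalSubset (A : Pair.{u}) (s : Finset A.carrier) (g : A.carrier) :
    Set (ValuativeRel A.carrier) :=
  {x | x ∈ A.points ∧ (∀ f ∈ s, x.vle f g) ∧ ¬ x.vle g 0}

/-- `φ : (A, A⁺) → (B, B⁺)` exhibits `(B, B⁺)` as `(𝒪_X(U), 𝒪_X⁺(U))` for a rational subset `U` of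
`X = Spa(A, A⁺)`: `Spa(B, B⁺)` has image `U` in `X`, and `φ` is universal among the morphisms to
complete affinoid rings which map into `U` on points. -/
def IsRationalLocalization {A B : CompleteAffinoid.{u}} (φ : A ⟶ B) : Prop :=
  ∃ (s : Finset A.obj.carrier) (g : A.obj.carrier),
    IsOpen (Ideal.span (s : Set A.obj.carrier) : Set A.obj.carrier) ∧
    comapValuation φ.hom.toRingHom '' B.obj.points = A.obj.rationalSubset s g ∧
    ∀ (C : CompleteAffinoid.{u}) (ψ : A ⟶ C),
      (∀ x ∈ C.obj.points, comapValuation ψ.hom.toRingHom x ∈ A.obj.rationalSubset s g) →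
      ∃! χ : B ⟶ C, φ ≫ χ = ψ

/-! ### The site of complete affinoid rings and general adic spaces -/

/-- The covering families of `Spa(A, A⁺)`: the families of rational subsets which cover it. -/
def rationalCoverings : Precoverage CompleteAffinoid.{u}ᵒᵖ where
  coverings X := {R | (∀ ⦃Y : CompleteAffinoid.{u}ᵒᵖ⦄ (f : Y ⟶ X), R f →
      IsRationalLocalization f.unop) ∧
    ∀ x ∈ X.unop.obj.points, ∃ (Y : CompleteAffinoid.{u}ᵒᵖ) (f : Y ⟶ X), R f ∧
      x ∈ comapValuation f.unop.hom.toRingHom '' Y.unop.obj.points}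

/-- The Grothendieck topology on the opposite of the category of complete affinoid rings. -/
def rationalTopology : GrothendieckTopology CompleteAffinoid.{u}ᵒᵖ :=
  rationalCoverings.toGrothendieck

/-- The category of sheaves on the site of complete affinoid rings, of which the category of
general adic spaces is a full subcategory. -/
abbrev AdicSheaf : Type (u + 2) := Sheaf rationalTopology.{u} (Type (u + 1))

/-- The presheaf `(T, T⁺) ↦ Hom((A, A⁺), (T, T⁺))`. -/
def homPresheaf : Pair.{u}ᵒᵖ ⥤ (CompleteAffinoid.{u}ᵒᵖᵒᵖ ⥤ Type (u + 1)) :=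
  coyoneda ⋙ (Functor.whiskeringRight _ _ _).obj uliftFunctor.{u + 1, u} ⋙
    (Functor.whiskeringLeft _ _ _).obj (unopUnop _ ⋙ ObjectProperty.ι _)

/-- `Spa(A, A⁺)` as a sheaf: the sheafification of `(T, T⁺) ↦ Hom((A, A⁺), (T, T⁺))`. -/
noncomputable def Spa : Pair.{u}ᵒᵖ ⥤ AdicSheaf.{u} :=
  homPresheaf ⋙ presheafToSheaf rationalTopology (Type (u + 1))

/-- The section of `Spa(A, A⁺)` over `(T, T⁺)` given by a morphism `(A, A⁺) → (T, T⁺)`. -/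
noncomputable def sectionOfHom {A : Pair.{u}} {T : CompleteAffinoid.{u}} (g : A ⟶ T.obj) :
    (Spa.obj (op A)).obj.obj (op (op T)) :=
  (toSheafify rationalTopology (homPresheaf.obj (op A))).app (op (op T)) (ULift.up g : ULift.{u + 1} (A ⟶ T.obj))

theorem map_sectionOfHom {A : Pair.{u}} {T T' : CompleteAffinoid.{u}} (g : A ⟶ T.obj)
    (h : T ⟶ T') :
    (Spa.obj (op A)).obj.map h.op.op (sectionOfHom g) = sectionOfHom (g ≫ h.hom) := by
  unfold sectionOfHom
  exact (NatTrans.naturality_apply (toSheafify rationalTopology (homPresheaf.obj (op A)))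
    h.op.op (ULift.up g : ULift.{u + 1} (A ⟶ T.obj))).symm

/-- For `X` over `Spa(A, A⁺)` and a set `Z` of points of `Spa(A, A⁺)`: the sections of `X` over
`(T, T⁺)` whose image in `Spa(A, A⁺)` is given by a morphism `(A, A⁺) → (T, T⁺)` such that the
induced map `Spa(T, T⁺) → Spa(A, A⁺)` on points avoids `Z`. -/
def avoiding {X : AdicSheaf.{u}} {A : Pair.{u}} (π : X ⟶ Spa.obj (op A))
    (Z : Set (ValuativeRel A.carrier)) : Subfunctor X.obj where
  obj U := {s | ∃ g : A ⟶ U.unop.unop.obj, π.hom.app U s = sectionOfHom g ∧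
    ∀ x ∈ U.unop.unop.obj.points, comapValuation (Pair.Hom.toRingHom g) x ∉ Z}
  map := by
    rintro U V i s ⟨g, hg, hZ⟩
    refine ⟨g ≫ i.unop.unop.hom, ?_, fun x hx => hZ _ (Pair.Hom.comap_mem_points i.unop.unop.hom hx)⟩
    rw [← map_sectionOfHom g i.unop.unop, ← hg]
    exact NatTrans.naturality_apply π.hom i s

/-- The complement in `X` of the preimage of a (closed) set `Z` of points of `Spa(A, A⁺)`: the
subsheaf of those sections of `X` which locally avoid `Z`. -/
noncomputable def complement {X : AdicSheaf.{u}} {A : Pair.{u}} (π : X ⟶ Spa.obj (op A))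
    (Z : Set (ValuativeRel A.carrier)) : AdicSheaf.{u} where
  obj := ((avoiding π Z).sheafify rationalTopology).toFunctor
  property := (isSheaf_iff_isSheaf_of_type _ _).2 <|
    (avoiding π Z).sheafify_isSheaf ((isSheaf_iff_isSheaf_of_type _ _).1 X.property)

/-- The inclusion of `complement π Z` into `X`. -/
noncomputable def complementι {X : AdicSheaf.{u}} {A : Pair.{u}} (π : X ⟶ Spa.obj (op A))
    (Z : Set (ValuativeRel A.carrier)) : complement π Z ⟶ X where
  hom := ((avoiding π Z).sheafify rationalTopology).ι

end AdicSpaces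

namespace FarguesFontaine

noncomputable section

section LocalField

theorem norm_p (p : ℕ) [Fact p.Prime] (E : Type u) [NontriviallyNormedField E]
    [NormedAlgebra ℚ_[p] E] : ‖(p : E)‖ = (p : ℝ)⁻¹ := by
  rw [← map_natCast (algebraMap ℚ_[p] E), norm_algebraMap', Padic.norm_p]

theorem norm_p_lt_one (p : ℕ) [Fact p.Prime] (E : Type u) [NontriviallyNormedField E]
    [NormedAlgebra ℚ_[p] E] : ‖(p : E)‖ < 1 := by
  rw [norm_p]
  exact inv_lt_one_of_one_lt₀ (by exact_mod_cast (Fact.out : p.Prime).one_lt)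

theorem not_isUnit_p (p : ℕ) [Fact p.Prime] (E : Type u) [NontriviallyNormedField E]
    [IsUltrametricDist E] [NormedAlgebra ℚ_[p] E] : ¬ IsUnit (p : 𝒪[E]) := by
  rw [Valued.integer.isUnit_iff_norm_eq_one]
  exact (norm_p_lt_one p E).ne

theorem compactSpace_integer (p : ℕ) [Fact p.Prime] (E : Type u) [NontriviallyNormedField E]
    [IsUltrametricDist E] [NormedAlgebra ℚ_[p] E] [FiniteDimensional ℚ_[p] E] :
    CompactSpace 𝒪[E] := by
  have : ProperSpace E := FiniteDimensional.proper ℚ_[p] E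
  have h : ((𝒪[E] : Subring E) : Set E) = Metric.closedBall 0 1 := by
    ext x
    rw [SetLike.mem_coe, Valued.integer.mem_iff, mem_closedBall_zero_iff]
  exact isCompact_iff_compactSpace.1 (h ▸ isCompact_closedBall (0 : E) 1)

theorem isDVR_and_finite (p : ℕ) [Fact p.Prime] (E : Type u) [NontriviallyNormedField E]
    [IsUltrametricDist E] [NormedAlgebra ℚ_[p] E] [FiniteDimensional ℚ_[p] E] :
    IsDiscreteValuationRing 𝒪[E] ∧ Finite 𝓀[E] := by
  have := compactSpace_integer p E
  let r : (Valued.v : Valuation E NNReal).RankOne :=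
    inferInstanceAs (NormedField.valuation (K := E)).RankOne
  exact (Valued.integer.compactSpace_iff_completeSpace_and_isDiscreteValuationRing_and_finite_residueField.1
    this).2

theorem charP_residueField (p : ℕ) [Fact p.Prime] (E : Type u) [NontriviallyNormedField E]
    [IsUltrametricDist E] [NormedAlgebra ℚ_[p] E] : CharP 𝓀[E] p := by
  have : ((p : ℕ) : 𝓀[E]) = 0 := by
    rw [← map_natCast (IsLocalRing.residue 𝒪[E]), IsLocalRing.residue_eq_zero_iff]
    exact not_isUnit_p p E
  exact (CharP.charP_iff_prime_eq_zero Fact.out).2 this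

theorem perfectRing_residueField (p : ℕ) [Fact p.Prime] (E : Type u) [NontriviallyNormedField E]
    [IsUltrametricDist E] [NormedAlgebra ℚ_[p] E] [FiniteDimensional ℚ_[p] E] [CharP 𝓀[E] p] :
    PerfectRing 𝓀[E] p := by
  have := (isDVR_and_finite p E).2
  exact PerfectRing.ofFiniteOfIsReduced p _

theorem dvd_iff_norm_le {E : Type u} [NontriviallyNormedField E] [IsUltrametricDist E]
    {a b : 𝒪[E]} : a ∣ b ↔ ‖b‖ ≤ ‖a‖ := by
  rw [← Ideal.mem_span_singleton, ← SetLike.mem_coe,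
    Valued.integer.coe_span_singleton_eq_closedBall, mem_closedBall_zero_iff]

/-- The topology of `𝒪_E` is `a`-adic for every `a` with `0 < |a| < 1`. -/
theorem isAdic_span {E : Type u} [NontriviallyNormedField E] [IsUltrametricDist E]
    {a : 𝒪[E]} (h0 : 0 < ‖a‖) (h1 : ‖a‖ < 1) : IsAdic (Ideal.span {a}) := by
  have hb : ∀ n : ℕ, ((Ideal.span {a} ^ n : Ideal 𝒪[E]) : Set 𝒪[E]) =
      Metric.closedBall 0 (‖a‖ ^ n) := by
    intro n
    rw [Ideal.span_singleton_pow, Valued.integer.coe_span_singleton_eq_closedBall, norm_pow]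
  rw [isAdic_iff]
  constructor
  · intro n
    rw [hb]
    exact IsUltrametricDist.isOpen_closedBall _ (pow_pos h0 _).ne'
  · intro s hs
    obtain ⟨ε, hε, h⟩ := Metric.mem_nhds_iff.1 hs
    obtain ⟨n, hn⟩ := exists_pow_lt_of_lt_one hε h1
    refine ⟨n, ?_⟩
    rw [hb]
    exact (Metric.closedBall_subset_ball hn).trans h

theorem norm_p_integer (p : ℕ) [Fact p.Prime] (E : Type u) [NontriviallyNormedField E]
    [IsUltrametricDist E] [NormedAlgebra ℚ_[p] E] :
    0 < ‖(p : 𝒪[E])‖ ∧ ‖(p : 𝒪[E])‖ < 1 := by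
  refine ⟨?_, norm_p_lt_one p E⟩
  change 0 < ‖(p : E)‖
  rw [norm_p]
  exact inv_pos.2 (by exact_mod_cast (Fact.out : p.Prime).pos)

theorem isAdicComplete_p (p : ℕ) [Fact p.Prime] (E : Type u) [NontriviallyNormedField E]
    [IsUltrametricDist E] [NormedAlgebra ℚ_[p] E] [FiniteDimensional ℚ_[p] E] :
    IsAdicComplete (Ideal.span {(p : 𝒪[E])}) 𝒪[E] := by
  have := compactSpace_integer p E
  exact (isAdic_span (norm_p_integer p E).1 (norm_p_integer p E).2).isAdicComplete_iff.2
    ⟨inferInstance, inferInstance⟩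

theorem exists_pow_dvd (p : ℕ) [Fact p.Prime] (E : Type u) [NontriviallyNormedField E]
    [IsUltrametricDist E] [NormedAlgebra ℚ_[p] E] [FiniteDimensional ℚ_[p] E] :
    ∃ N : ℕ, ∀ x ∈ IsLocalRing.maximalIdeal 𝒪[E], (p : 𝒪[E]) ∣ x ^ p ^ N := by
  have := (isDVR_and_finite p E).1
  obtain ⟨ϖ, hϖ⟩ := IsDiscreteValuationRing.exists_irreducible 𝒪[E]
  obtain ⟨n, hn⟩ := exists_pow_lt_of_lt_one (norm_p_integer p E).1
    (Valued.integer.norm_irreducible_lt_one hϖ)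
  refine ⟨n, fun x hx => ?_⟩
  rw [hϖ.maximalIdeal_eq, Ideal.mem_span_singleton] at hx
  have h1 : (p : 𝒪[E]) ∣ ϖ ^ n := dvd_iff_norm_le.2 (by rw [norm_pow]; exact hn.le)
  have h2 : n ≤ p ^ n := (Nat.lt_pow_self (Fact.out : p.Prime).one_lt).le
  exact h1.trans ((pow_dvd_pow ϖ h2).trans (pow_dvd_pow_of_dvd hx _))

/-- There is a ring homomorphism `k → 𝒪_E / p` which is a section of the reduction map, where `k` is
the residue field of `E`. -/
theorem exists_section (p : ℕ) [Fact p.Prime] (E : Type u) [NontriviallyNormedField E]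
    [IsUltrametricDist E] [NormedAlgebra ℚ_[p] E] [FiniteDimensional ℚ_[p] E] :
    ∃ σ : 𝓀[E] →+* ModP 𝒪[E] p, ∀ a : 𝒪[E], ∀ b : 𝓀[E], σ b = Ideal.Quotient.mk _ a →
      b = IsLocalRing.residue 𝒪[E] a := by
  have := charP_residueField p E
  have := perfectRing_residueField p E
  have : Fact (¬ IsUnit (p : 𝒪[E])) := ⟨not_isUnit_p p E⟩
  obtain ⟨N, hN⟩ := exists_pow_dvd p E
  let f : 𝒪[E] →+* ModP 𝒪[E] p := (iterateFrobenius (ModP 𝒪[E] p) p N).comp (Ideal.Quotient.mk _)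
  have hf : ∀ a ∈ IsLocalRing.maximalIdeal 𝒪[E], f a = 0 := by
    intro a ha
    change iterateFrobenius (ModP 𝒪[E] p) p N (Ideal.Quotient.mk _ a) = 0
    rw [iterateFrobenius_def, ← map_pow, Ideal.Quotient.eq_zero_iff_dvd]
    exact hN a ha
  let g : 𝓀[E] →+* ModP 𝒪[E] p := Ideal.Quotient.lift _ f hf
  refine ⟨g.comp (iterateFrobeniusEquiv 𝓀[E] p N).symm.toRingHom, fun a b h => ?_⟩
  obtain ⟨c, rfl⟩ := (iterateFrobeniusEquiv 𝓀[E] p N).surjective b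
  obtain ⟨c, rfl⟩ := IsLocalRing.residue_surjective c
  have h1 : f c = Ideal.Quotient.mk _ a := by
    have : (g.comp (iterateFrobeniusEquiv 𝓀[E] p N).symm.toRingHom)
        (iterateFrobeniusEquiv 𝓀[E] p N (IsLocalRing.residue 𝒪[E] c)) = f c := by
      change g ((iterateFrobeniusEquiv 𝓀[E] p N).symm _) = _
      rw [RingEquiv.symm_apply_apply]
      rfl
    rw [← this, h]
  change iterateFrobenius (ModP 𝒪[E] p) p N (Ideal.Quotient.mk _ c) = _ at h1
  rw [iterateFrobenius_def, ← map_pow, Ideal.Quotient.eq, Ideal.mem_span_singleton] at h1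
  change iterateFrobenius 𝓀[E] p N _ = _
  rw [iterateFrobenius_def, ← map_pow, ← sub_eq_zero, ← map_sub, IsLocalRing.residue_eq_zero_iff]
  exact Ideal.mem_of_dvd _ h1 (not_isUnit_p p E)

/-- There is a ring homomorphism `W(k) → 𝒪_E` inducing the identity on residue fields. -/
theorem exists_wittToInteger (p : ℕ) [Fact p.Prime] (E : Type u) [NontriviallyNormedField E]
    [IsUltrametricDist E] [NormedAlgebra ℚ_[p] E] [FiniteDimensional ℚ_[p] E] :
    ∃ ι : WittVector p 𝓀[E] →+* 𝒪[E], ∀ w, IsLocalRing.residue 𝒪[E] (ι w) = w.coeff 0 := by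
  have := charP_residueField p E
  have := perfectRing_residueField p E
  have : Fact (¬ IsUnit (p : 𝒪[E])) := ⟨not_isUnit_p p E⟩
  have := isAdicComplete_p p E
  obtain ⟨σ, hσ⟩ := exists_section p E
  let τ : 𝓀[E] →+* PreTilt 𝒪[E] p := Perfection.lift p 𝓀[E] (ModP 𝒪[E] p) σ
  refine ⟨(WittVector.fontaineTheta 𝒪[E] p).comp (WittVector.map τ), fun w => ?_⟩
  refine (hσ _ _ ?_).symm
  rw [RingHom.comp_apply, WittVector.mk_fontaineTheta, WittVector.map_coeff]
  exact (RingHom.congr_fun ((Perfection.lift p 𝓀[E] (ModP 𝒪[E] p)).symm_apply_apply σ) _).symm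

/-- The ring homomorphism `W(k) → 𝒪_E` inducing the identity on residue fields (there is only one),
where `k` is the residue field of `E`. -/
def wittToInteger (p : ℕ) [Fact p.Prime] (E : Type u) [NontriviallyNormedField E]
    [IsUltrametricDist E] [NormedAlgebra ℚ_[p] E] [FiniteDimensional ℚ_[p] E] :
    WittVector p 𝓀[E] →+* 𝒪[E] :=
  (exists_wittToInteger p E).choose

theorem residue_wittToInteger (p : ℕ) [Fact p.Prime] (E : Type u) [NontriviallyNormedField E]
    [IsUltrametricDist E] [NormedAlgebra ℚ_[p] E] [FiniteDimensional ℚ_[p] E]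
    (w : WittVector p 𝓀[E]) : IsLocalRing.residue 𝒪[E] (wittToInteger p E w) = w.coeff 0 :=
  (exists_wittToInteger p E).choose_spec w

end LocalField

section RamifiedWitt

variable (p : ℕ) [Fact p.Prime] {E : Type u} [NontriviallyNormedField E] [IsUltrametricDist E]
  [NormedAlgebra ℚ_[p] E] [FiniteDimensional ℚ_[p] E]
  {R S : Type u} [CommRing R] [CommRing S]

/-- `W(R)` regarded as an algebra over `W(k)` by means of `j : k → R`. -/
def WittOver (_ : 𝓀[E] →+* R) : Type u := WittVector p R

instance (j : 𝓀[E] →+* R) : CommRing (WittOver p j) := inferInstanceAs (CommRing (WittVector p R))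

instance (j : 𝓀[E] →+* R) : Algebra (WittVector p 𝓀[E]) (WittOver p j) :=
  RingHom.toAlgebra (S := WittOver p j) (WittVector.map j)

/-- `𝒪_E` as an algebra over `W(k)`. -/
instance : Algebra (WittVector p 𝓀[E]) 𝒪[E] := (wittToInteger p E).toAlgebra

/-- `W_{𝒪_E}(R) = W(R) ⊗_{W(k)} 𝒪_E` for a ring `R` over the residue field `k` of `E`; the structure
map of `R` is `j : k → R`. -/
def RamifiedWitt (j : 𝓀[E] →+* R) : Type u :=
  TensorProduct (WittVector p 𝓀[E]) (WittOver p j) 𝒪[E]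

namespace RamifiedWitt

variable (j : 𝓀[E] →+* R) (j' : 𝓀[E] →+* S)

instance : CommRing (RamifiedWitt p j) :=
  inferInstanceAs (CommRing (TensorProduct (WittVector p 𝓀[E]) (WittOver p j) 𝒪[E]))

/-- The ring homomorphism `W(R) → W_{𝒪_E}(R)`. -/
def ofWitt : WittVector p R →+* RamifiedWitt p j :=
  (Algebra.TensorProduct.includeLeftRingHom :
    WittOver p j →+* TensorProduct (WittVector p 𝓀[E]) (WittOver p j) 𝒪[E])

/-- The ring homomorphism `𝒪_E → W_{𝒪_E}(R)`. -/
def ofInteger : 𝒪[E] →+* RamifiedWitt p j :=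
  (Algebra.TensorProduct.includeRight :
    𝒪[E] →ₐ[WittVector p 𝓀[E]] TensorProduct (WittVector p 𝓀[E]) (WittOver p j) 𝒪[E]).toRingHom

/-- The Teichmüller representative `[a]`. -/
def teichmuller : R →* RamifiedWitt p j :=
  (ofWitt p j).toMonoidHom.comp (WittVector.teichmuller p)

theorem ofInteger_wittToInteger (w : WittVector p 𝓀[E]) :
    ofInteger p j (wittToInteger p E w) = ofWitt p j (WittVector.map j w) := by
  exact ((Algebra.TensorProduct.includeRight : 𝒪[E] →ₐ[WittVector p 𝓀[E]]
    TensorProduct (WittVector p 𝓀[E]) (WittOver p j) 𝒪[E]).commutes w).trans rfl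

@[elab_as_elim]
theorem induction_on {P : RamifiedWitt p j → Prop} (z : RamifiedWitt p j) (h0 : P 0)
    (hmul : ∀ w e, P (ofWitt p j w * ofInteger p j e)) (hadd : ∀ x y, P x → P y → P (x + y)) :
    P z := by
  refine TensorProduct.induction_on (motive := P) z h0 (fun w e => ?_) hadd
  have h : ofWitt p j w * ofInteger p j e = (TensorProduct.tmul (WittVector p 𝓀[E]) (w : WittOver p j) e :
      TensorProduct (WittVector p 𝓀[E]) (WittOver p j) 𝒪[E]) := by
    refine (Algebra.TensorProduct.tmul_mul_tmul (R := WittVector p 𝓀[E])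
      (w : WittOver p j) 1 1 e).trans ?_
    rw [mul_one, one_mul]
  exact h ▸ hmul w e

/-- The ring homomorphism out of `W_{𝒪_E}(R)` given by compatible homomorphisms out of `W(R)` and
`𝒪_E`. -/
def lift (f : WittVector p R →+* S) (g : 𝒪[E] →+* S)
    (h : ∀ w, f (WittVector.map j w) = g (wittToInteger p E w)) : RamifiedWitt p j →+* S :=
  letI : Algebra (WittVector p 𝓀[E]) S := (f.comp (WittVector.map j)).toAlgebra
  (Algebra.TensorProduct.lift (⟨f, fun _ => rfl⟩ : WittOver p j →ₐ[WittVector p 𝓀[E]] S)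
    (⟨g, fun w => (h w).symm⟩ : 𝒪[E] →ₐ[WittVector p 𝓀[E]] S)
    (fun _ _ => Commute.all _ _)).toRingHom

theorem lift_ofWitt (f : WittVector p R →+* S) (g : 𝒪[E] →+* S)
    (h : ∀ w, f (WittVector.map j w) = g (wittToInteger p E w)) (w : WittVector p R) :
    lift p j f g h (ofWitt p j w) = f w := by
  let : Algebra (WittVector p 𝓀[E]) S := (f.comp (WittVector.map j)).toAlgebra
  refine (Algebra.TensorProduct.lift_tmul (R := WittVector p 𝓀[E]) (S := WittVector p 𝓀[E])
    (A := WittOver p j) (B := 𝒪[E])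
    _ _ _ w 1).trans ?_
  rw [map_one, mul_one]
  rfl

theorem lift_ofInteger (f : WittVector p R →+* S) (g : 𝒪[E] →+* S)
    (h : ∀ w, f (WittVector.map j w) = g (wittToInteger p E w)) (e : 𝒪[E]) :
    lift p j f g h (ofInteger p j e) = g e := by
  let : Algebra (WittVector p 𝓀[E]) S := (f.comp (WittVector.map j)).toAlgebra
  refine (Algebra.TensorProduct.lift_tmul (R := WittVector p 𝓀[E]) (S := WittVector p 𝓀[E])
    (A := WittOver p j) (B := 𝒪[E])
    _ _ _ 1 e).trans ?_
  rw [map_one, one_mul]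
  rfl

/-- The ring homomorphism `W_{𝒪_E}(R) → W_{𝒪_E}(S)` induced by a homomorphism `R → S` over `k`. -/
def map (f : R →+* S) (h : f.comp j = j') : RamifiedWitt p j →+* RamifiedWitt p j' :=
  lift p j ((ofWitt p j').comp (WittVector.map f)) (ofInteger p j') (fun w => by
    rw [ofInteger_wittToInteger, RingHom.comp_apply, ← h]
    congr 1)

theorem map_ofWitt (f : R →+* S) (h : f.comp j = j') (w : WittVector p R) :
    map p j j' f h (ofWitt p j w) = ofWitt p j' (WittVector.map f w) :=
  lift_ofWitt ..

theorem map_ofInteger (f : R →+* S) (h : f.comp j = j') (e : 𝒪[E]) :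
    map p j j' f h (ofInteger p j e) = ofInteger p j' e :=
  lift_ofInteger ..

theorem map_teichmuller (f : R →+* S) (h : f.comp j = j') (a : R) :
    map p j j' f h (teichmuller p j a) = teichmuller p j' (f a) := by
  change map p j j' f h (ofWitt p j _) = ofWitt p j' _
  rw [map_ofWitt, WittVector.map_teichmuller]

/-- The reduction map `W_{𝒪_E}(R) → R`. -/
def residue : RamifiedWitt p j →+* R :=
  lift p j WittVector.constantCoeff (j.comp (IsLocalRing.residue 𝒪[E])) (fun w => by
    rw [RingHom.comp_apply, residue_wittToInteger]
    exact WittVector.map_coeff ..)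

theorem residue_teichmuller (a : R) : residue p j (teichmuller p j a) = a :=
  (lift_ofWitt ..).trans (WittVector.teichmuller_coeff_zero p a)

theorem residue_ofInteger (e : 𝒪[E]) :
    residue p j (ofInteger p j e) = j (IsLocalRing.residue 𝒪[E] e) :=
  lift_ofInteger ..

variable {π : 𝒪[E]}

theorem residue_uniformizer (hπ : Irreducible π) : residue p j (ofInteger p j π) = 0 := by
  rw [residue_ofInteger, (IsLocalRing.residue_eq_zero_iff π).2 hπ.not_isUnit, map_zero]

theorem dvd_p (hπ : Irreducible π) : π ∣ (p : 𝒪[E]) := by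
  have := (isDVR_and_finite p E).1
  rw [← Ideal.mem_span_singleton, ← hπ.maximalIdeal_eq]
  exact not_isUnit_p p E

variable [CharP R p] [PerfectRing R p]

theorem dvd_ofWitt (hπ : Irreducible π) (w : WittVector p R) (hw : w.coeff 0 = 0) :
    ofInteger p j π ∣ ofWitt p j w := by
  have h1 : (p : WittVector p R) ∣ w := by
    rw [← Ideal.mem_span_singleton, WittVector.mem_span_p_iff_coeff_zero_eq_zero]
    exact hw
  have h2 := map_dvd (ofInteger p j) (dvd_p p hπ)
  rw [map_natCast] at h2
  have h3 := map_dvd (ofWitt p j) h1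
  rw [map_natCast] at h3
  exact h2.trans h3

/-- Modulo a uniformizer every element of `W_{𝒪_E}(R)` is the Teichmüller representative of its
residue. -/
theorem dvd_sub_teichmuller (hπ : Irreducible π) (z : RamifiedWitt p j) :
    ofInteger p j π ∣ z - teichmuller p j (residue p j z) := by
  have := (isDVR_and_finite p E).1
  have hsub : ∀ w : WittVector p R,
      ofInteger p j π ∣ ofWitt p j w - teichmuller p j (w.coeff 0) := by
    intro w
    have : ofWitt p j w - teichmuller p j (w.coeff 0) =
        ofWitt p j (w - WittVector.teichmuller p (w.coeff 0)) := by
      rw [map_sub]; rfl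
    rw [this]
    apply dvd_ofWitt p j hπ
    refine ((WittVector.constantCoeff : WittVector p R →+* R).map_sub _ _).trans ?_
    rw [sub_eq_zero]
    exact (WittVector.teichmuller_coeff_zero p _).symm
  induction z using induction_on with
  | h0 =>
    rw [map_zero]
    have := hsub 0
    rwa [map_zero, WittVector.zero_coeff] at this
  | hmul w e =>
    rw [map_mul, map_mul]
    have h1 := hsub w
    have hw : residue p j (ofWitt p j w) = w.coeff 0 := lift_ofWitt ..
    rw [hw, residue_ofInteger]
    have h2 : ofInteger p j π ∣ ofInteger p j e -
        teichmuller p j (j (IsLocalRing.residue 𝒪[E] e)) := by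
      set b := IsLocalRing.residue 𝒪[E] e with hb
      have h3 : teichmuller p j (j b) =
          ofInteger p j (wittToInteger p E (WittVector.teichmuller p b)) := by
        rw [ofInteger_wittToInteger, WittVector.map_teichmuller]; rfl
      rw [h3, ← map_sub]
      apply map_dvd
      rw [← Ideal.mem_span_singleton, ← hπ.maximalIdeal_eq, ← IsLocalRing.residue_eq_zero_iff,
        map_sub, residue_wittToInteger, WittVector.teichmuller_coeff_zero, hb, sub_self]
    have h4 : ∀ a a' b b' : RamifiedWitt p j,
        a * b - a' * b' = (a - a') * b + a' * (b - b') := by intros; ring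
    rw [h4]
    exact dvd_add (h1.mul_right _) (h2.mul_left _)
  | hadd x y hx hy =>
    rw [map_add]
    have h1 := hsub (WittVector.teichmuller p (residue p j x) +
      WittVector.teichmuller p (residue p j y))
    have h2 : (WittVector.teichmuller p (residue p j x) +
        WittVector.teichmuller p (residue p j y)).coeff 0 = residue p j x + residue p j y := by
      refine ((WittVector.constantCoeff : WittVector p R →+* R).map_add _ _).trans ?_
      exact congr_arg₂ _ (WittVector.teichmuller_coeff_zero p _)
        (WittVector.teichmuller_coeff_zero p _)
    rw [h2, map_add] at h1
    have h3 := dvd_add (dvd_add hx hy) h1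
    convert h3 using 1
    have h4 : ∀ a : R, ofWitt p j (WittVector.teichmuller p a) = teichmuller p j a := fun _ => rfl
    rw [h4, h4]
    ring

end RamifiedWitt

end RamifiedWitt

section Expansions

namespace RamifiedWitt

variable (p : ℕ) [Fact p.Prime] {E : Type u} [NontriviallyNormedField E] [IsUltrametricDist E]
  [NormedAlgebra ℚ_[p] E] [FiniteDimensional ℚ_[p] E]

/-- The partial sum `∑_{i < m} [b_i] π^i` in `W_{𝒪_E}(R)`. -/
def partialSum {R : Type u} [CommRing R] (j : 𝓀[E] →+* R) (π : 𝒪[E]) (b : ℕ → R) (m : ℕ) :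
    RamifiedWitt p j :=
  ∑ i ∈ Finset.range m, teichmuller p j (b i) * ofInteger p j π ^ i

theorem partialSum_succ {R : Type u} [CommRing R] (j : 𝓀[E] →+* R) (π : 𝒪[E]) (b : ℕ → R)
    (m : ℕ) : partialSum p j π b (m + 1) =
      teichmuller p j (b 0) + ofInteger p j π * partialSum p j π (fun i => b (i + 1)) m := by
  rw [partialSum, Finset.sum_range_succ', partialSum, Finset.mul_sum, add_comm]
  congr 1
  · rw [pow_zero, mul_one]
  · refine Finset.sum_congr rfl fun i _ => ?_
    rw [pow_succ]
    ring

/-- `z = ∑_{i ≥ 0} [b_i] π^i` in `W_{𝒪_E}(R)`, the series being `π`-adically convergent. -/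
def IsExpansion {R : Type u} [CommRing R] (j : 𝓀[E] →+* R) (π : 𝒪[E]) (z : RamifiedWitt p j)
    (b : ℕ → R) : Prop :=
  ∀ m, ofInteger p j π ^ m ∣ z - partialSum p j π b m

theorem exists_isExpansion {R : Type u} [CommRing R] [CharP R p] [PerfectRing R p]
    (j : 𝓀[E] →+* R) {π : 𝒪[E]} (hπ : Irreducible π) (z : RamifiedWitt p j) :
    ∃ b, IsExpansion p j π z b := by
  have h := fun z => dvd_sub_teichmuller p j hπ z
  choose q hq using h
  refine ⟨fun i => residue p j (q^[i] z), fun m => ⟨q^[m] z, ?_⟩⟩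
  induction m generalizing z with
  | zero => simp [partialSum]
  | succ m ih =>
    rw [partialSum_succ]
    have h1 := ih (q z)
    simp only [Function.iterate_succ, Function.comp_apply, Function.iterate_zero, id]
    have h2 := hq z
    linear_combination h2 + ofInteger p j π * h1

theorem uniformizer_regular {F : Type u} [Field F] [CharP F p] (j : 𝓀[E] →+* F) {π : 𝒪[E]}
    (hπ : Irreducible π) (z z' : RamifiedWitt p j)
    (hz : ofInteger p j π * z = ofInteger p j π * z') : z = z' := by
  have := charP_residueField p E
  have := perfectRing_residueField p E
  have hdom : IsDomain (WittOver p j) := inferInstanceAs (IsDomain (WittVector p F))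
  have hinj : Function.Injective (algebraMap (WittVector p 𝓀[E]) (WittOver p j)) :=
    WittVector.map_injective j j.injective
  have : Module.IsTorsionFree (WittVector p 𝓀[E]) (WittOver p j) :=
    (faithfulSMul_iff_algebraMap_injective _ _).2 hinj |>.to_isTorsionFree
  have hflat : Module.Flat (WittVector p 𝓀[E]) (WittOver p j) := inferInstance
  let f : 𝒪[E] →ₗ[WittVector p 𝓀[E]] 𝒪[E] := LinearMap.mulLeft _ π
  have hf : Function.Injective f := fun a b h => mul_left_cancel₀ hπ.ne_zero h
  have h1 := Module.Flat.lTensor_preserves_injective_linearMap (M := WittOver p j) f hf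
  have h2 : ∀ z : RamifiedWitt p j, LinearMap.lTensor (WittOver p j) f z =
      ofInteger p j π * z := by
    intro z
    refine TensorProduct.induction_on (motive := fun z : RamifiedWitt p j =>
      LinearMap.lTensor (WittOver p j) f z = ofInteger p j π * z) z ?_ (fun w e => ?_)
      (fun x y hx hy => ?_)
    · exact (map_zero _).trans (mul_zero _).symm
    · refine (LinearMap.lTensor_tmul _ _ _ _).trans ?_
      refine Eq.trans ?_ (Algebra.TensorProduct.tmul_mul_tmul (R := WittVector p 𝓀[E])
        (A := WittOver p j) (B := 𝒪[E]) 1 w π e).symm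
      rw [one_mul]
      rfl
    · exact (map_add _ _ _).trans ((congr_arg₂ _ hx hy).trans (mul_add (ofInteger p j π) x y).symm)
  exact h1 ((h2 z).trans (hz.trans (h2 z').symm))

theorem pow_regular {F : Type u} [Field F] [CharP F p] (j : 𝓀[E] →+* F) {π : 𝒪[E]}
    (hπ : Irreducible π) (n : ℕ) (z z' : RamifiedWitt p j)
    (hz : ofInteger p j π ^ n * z = ofInteger p j π ^ n * z') : z = z' := by
  induction n with
  | zero => simpa using hz
  | succ n ih =>
    apply ih
    apply uniformizer_regular p j hπ
    rw [← mul_assoc, ← mul_assoc, ← pow_succ', hz]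

theorem eq_of_dvd_partialSum_sub {F : Type u} [Field F] [CharP F p] (j : 𝓀[E] →+* F) {π : 𝒪[E]}
    (hπ : Irreducible π) (m : ℕ) (a b : ℕ → F)
    (h : ofInteger p j π ^ m ∣ partialSum p j π a m - partialSum p j π b m) :
    ∀ i < m, a i = b i := by
  induction m generalizing a b with
  | zero => intro i hi; omega
  | succ m ih =>
    obtain ⟨c, hc⟩ := h
    rw [partialSum_succ, partialSum_succ] at hc
    have h0 : a 0 = b 0 := by
      have := congr_arg (residue p j) hc
      simp only [map_sub, map_add, map_mul, map_pow, residue_uniformizer p j hπ,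
        residue_teichmuller] at this
      rw [zero_mul, zero_mul, add_zero, add_zero, zero_pow (Nat.succ_ne_zero m), zero_mul,
        sub_eq_zero] at this
      exact this
    have h1 := ih (fun i => a (i + 1)) (fun i => b (i + 1)) ⟨c, by
      apply uniformizer_regular p j hπ
      rw [h0] at hc
      rw [pow_succ'] at hc
      linear_combination hc⟩
    intro i hi
    rcases i with _ | i
    · exact h0
    · exact h1 i (by omega)

section Coefficients

variable {F : Type u} [Field F] [CharP F p] [PerfectRing F p] (j : 𝓀[E] →+* F) {π : 𝒪[E]}
  (hπ : Irreducible π)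

/-- The sequence `(z_i)` with `z = ∑_{i ≥ 0} [z_i] π^i`, for `z ∈ W_{𝒪_E}(F)`. -/
def coeff (z : RamifiedWitt p j) : ℕ → F :=
  (exists_isExpansion p j hπ z).choose

theorem isExpansion_coeff (z : RamifiedWitt p j) : IsExpansion p j π z (coeff p j hπ z) :=
  (exists_isExpansion p j hπ z).choose_spec

theorem coeff_eq_of_dvd {z : RamifiedWitt p j} {b : ℕ → F} {m : ℕ}
    (h : ofInteger p j π ^ m ∣ z - partialSum p j π b m) : ∀ i < m, coeff p j hπ z i = b i := by
  apply eq_of_dvd_partialSum_sub p j hπ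
  have := dvd_sub h (isExpansion_coeff p j hπ z m)
  rwa [sub_sub_sub_cancel_left] at this

theorem coeff_eq {z : RamifiedWitt p j} {b : ℕ → F} (h : IsExpansion p j π z b) :
    coeff p j hπ z = b :=
  funext fun i => coeff_eq_of_dvd p j hπ (h (i + 1)) i (Nat.lt_succ_self i)

theorem coeff_congr {z z' : RamifiedWitt p j} {m : ℕ} (h : ofInteger p j π ^ m ∣ z - z') :
    ∀ i < m, coeff p j hπ z i = coeff p j hπ z' i := by
  apply coeff_eq_of_dvd
  have := dvd_add h (isExpansion_coeff p j hπ z' m)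
  rwa [sub_add_sub_cancel] at this

theorem coeff_teichmuller_mul (c : F) (z : RamifiedWitt p j) (i : ℕ) :
    coeff p j hπ (teichmuller p j c * z) i = c * coeff p j hπ z i := by
  refine congr_fun (coeff_eq p j hπ (b := fun i => c * coeff p j hπ z i) fun m => ?_) i
  have h := (isExpansion_coeff p j hπ z m).mul_left (teichmuller p j c)
  convert h using 1
  rw [mul_sub, partialSum, partialSum, Finset.mul_sum]
  congr 1
  refine Finset.sum_congr rfl fun i _ => ?_
  rw [map_mul, mul_assoc]

theorem coeff_uniformizer_mul (z : RamifiedWitt p j) :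
    coeff p j hπ (ofInteger p j π * z) = fun i => Nat.casesOn i 0 (coeff p j hπ z) := by
  apply coeff_eq
  intro m
  rcases m with _ | m
  · simp
  · rw [partialSum_succ]
    have h := mul_dvd_mul_left (ofInteger p j π) (isExpansion_coeff p j hπ z m)
    rw [← pow_succ'] at h
    convert h using 1
    have h0 : teichmuller p j (0 : F) = 0 := by
      change ofWitt p j _ = 0
      rw [WittVector.teichmuller_zero, map_zero]
    change _ - (teichmuller p j 0 + _) = _
    rw [h0]
    ring

theorem coeff_pow_mul (n : ℕ) (z : RamifiedWitt p j) (i : ℕ) :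
    coeff p j hπ (ofInteger p j π ^ n * z) (i + n) = coeff p j hπ z i := by
  induction n with
  | zero => rw [pow_zero, one_mul, add_zero]
  | succ n ih => rw [pow_succ', mul_assoc, coeff_uniformizer_mul, ← ih]; rfl

theorem coeff_pow_mul_of_lt (n : ℕ) (z : RamifiedWitt p j) (i : ℕ) (hi : i < n) :
    coeff p j hπ (ofInteger p j π ^ n * z) i = 0 := by
  induction n generalizing i with
  | zero => omega
  | succ n ih =>
    rw [pow_succ', mul_assoc, coeff_uniformizer_mul]
    rcases i with _ | i
    · rfl
    · exact ih i (by omega)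

theorem coeff_zero (i : ℕ) : coeff p j hπ 0 i = 0 := by
  rw [← mul_zero (ofInteger p j π ^ (i + 1))]
  exact coeff_pow_mul_of_lt p j hπ (i + 1) 0 i (Nat.lt_succ_self i)

theorem dvd_of_coeff_eq_zero {z : RamifiedWitt p j} {m : ℕ}
    (h : ∀ i < m, coeff p j hπ z i = 0) : ofInteger p j π ^ m ∣ z := by
  have h0 : teichmuller p j (0 : F) = 0 := by
    change ofWitt p j _ = 0
    rw [WittVector.teichmuller_zero, map_zero]
  have h1 : partialSum p j π (coeff p j hπ z) m = 0 :=
    Finset.sum_eq_zero fun i hi => by rw [h i (Finset.mem_range.1 hi), h0, zero_mul]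
  have := isExpansion_coeff p j hπ z m
  rwa [h1, sub_zero] at this

end Coefficients

end RamifiedWitt

end Expansions

section PerfectoidField

variable (p : ℕ) [Fact p.Prime] (E : Type u) [NontriviallyNormedField E] [IsUltrametricDist E]
  [NormedAlgebra ℚ_[p] E] [FiniteDimensional ℚ_[p] E]
  (F : Type u) [NontriviallyNormedField F] [IsUltrametricDist F] [Algebra 𝓀[E] F]

theorem charP_integer [CharP F p] : CharP 𝒪[F] p :=
  (CharP.charP_iff_prime_eq_zero Fact.out).2 <| Subtype.ext <| by
    push_cast
    exact CharP.cast_eq_zero F p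

theorem perfectRing_integer [CharP F p] [PerfectRing F p] [CharP 𝒪[F] p] :
    PerfectRing 𝒪[F] p := by
  refine ⟨fun x y h => ?_, fun x => ?_⟩
  · exact Subtype.ext ((frobeniusEquiv F p).injective (congr_arg Subtype.val h))
  · obtain ⟨y, hy⟩ := (frobeniusEquiv F p).surjective x
    have hy' : y ^ p = x := hy
    have hy1 : ‖y‖ ≤ 1 := by
      refine (pow_le_one_iff_of_nonneg (norm_nonneg y) (Fact.out : p.Prime).ne_zero).1 ?_
      rw [← norm_pow, hy']
      exact Valued.integer.mem_iff.1 x.2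
    exact ⟨⟨y, Valued.integer.mem_iff.2 hy1⟩, Subtype.ext hy'⟩

/-- The residue field of `E` maps into `𝒪_F`. -/
def residueFieldToInteger : 𝓀[E] →+* 𝒪[F] :=
  (algebraMap 𝓀[E] F).codRestrict 𝒪[F] (fun x => by
    have := (isDVR_and_finite p E).2
    have := Fintype.ofFinite 𝓀[E]
    rw [Valued.integer.mem_iff]
    by_cases hx : x = 0
    · rw [hx, map_zero, norm_zero]; exact zero_le_one
    · have h1 : x ^ (Fintype.card 𝓀[E] - 1) = 1 := FiniteField.pow_card_sub_one_eq_one x hx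
      have h2 : Fintype.card 𝓀[E] - 1 ≠ 0 := by
        have := Fintype.one_lt_card (α := 𝓀[E]); omega
      refine (pow_le_one_iff_of_nonneg (norm_nonneg _) h2).1 ?_
      rw [← norm_pow, ← map_pow, h1, map_one, norm_one])

/-- `B^{b,+} = W_{𝒪_E}(𝒪_F)`. -/
abbrev BbPlus : Type u := RamifiedWitt p (residueFieldToInteger p E F)

/-- `W_{𝒪_E}(F)`. -/
abbrev WittF : Type u := RamifiedWitt p (algebraMap 𝓀[E] F)

/-- The homomorphism `W_{𝒪_E}(𝒪_F) → W_{𝒪_E}(F)`. -/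
abbrev toWittF : BbPlus p E F →+* WittF p E F :=
  RamifiedWitt.map p _ _ (Subring.subtype 𝒪[F]) (RingHom.ext fun _ => rfl)

section Bounds

open RamifiedWitt

variable {E F}

theorem map_partialSum (π : 𝒪[E]) (b : ℕ → 𝒪[F]) (m : ℕ) :
    toWittF p E F (partialSum p _ π b m) = partialSum p _ π (fun i => (b i : F)) m := by
  rw [partialSum, partialSum, map_sum]
  refine Finset.sum_congr rfl fun i _ => ?_
  rw [map_mul, map_pow, RamifiedWitt.map_teichmuller, RamifiedWitt.map_ofInteger]
  rfl

variable [CharP F p] [PerfectRing F p] {π : 𝒪[E]} (hπ : Irreducible π)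

theorem norm_coeff_toWittF (z : BbPlus p E F) (i : ℕ) :
    ‖coeff p _ hπ (toWittF p E F z) i‖ ≤ 1 := by
  have := charP_integer p F
  have := perfectRing_integer p F
  obtain ⟨b, hb⟩ := exists_isExpansion p _ hπ z
  have : coeff p _ hπ (toWittF p E F z) = fun i => (b i : F) := by
    apply coeff_eq
    intro m
    have := map_dvd (toWittF p E F) (hb m)
    rwa [map_pow, RamifiedWitt.map_ofInteger, map_sub, map_partialSum] at this
  rw [this]
  exact Valued.integer.mem_iff.1 (b i).2

theorem exists_toWittF {z : WittF p E F} {m : ℕ} (h : ∀ i < m, ‖coeff p _ hπ z i‖ ≤ 1) :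
    ∃ y : BbPlus p E F, ofInteger p _ π ^ m ∣ z - toWittF p E F y := by
  classical
  refine ⟨partialSum p _ π (fun i => if hi : i < m then
    ⟨coeff p _ hπ z i, Valued.integer.mem_iff.2 (h i hi)⟩ else 0) m, ?_⟩
  rw [map_partialSum p π]
  convert isExpansion_coeff p _ hπ z m using 2
  refine Finset.sum_congr rfl fun i hi => ?_
  beta_reduce
  rw [dif_pos (Finset.mem_range.1 hi)]

theorem norm_coeff_add_le {x y : WittF p E F} {m : ℕ} {C : ℝ}
    (hx : ∀ i < m, ‖coeff p _ hπ x i‖ ≤ C) (hy : ∀ i < m, ‖coeff p _ hπ y i‖ ≤ C) :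
    ∀ i < m, ‖coeff p _ hπ (x + y) i‖ ≤ C := by
  intro k hk
  have hC : 0 ≤ C := (norm_nonneg _).trans (hx k hk)
  obtain ⟨c, hcC, hcx, hcy⟩ : ∃ c : F, ‖c‖ ≤ C ∧ (∀ i < m, ‖coeff p _ hπ x i‖ ≤ ‖c‖) ∧
      ∀ i < m, ‖coeff p _ hπ y i‖ ≤ ‖c‖ := by
    classical
    let s : Finset F := insert 0 ((Finset.range m).image (coeff p _ hπ x) ∪
      (Finset.range m).image (coeff p _ hπ y))
    obtain ⟨c, hc, hmax⟩ := s.exists_max_image (fun c => ‖c‖) ⟨0, Finset.mem_insert_self _ _⟩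
    refine ⟨c, ?_, fun i hi => hmax _ ?_, fun i hi => hmax _ ?_⟩
    · simp only [s, Finset.mem_insert, Finset.mem_union, Finset.mem_image, Finset.mem_range] at hc
      rcases hc with rfl | ⟨i, hi, rfl⟩ | ⟨i, hi, rfl⟩
      · rw [norm_zero]; exact hC
      · exact hx i hi
      · exact hy i hi
    · exact Finset.mem_insert_of_mem (Finset.mem_union_left _
        (Finset.mem_image_of_mem _ (Finset.mem_range.2 hi)))
    · exact Finset.mem_insert_of_mem (Finset.mem_union_right _
        (Finset.mem_image_of_mem _ (Finset.mem_range.2 hi)))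
  refine le_trans ?_ hcC
  by_cases hc : c = 0
  · simp only [hc, norm_zero, norm_le_zero_iff] at hcx hcy
    have h1 := dvd_add (dvd_of_coeff_eq_zero p _ hπ hcx) (dvd_of_coeff_eq_zero p _ hπ hcy)
    obtain ⟨w, hw⟩ := h1
    rw [hw, coeff_pow_mul_of_lt p _ hπ m w k hk, norm_zero]
    exact norm_nonneg c
  · have hc' : 0 < ‖c‖ := norm_pos_iff.2 hc
    have key : ∀ z : WittF p E F, (∀ i < m, ‖coeff p _ hπ z i‖ ≤ ‖c‖) →
        ∃ y : BbPlus p E F, ofInteger p _ π ^ m ∣ teichmuller p _ c⁻¹ * z - toWittF p E F y := by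
      intro z hz
      apply exists_toWittF p hπ
      intro i hi
      rw [coeff_teichmuller_mul, norm_mul, norm_inv, inv_mul_le_one₀ hc']
      exact hz i hi
    obtain ⟨x', hx'⟩ := key x hcx
    obtain ⟨y', hy'⟩ := key y hcy
    have h1 : ofInteger p _ π ^ m ∣ teichmuller p _ c⁻¹ * (x + y) - toWittF p E F (x' + y') := by
      rw [map_add, mul_add, add_sub_add_comm]
      exact dvd_add hx' hy'
    have h2 := norm_coeff_toWittF p hπ (x' + y') k
    rw [← coeff_congr p _ hπ h1 k hk, coeff_teichmuller_mul, norm_mul, norm_inv,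
      inv_mul_le_one₀ hc'] at h2
    exact h2

theorem norm_coeff_sum_le {ι : Type*} (s : Finset ι) (x : ι → WittF p E F) {m : ℕ} {C : ℝ}
    (hC : 0 ≤ C) (hx : ∀ k ∈ s, ∀ i < m, ‖coeff p _ hπ (x k) i‖ ≤ C) :
    ∀ i < m, ‖coeff p _ hπ (∑ k ∈ s, x k) i‖ ≤ C := by
  classical
  induction s using Finset.induction_on with
  | empty =>
    intro i _
    rw [Finset.sum_empty, coeff_zero, norm_zero]
    exact hC
  | insert a s ha ih =>
    rw [Finset.sum_insert ha]
    exact norm_coeff_add_le p hπ (hx a (Finset.mem_insert_self _ _))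
      (ih fun k hk => hx k (Finset.mem_insert_of_mem hk))

theorem weighted_add {ρ C : ℝ} (h0 : 0 < ρ) (h1 : ρ ≤ 1) {x y : WittF p E F}
    (hx : ∀ i, ‖coeff p _ hπ x i‖ * ρ ^ i ≤ C) (hy : ∀ i, ‖coeff p _ hπ y i‖ * ρ ^ i ≤ C) (i : ℕ) :
    ‖coeff p _ hπ (x + y) i‖ * ρ ^ i ≤ C := by
  have hC : 0 ≤ C := (mul_nonneg (norm_nonneg _) (pow_nonneg h0.le _)).trans (hx 0)
  rw [← le_div_iff₀ (pow_pos h0 i)]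
  have key : ∀ z : WittF p E F, (∀ i, ‖coeff p _ hπ z i‖ * ρ ^ i ≤ C) →
      ∀ k < i + 1, ‖coeff p _ hπ z k‖ ≤ C / ρ ^ i := by
    intro z hz k hk
    have := hz k
    rw [← le_div_iff₀ (pow_pos h0 k)] at this
    exact this.trans (div_le_div_of_nonneg_left hC (pow_pos h0 i)
      (pow_le_pow_of_le_one h0.le h1 (by omega)))
  exact norm_coeff_add_le p hπ (key x hx) (key y hy) i (Nat.lt_succ_self i)

theorem weighted_mul {ρ C D : ℝ} (h0 : 0 < ρ) (h1 : ρ ≤ 1) {x y : WittF p E F}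
    (hx : ∀ i, ‖coeff p _ hπ x i‖ * ρ ^ i ≤ C) (hy : ∀ i, ‖coeff p _ hπ y i‖ * ρ ^ i ≤ D) (i : ℕ) :
    ‖coeff p _ hπ (x * y) i‖ * ρ ^ i ≤ C * D := by
  have hC : 0 ≤ C := (mul_nonneg (norm_nonneg _) (pow_nonneg h0.le _)).trans (hx 0)
  have hD : 0 ≤ D := (mul_nonneg (norm_nonneg _) (pow_nonneg h0.le _)).trans (hy 0)
  rw [← le_div_iff₀ (pow_pos h0 i)]
  have h2 : ofInteger p _ π ^ (i + 1) ∣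
      x * y - ∑ k ∈ Finset.range (i + 1), ofInteger p _ π ^ k *
        (teichmuller p _ (coeff p _ hπ x k) * y) := by
    have := (isExpansion_coeff p _ hπ x (i + 1)).mul_right y
    convert this using 1
    rw [sub_mul, partialSum, Finset.sum_mul]
    congr 1
    exact Finset.sum_congr rfl fun k _ => by ring
  rw [coeff_congr p _ hπ h2 i (Nat.lt_succ_self i)]
  refine norm_coeff_sum_le p hπ _ _ (div_nonneg (mul_nonneg hC hD) (pow_pos h0 i).le) ?_ i
    (Nat.lt_succ_self i)
  intro k _ l hl
  by_cases hkl : l < k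
  · rw [coeff_pow_mul_of_lt p _ hπ _ _ _ hkl, norm_zero]
    exact div_nonneg (mul_nonneg hC hD) (pow_pos h0 i).le
  · obtain ⟨n, rfl⟩ : ∃ n, l = n + k := ⟨l - k, by omega⟩
    rw [coeff_pow_mul, coeff_teichmuller_mul, norm_mul, le_div_iff₀ (pow_pos h0 i)]
    calc ‖coeff p _ hπ x k‖ * ‖coeff p _ hπ y n‖ * ρ ^ i
        ≤ ‖coeff p _ hπ x k‖ * ‖coeff p _ hπ y n‖ * ρ ^ (n + k) :=
          mul_le_mul_of_nonneg_left (pow_le_pow_of_le_one h0.le h1 (by omega))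
            (mul_nonneg (norm_nonneg _) (norm_nonneg _))
      _ = (‖coeff p _ hπ x k‖ * ρ ^ k) * (‖coeff p _ hπ y n‖ * ρ ^ n) := by ring
      _ ≤ C * D := mul_le_mul (hx k) (hy n) (mul_nonneg (norm_nonneg _) (pow_nonneg h0.le _)) hC

end Bounds

section RingBb

open RamifiedWitt

/-- `W_{𝒪_E}(F)[1/π]`. -/
abbrev WittFInv (π : 𝒪[E]) : Type u :=
  Localization.Away (ofInteger p (algebraMap 𝓀[E] F) π)

variable {E F}

/-- `z = ∑_{n ≫ -∞} [a_n] π^n` in `W_{𝒪_E}(F)[1/π]`: for some `N`, the coefficients `a_n` vanish for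
`n < -N`, and `π^N z` lies in `W_{𝒪_E}(F)` and is equal to `∑_{i ≥ 0} [a_{i - N}] π^i`. -/
def IsTeichmullerExpansion {π : 𝒪[E]} (z : WittFInv p E F π) (a : ℤ → F) : Prop :=
  ∃ N : ℕ, (∀ n : ℤ, n < -N → a n = 0) ∧ ∃ y : WittF p E F,
    algebraMap (WittF p E F) (WittFInv p E F π) y =
      algebraMap (WittF p E F) (WittFInv p E F π) (ofInteger p _ π) ^ N * z ∧
    IsExpansion p _ π y (fun i => a (i - N))

theorem exists_pow_mul {π : 𝒪[E]} (z : WittFInv p E F π) : ∃ (N : ℕ) (y : WittF p E F),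
    algebraMap (WittF p E F) (WittFInv p E F π) y =
      algebraMap (WittF p E F) (WittFInv p E F π) (ofInteger p _ π) ^ N * z := by
  obtain ⟨n, a, h⟩ := IsLocalization.Away.surj (ofInteger p (algebraMap 𝓀[E] F) π) z
  exact ⟨n, a, by rw [mul_comm, h]⟩

theorem pow_mul_of_le {π : 𝒪[E]} {z : WittFInv p E F π} {N : ℕ} {y : WittF p E F}
    (h : algebraMap (WittF p E F) (WittFInv p E F π) y =
      algebraMap (WittF p E F) (WittFInv p E F π) (ofInteger p _ π) ^ N * z) (M : ℕ) :
    algebraMap (WittF p E F) (WittFInv p E F π) (ofInteger p _ π ^ M * y) =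
      algebraMap (WittF p E F) (WittFInv p E F π) (ofInteger p _ π) ^ (M + N) * z := by
  rw [map_mul, map_pow, h, pow_add, mul_assoc]

variable [CharP F p]

theorem algebraMap_injective {π : 𝒪[E]} (hπ : Irreducible π) :
    Function.Injective (algebraMap (WittF p E F) (WittFInv p E F π)) := by
  apply IsLocalization.injective (M := Submonoid.powers (ofInteger p (algebraMap 𝓀[E] F) π))
  rw [Submonoid.powers_le, mem_nonZeroDivisors_iff_left]
  intro x hx
  exact uniformizer_regular p _ hπ _ _ (by rw [hx, mul_zero])

variable [PerfectRing F p] {π : 𝒪[E]}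

theorem exists_isTeichmullerExpansion (hπ : Irreducible π) (z : WittFInv p E F π) :
    ∃ a, IsTeichmullerExpansion p z a := by
  obtain ⟨N, y, hy⟩ := exists_pow_mul p z
  refine ⟨fun n => if n < -N then 0 else coeff p _ hπ y (n + N).toNat, N, fun n hn => if_pos hn,
    y, hy, ?_⟩
  convert isExpansion_coeff p _ hπ y using 2 with i
  beta_reduce
  rw [if_neg (by omega)]
  congr 1
  omega

variable (hπ : Irreducible π)

theorem IsTeichmullerExpansion.apply_eq {z : WittFInv p E F π} {a : ℤ → F}
    (h : IsTeichmullerExpansion p z a) {N : ℕ} {y : WittF p E F}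
    (hy : algebraMap (WittF p E F) (WittFInv p E F π) y =
      algebraMap (WittF p E F) (WittFInv p E F π) (ofInteger p _ π) ^ N * z) :
    (∀ n : ℤ, n < -N → a n = 0) ∧ ∀ i : ℕ, a (i - N) = coeff p _ hπ y i := by
  obtain ⟨N', ha, y', hy', hE⟩ := h
  have h1 : ofInteger p _ π ^ N' * y = ofInteger p _ π ^ N * y' := by
    apply algebraMap_injective p hπ
    rw [pow_mul_of_le p hy, pow_mul_of_le p hy', add_comm]
  have h2 := coeff_eq p _ hπ hE
  have key : ∀ k : ℕ, coeff p _ hπ (ofInteger p _ π ^ N' * y) k = a (k - N - N') := by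
    intro k
    rw [h1]
    by_cases hk : k < N
    · rw [coeff_pow_mul_of_lt p _ hπ _ _ _ hk, ha _ (by omega)]
    · obtain ⟨m, rfl⟩ : ∃ m, k = m + N := ⟨k - N, by omega⟩
      rw [coeff_pow_mul, h2]
      beta_reduce
      congr 1
      push_cast
      ring
  constructor
  · intro n hn
    by_cases hn' : n < -N'
    · exact ha n hn'
    · have := key (n + N + N').toNat
      rw [coeff_pow_mul_of_lt p _ hπ _ _ _ (by omega)] at this
      rw [this]
      congr 1
      omega
  · intro i
    have := key (i + N')
    rw [coeff_pow_mul] at this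
    rw [this]
    congr 1
    push_cast
    ring

/-- The sequence `(z_n)` with `z = ∑_{n ≫ -∞} [z_n] π^n`, for `z ∈ W_{𝒪_E}(F)[1/π]`. -/
def teichmullerCoeff (z : WittFInv p E F π) : ℤ → F :=
  (exists_isTeichmullerExpansion p hπ z).choose

theorem isTeichmullerExpansion (z : WittFInv p E F π) :
    IsTeichmullerExpansion p z (teichmullerCoeff p hπ z) :=
  (exists_isTeichmullerExpansion p hπ z).choose_spec

theorem bound_iff {z : WittFInv p E F π} {N : ℕ} {y : WittF p E F}
    (hy : algebraMap (WittF p E F) (WittFInv p E F π) y =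
      algebraMap (WittF p E F) (WittFInv p E F π) (ofInteger p _ π) ^ N * z)
    {ρ C : ℝ} (h0 : 0 < ρ) :
    (∀ n : ℤ, ‖teichmullerCoeff p hπ z n‖ * ρ ^ n ≤ C) ↔
      ∀ i : ℕ, ‖coeff p _ hπ y i‖ * ρ ^ i ≤ C * ρ ^ N := by
  obtain ⟨h1, h2⟩ := (isTeichmullerExpansion p hπ z).apply_eq p hπ hy
  have h3 : ∀ i : ℕ, ρ ^ ((i : ℤ) - N) = ρ ^ i / ρ ^ N := fun i => by
    rw [zpow_sub₀ h0.ne', zpow_natCast, zpow_natCast]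
  have hN := pow_pos h0 N
  constructor
  · intro h i
    have := h (i - N)
    rwa [h2, h3, ← mul_div_assoc, div_le_iff₀ hN] at this
  · intro h n
    by_cases hn : n < -N
    · rw [h1 n hn, norm_zero, zero_mul]
      have := (mul_nonneg (norm_nonneg (coeff p _ hπ y 0)) (pow_nonneg h0.le 0)).trans (h 0)
      exact nonneg_of_mul_nonneg_left this hN
    · obtain ⟨i, rfl⟩ : ∃ i : ℕ, n = i - N := ⟨(n + N).toNat, by omega⟩
      rw [h2, h3, ← mul_div_assoc, div_le_iff₀ hN]
      exact h i

theorem bound_add {x y : WittFInv p E F π} {ρ C : ℝ} (h0 : 0 < ρ) (h1 : ρ ≤ 1)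
    (hx : ∀ n, ‖teichmullerCoeff p hπ x n‖ * ρ ^ n ≤ C)
    (hy : ∀ n, ‖teichmullerCoeff p hπ y n‖ * ρ ^ n ≤ C) :
    ∀ n, ‖teichmullerCoeff p hπ (x + y) n‖ * ρ ^ n ≤ C := by
  obtain ⟨N, x', hx'⟩ := exists_pow_mul p x
  obtain ⟨M, y', hy'⟩ := exists_pow_mul p y
  have hx'' := pow_mul_of_le p hx' M
  have hy'' := pow_mul_of_le p hy' N
  rw [add_comm N M] at hy''
  rw [bound_iff p hπ hx'' h0] at hx
  rw [bound_iff p hπ hy'' h0] at hy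
  refine (bound_iff p hπ (y := ofInteger p _ π ^ M * x' + ofInteger p _ π ^ N * y') ?_ h0).2
    (weighted_add p hπ h0 h1 hx hy)
  rw [map_add, hx'', hy'', mul_add]

theorem bound_mul {x y : WittFInv p E F π} {ρ C D : ℝ} (h0 : 0 < ρ) (h1 : ρ ≤ 1)
    (hx : ∀ n, ‖teichmullerCoeff p hπ x n‖ * ρ ^ n ≤ C)
    (hy : ∀ n, ‖teichmullerCoeff p hπ y n‖ * ρ ^ n ≤ D) :
    ∀ n, ‖teichmullerCoeff p hπ (x * y) n‖ * ρ ^ n ≤ C * D := by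
  obtain ⟨N, x', hx'⟩ := exists_pow_mul p x
  obtain ⟨M, y', hy'⟩ := exists_pow_mul p y
  rw [bound_iff p hπ hx' h0] at hx
  rw [bound_iff p hπ hy' h0] at hy
  refine (bound_iff p hπ (N := N + M) (y := x' * y') ?_ h0).2 ?_
  · rw [map_mul, hx', hy', pow_add]
    ring
  · have := weighted_mul p hπ h0 h1 hx hy
    intro i
    rw [pow_add]
    exact (this i).trans_eq (by ring)

/-- The homomorphism `B^{b,+} = W_{𝒪_E}(𝒪_F) → W_{𝒪_E}(F)[1/π]`. -/
def toWittFInv (π : 𝒪[E]) : BbPlus p E F →+* WittFInv p E F π :=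
  (algebraMap (WittF p E F) (WittFInv p E F π)).comp (toWittF p E F)

theorem toWittF_ofInteger (e : 𝒪[E]) :
    toWittF p E F (ofInteger p _ e) = ofInteger p _ e :=
  RamifiedWitt.map_ofInteger ..

theorem toWittF_teichmuller (c : 𝒪[F]) :
    toWittF p E F (teichmuller p _ c) = teichmuller p _ (c : F) :=
  RamifiedWitt.map_teichmuller ..

theorem bound_toWittFInv (z : BbPlus p E F) {ρ : ℝ} (h0 : 0 < ρ) (h1 : ρ ≤ 1) (n : ℤ) :
    ‖teichmullerCoeff p hπ (toWittFInv p π z) n‖ * ρ ^ n ≤ 1 := by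
  revert n
  rw [bound_iff p hπ (N := 0) (y := toWittF p E F z) (by rw [pow_zero, one_mul]; rfl) h0]
  intro i
  rw [pow_zero, one_mul]
  exact mul_le_one₀ (norm_coeff_toWittF p hπ z i) (pow_nonneg h0.le i) (pow_le_one₀ h0.le h1)

theorem bound_uniformizer {ρ : ℝ} (h0 : 0 < ρ) (h1 : ρ ≤ 1) (n : ℤ) :
    ‖teichmullerCoeff p hπ (toWittFInv p π (ofInteger p (residueFieldToInteger p E F) π)) n‖ *
      ρ ^ n ≤ ρ := by
  revert n
  rw [bound_iff p hπ (N := 0) (y := ofInteger p _ π * 1) (by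
    rw [pow_zero, one_mul, mul_one]
    exact congr_arg _ (toWittF_ofInteger p π).symm) h0, pow_zero, mul_one ρ]
  rintro (_ | i)
  · rw [coeff_uniformizer_mul]
    change ‖(0 : F)‖ * _ ≤ _
    rw [norm_zero, zero_mul]
    exact h0.le
  · rw [coeff_uniformizer_mul]
    change ‖coeff p (algebraMap 𝓀[E] F) hπ 1 i‖ * ρ ^ (i + 1) ≤ ρ
    have h2 : ‖coeff p (algebraMap 𝓀[E] F) hπ 1 i‖ ≤ 1 := by
      rw [← map_one (toWittF p E F)]
      exact norm_coeff_toWittF p hπ 1 i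
    calc ‖coeff p (algebraMap 𝓀[E] F) hπ 1 i‖ * ρ ^ (i + 1) ≤ 1 * ρ ^ (i + 1) :=
          mul_le_mul_of_nonneg_right h2 (pow_nonneg h0.le _)
      _ ≤ ρ := by
        rw [one_mul]
        exact (pow_le_pow_of_le_one h0.le h1 (Nat.le_add_left 1 i)).trans_eq (pow_one ρ)

theorem bound_teichmuller (c : 𝒪[F]) {ρ : ℝ} (h0 : 0 < ρ) (h1 : ρ ≤ 1) (n : ℤ) :
    ‖teichmullerCoeff p hπ (toWittFInv p π (teichmuller p (residueFieldToInteger p E F) c)) n‖ *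
      ρ ^ n ≤ ‖c‖ := by
  revert n
  rw [bound_iff p hπ (N := 0) (y := teichmuller p _ (c : F) * 1) (by
    rw [pow_zero, one_mul, mul_one]
    exact congr_arg _ (toWittF_teichmuller p c).symm) h0, pow_zero, mul_one ‖c‖]
  intro i
  rw [coeff_teichmuller_mul, norm_mul, mul_assoc]
  have h2 : ‖coeff p (algebraMap 𝓀[E] F) hπ 1 i‖ ≤ 1 := by
    rw [← map_one (toWittF p E F)]
    exact norm_coeff_toWittF p hπ 1 i
  exact mul_le_of_le_one_right (norm_nonneg _)
    (mul_le_one₀ h2 (pow_nonneg h0.le i) (pow_le_one₀ h0.le h1))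

/-- `B^b`: the subring of those `∑ [x_n] π^n` in `W_{𝒪_E}(F)[1/π]` for which `|x_n|` is bounded. -/
def Bb : Subring (WittFInv p E F π) where
  carrier := {x | ∃ C : ℝ, ∀ n, ‖teichmullerCoeff p hπ x n‖ ≤ C}
  add_mem' := by
    rintro x y ⟨C, hC⟩ ⟨D, hD⟩
    refine ⟨max C D, ?_⟩
    have := bound_add p hπ (ρ := 1) (C := max C D) one_pos le_rfl (x := x) (y := y)
      (fun n => by simpa using Or.inl (hC n)) (fun n => by simpa using Or.inr (hD n))
    simpa using this
  mul_mem' := by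
    rintro x y ⟨C, hC⟩ ⟨D, hD⟩
    refine ⟨C * D, ?_⟩
    have := bound_mul p hπ (ρ := 1) one_pos le_rfl (x := x) (y := y)
      (fun n => by simpa using hC n) (fun n => by simpa using hD n)
    simpa using this
  zero_mem' := ⟨1, fun n => by
    have := bound_toWittFInv p hπ (F := F) 0 one_pos le_rfl n
    simpa using this⟩
  one_mem' := ⟨1, fun n => by
    have := bound_toWittFInv p hπ (F := F) 1 one_pos le_rfl n
    simpa using this⟩
  neg_mem' := by
    rintro x ⟨C, hC⟩
    refine ⟨1 * C, ?_⟩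
    have := bound_mul p hπ (ρ := 1) one_pos le_rfl (y := x)
      (fun n => bound_toWittFInv p hπ (-1) one_pos le_rfl n) (fun n => by simpa using hC n)
    simpa using this

/-- The homomorphism `B^{b,+} → B^b`. -/
def toBb : BbPlus p E F →+* Bb p (F := F) hπ :=
  (toWittFInv p π).codRestrict (Bb p hπ) (fun z => ⟨1, fun n => by
    have := bound_toWittFInv p hπ z one_pos le_rfl n
    simpa using this⟩)

end RingBb

section RingBI

open RamifiedWitt

variable {E F}
variable [CharP F p] [PerfectRing F p] {π : 𝒪[E]} (hπ : Irreducible π)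

/-- The norm `|x|_ρ = sup_n |x_n| ρ^n` of `x = ∑ [x_n] π^n`. -/
def gaussNorm (ρ : ℝ) (x : WittFInv p E F π) : ℝ :=
  ⨆ n : ℤ, ‖teichmullerCoeff p hπ x n‖ * ρ ^ n

/-- The closed intervals `I ⊆ (0, 1)` (nonempty, possibly reduced to a point), ordered by
inclusion. -/
abbrev ClosedInterval : Type := NonemptyInterval (Set.Ioo (0 : ℝ) 1)

/-- The norm `|x|_I = sup_{ρ ∈ I} |x|_ρ`. -/
def intervalNorm (I : ClosedInterval) (x : WittFInv p E F π) : ℝ :=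
  ⨆ ρ : Set.Icc (I.fst : ℝ) (I.snd : ℝ), gaussNorm p hπ (ρ : ℝ) x

theorem mem_interval_bounds {I : ClosedInterval} {ρ : ℝ}
    (h : ρ ∈ Set.Icc (I.fst : ℝ) (I.snd : ℝ)) : 0 < ρ ∧ ρ ≤ 1 :=
  ⟨I.fst.2.1.trans_le h.1, h.2.trans I.snd.2.2.le⟩

instance (I : ClosedInterval) : Nonempty (Set.Icc (I.fst : ℝ) (I.snd : ℝ)) :=
  ⟨⟨I.fst, le_rfl, I.fst_le_snd⟩⟩

theorem exists_bound {x : WittFInv p E F π} (hx : x ∈ Bb p hπ) (I : ClosedInterval) :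
    ∃ C : ℝ, ∀ ρ ∈ Set.Icc (I.fst : ℝ) (I.snd : ℝ), ∀ n,
      ‖teichmullerCoeff p hπ x n‖ * ρ ^ n ≤ C := by
  obtain ⟨C, hC⟩ := hx
  obtain ⟨N, h1, -⟩ := isTeichmullerExpansion p hπ x
  have hC0 : 0 ≤ C := (norm_nonneg _).trans (hC 0)
  have hr := I.fst.2.1
  refine ⟨C * ((I.fst : ℝ) ^ N)⁻¹, fun ρ hρ n => ?_⟩
  obtain ⟨h0, hρ1⟩ := mem_interval_bounds hρ
  by_cases hn : n < -N
  · rw [h1 n hn, norm_zero, zero_mul]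
    positivity
  · refine mul_le_mul (hC n) ?_ (zpow_nonneg h0.le n) hC0
    calc ρ ^ n ≤ ρ ^ (-(N : ℤ)) := zpow_le_zpow_right_of_le_one₀ h0 hρ1 (by omega)
      _ = (ρ ^ N)⁻¹ := by rw [zpow_neg, zpow_natCast]
      _ ≤ ((I.fst : ℝ) ^ N)⁻¹ := inv_anti₀ (pow_pos hr N) (pow_le_pow_left₀ hr.le hρ.1 N)

theorem intervalNorm_le_iff {x : WittFInv p E F π} (hx : x ∈ Bb p hπ) (I : ClosedInterval)
    {C : ℝ} : intervalNorm p hπ I x ≤ C ↔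
      ∀ ρ ∈ Set.Icc (I.fst : ℝ) (I.snd : ℝ), ∀ n, ‖teichmullerCoeff p hπ x n‖ * ρ ^ n ≤ C := by
  obtain ⟨D, hD⟩ := exists_bound p hπ hx I
  constructor
  · intro h ρ hρ n
    refine le_trans ?_ h
    refine (le_ciSup (f := fun n : ℤ => ‖teichmullerCoeff p hπ x n‖ * ρ ^ n) ⟨D, ?_⟩ n).trans ?_
    · rintro _ ⟨n, rfl⟩
      exact hD ρ hρ n
    · refine le_ciSup (f := fun ρ : Set.Icc (I.fst : ℝ) (I.snd : ℝ) => gaussNorm p hπ (ρ : ℝ) x)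
        ⟨D, ?_⟩ ⟨ρ, hρ⟩
      rintro _ ⟨ρ', rfl⟩
      exact ciSup_le fun n => hD ρ' ρ'.2 n
  · intro h
    exact ciSup_le fun ρ => ciSup_le fun n => h ρ ρ.2 n

theorem bound_intervalNorm {x : WittFInv p E F π} (hx : x ∈ Bb p hπ) (I : ClosedInterval) :
    ∀ ρ ∈ Set.Icc (I.fst : ℝ) (I.snd : ℝ), ∀ n,
      ‖teichmullerCoeff p hπ x n‖ * ρ ^ n ≤ intervalNorm p hπ I x :=
  (intervalNorm_le_iff p hπ hx I).1 le_rfl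

theorem intervalNorm_nonneg {x : WittFInv p E F π} (hx : x ∈ Bb p hπ) (I : ClosedInterval) :
    0 ≤ intervalNorm p hπ I x := by
  have h : (I.fst : ℝ) ∈ Set.Icc (I.fst : ℝ) (I.snd : ℝ) := ⟨le_rfl, I.fst_le_snd⟩
  exact (mul_nonneg (norm_nonneg _) (zpow_nonneg I.fst.2.1.le _)).trans
    (bound_intervalNorm p hπ hx I _ h 0)

theorem intervalNorm_add_le {x y : WittFInv p E F π} (hx : x ∈ Bb p hπ) (hy : y ∈ Bb p hπ)
    (I : ClosedInterval) :
    intervalNorm p hπ I (x + y) ≤ max (intervalNorm p hπ I x) (intervalNorm p hπ I y) := by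
  rw [intervalNorm_le_iff p hπ ((Bb p hπ).add_mem hx hy)]
  intro ρ hρ
  obtain ⟨h0, h1⟩ := mem_interval_bounds hρ
  exact bound_add p hπ h0 h1 (fun n => le_max_of_le_left (bound_intervalNorm p hπ hx I ρ hρ n))
    (fun n => le_max_of_le_right (bound_intervalNorm p hπ hy I ρ hρ n))

theorem intervalNorm_mul_le {x y : WittFInv p E F π} (hx : x ∈ Bb p hπ) (hy : y ∈ Bb p hπ)
    (I : ClosedInterval) :
    intervalNorm p hπ I (x * y) ≤ intervalNorm p hπ I x * intervalNorm p hπ I y := by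
  rw [intervalNorm_le_iff p hπ ((Bb p hπ).mul_mem hx hy)]
  intro ρ hρ
  obtain ⟨h0, h1⟩ := mem_interval_bounds hρ
  exact bound_mul p hπ h0 h1 (bound_intervalNorm p hπ hx I ρ hρ) (bound_intervalNorm p hπ hy I ρ hρ)

theorem intervalNorm_toBb_le (z : BbPlus p E F) (I : ClosedInterval) :
    intervalNorm p hπ I (toBb p hπ z : WittFInv p E F π) ≤ 1 := by
  rw [intervalNorm_le_iff p hπ (toBb p hπ z).2]
  intro ρ hρ
  obtain ⟨h0, h1⟩ := mem_interval_bounds hρ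
  exact bound_toWittFInv p hπ z h0 h1

theorem intervalNorm_zero (I : ClosedInterval) :
    intervalNorm p hπ I (0 : WittFInv p E F π) = 0 := by
  refine le_antisymm ?_ (intervalNorm_nonneg p hπ (Bb p hπ).zero_mem I)
  rw [intervalNorm_le_iff p hπ (Bb p hπ).zero_mem]
  intro ρ hρ
  rw [bound_iff p hπ (N := 0) (y := 0) (by rw [map_zero, mul_zero]) (mem_interval_bounds hρ).1]
  intro i
  rw [coeff_zero, norm_zero, zero_mul, zero_mul]

theorem intervalNorm_neg_le {x : WittFInv p E F π} (hx : x ∈ Bb p hπ) (I : ClosedInterval) :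
    intervalNorm p hπ I (-x) ≤ intervalNorm p hπ I x := by
  have h1 := intervalNorm_toBb_le p hπ (-1 : BbPlus p E F) I
  have h2 := intervalNorm_mul_le p hπ (toBb p hπ (-1 : BbPlus p E F)).2 hx I
  have h3 : ((toBb p hπ (-1 : BbPlus p E F) : Bb p hπ) : WittFInv p E F π) * x = -x := by
    rw [map_neg, map_one]
    push_cast
    ring
  rw [h3] at h2
  exact h2.trans (mul_le_of_le_one_left (intervalNorm_nonneg p hπ hx I) h1)

theorem intervalNorm_mono {x : WittFInv p E F π} (hx : x ∈ Bb p hπ) {I J : ClosedInterval}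
    (h : I ≤ J) : intervalNorm p hπ I x ≤ intervalNorm p hπ J x := by
  rw [intervalNorm_le_iff p hπ hx]
  intro ρ hρ
  have h1 : (J.fst : ℝ) ≤ I.fst := h.1
  have h2 : (I.snd : ℝ) ≤ J.snd := h.2
  exact bound_intervalNorm p hπ hx J ρ ⟨h1.trans hρ.1, hρ.2.trans h2⟩

variable (F) in
/-- The ring `B^b`, to be endowed with the norm `|·|_I`. -/
def BbNormed (_ : ClosedInterval) : Type u := Bb p (F := F) hπ

instance (I : ClosedInterval) : CommRing (BbNormed p F hπ I) :=
  inferInstanceAs (CommRing (Bb p (F := F) hπ))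

/-- `|·|_I` as a seminorm on the additive group of `B^b`. -/
def intervalSeminorm (I : ClosedInterval) : AddGroupSeminorm (BbNormed p F hπ I) where
  toFun x := intervalNorm p hπ I (Subtype.val (p := fun x => x ∈ Bb p hπ) x)
  map_zero' := intervalNorm_zero p hπ I
  add_le' x y := (intervalNorm_add_le p hπ x.2 y.2 I).trans
    (max_le_add_of_nonneg (intervalNorm_nonneg p hπ x.2 I) (intervalNorm_nonneg p hπ y.2 I))
  neg' x := by
    refine le_antisymm (intervalNorm_neg_le p hπ x.2 I) ?_
    have := intervalNorm_neg_le p hπ ((Bb p hπ).neg_mem x.2) I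
    rwa [neg_neg] at this

instance (I : ClosedInterval) : SeminormedCommRing (BbNormed p F hπ I) :=
  { (intervalSeminorm p hπ I).toSeminormedAddCommGroup,
    (inferInstance : CommRing (BbNormed p F hπ I)) with
    norm_mul_le := fun x y => intervalNorm_mul_le p hπ x.2 y.2 I }

theorem norm_bbNormed (I : ClosedInterval) (x : BbNormed p F hπ I) :
    ‖x‖ = intervalNorm p hπ I (Subtype.val (p := fun x => x ∈ Bb p hπ) x) := rfl

variable (F) in
/-- `B_I`: the completion of `B^b` with respect to the norm `|·|_I`. -/
abbrev BI (I : ClosedInterval) : Type u := UniformSpace.Completion (BbNormed p F hπ I)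

theorem norm_BI_add_le (I : ClosedInterval) (x y : BI p F hπ I) : ‖x + y‖ ≤ max ‖x‖ ‖y‖ := by
  induction x, y using UniformSpace.Completion.induction_on₂ with
  | hp => exact isClosed_le (by fun_prop) (by fun_prop)
  | ih x y =>
    rw [← UniformSpace.Completion.coe_add, UniformSpace.Completion.norm_coe,
      UniformSpace.Completion.norm_coe, UniformSpace.Completion.norm_coe]
    exact intervalNorm_add_le p hπ x.2 y.2 I

theorem norm_BI_one_le (I : ClosedInterval) : ‖(1 : BI p F hπ I)‖ ≤ 1 := by
  rw [← UniformSpace.Completion.coe_one, UniformSpace.Completion.norm_coe]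
  have := intervalNorm_toBb_le p hπ (1 : BbPlus p E F) I
  rwa [map_one] at this

variable (F) in
/-- `B_I°`: the closed unit ball of `B_I`. -/
def BICirc (I : ClosedInterval) : Subring (BI p F hπ I) where
  carrier := {x | ‖x‖ ≤ 1}
  add_mem' hx hy := (norm_BI_add_le p hπ I _ _).trans (max_le hx hy)
  mul_mem' hx hy := (norm_mul_le _ _).trans (mul_le_one₀ hx (norm_nonneg _) hy)
  zero_mem' := by
    rw [Set.mem_ofPred_eq, norm_zero]
    exact zero_le_one
  one_mem' := norm_BI_one_le p hπ I
  neg_mem' {x} hx := by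
    rw [Set.mem_ofPred_eq, norm_neg]
    exact hx

end RingBI

section YAd

open RamifiedWitt AdicSpaces

/-! ### The affinoid rings and the spaces -/

/-- `(𝒪_E, 𝒪_E)`. -/
def integerPair : Pair.{u} where
  carrier := 𝒪[E]
  plus := ⊤

/-- `(E, 𝒪_E)`. -/
def fieldPair : Pair.{u} where
  carrier := E
  plus := 𝒪[E]

/-- The inclusion `(𝒪_E, 𝒪_E) → (E, 𝒪_E)`. -/
def integerToField : integerPair E ⟶ fieldPair E :=
  (⟨Subring.subtype 𝒪[E], continuous_subtype_val, fun a _ => a.2⟩ :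
    Pair.Hom (integerPair E) (fieldPair E))

variable {E F}

/-- The ideal `([ϖ], π)` of `B^{b,+} = W_{𝒪_E}(𝒪_F)`. -/
def idealOfDefinition (π : 𝒪[E]) (ϖ : 𝒪[F]) : Ideal (BbPlus p E F) :=
  Ideal.span {teichmuller p _ ϖ, ofInteger p _ π}

/-- `(B^{b,+}, B^{b,+})`, where `B^{b,+}` carries the `([ϖ], π)`-adic topology. -/
def bbPlusPair (π : 𝒪[E]) (ϖ : 𝒪[F]) : Pair.{u} :=
  letI : TopologicalSpace (BbPlus p E F) := (idealOfDefinition p π ϖ).adicTopology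
  letI : NonarchimedeanRing (BbPlus p E F) := (idealOfDefinition p π ϖ).nonarchimedean
  { carrier := BbPlus p E F
    plus := ⊤ }

theorem mem_nhds_bbPlus {π : 𝒪[E]} {ϖ : 𝒪[F]} {s : Set (bbPlusPair p π ϖ).carrier} :
    s ∈ 𝓝 (0 : (bbPlusPair p π ϖ).carrier) ↔
      ∃ n : ℕ, ((idealOfDefinition p π ϖ ^ n : Ideal (BbPlus p E F)) : Set (BbPlus p E F)) ⊆ s := by
  refine ((idealOfDefinition p π ϖ).hasBasis_nhds_zero_adic.mem_iff).trans ?_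
  exact exists_congr fun n => and_iff_right trivial

variable {π : 𝒪[E]}

theorem continuous_ofInteger (hπ : Irreducible π) (ϖ : 𝒪[F]) :
    Continuous (X := (integerPair E).carrier) (Y := (bbPlusPair p π ϖ).carrier)
      (ofInteger p (residueFieldToInteger p E F)) := by
  let f : (integerPair E).carrier →+* (bbPlusPair p π ϖ).carrier :=
    ofInteger p (residueFieldToInteger p E F)
  refine continuous_of_continuousAt_zero f ?_
  intro s hs
  rw [map_zero] at hs
  obtain ⟨n, hn⟩ := (mem_nhds_bbPlus p).1 hs
  have h := (isAdic_iff.1 (isAdic_span (Valued.integer.norm_irreducible_pos hπ)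
    (Valued.integer.norm_irreducible_lt_one hπ))).1 n
  change f ⁻¹' s ∈ 𝓝 (0 : 𝒪[E])
  refine Filter.mem_of_superset (h.mem_nhds (Ideal.zero_mem _)) fun x hx => hn ?_
  rw [SetLike.mem_coe, Ideal.span_singleton_pow, Ideal.mem_span_singleton] at hx
  obtain ⟨y, rfl⟩ := hx
  change ofInteger p (residueFieldToInteger p E F) (π ^ n * y) ∈ idealOfDefinition p π ϖ ^ n
  rw [map_mul, map_pow]
  exact Ideal.mul_mem_right _ _ (Ideal.pow_mem_pow (Ideal.subset_span (by simp)) n)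

/-- The structure map `(𝒪_E, 𝒪_E) → (B^{b,+}, B^{b,+})`. -/
def integerToBbPlus (hπ : Irreducible π) (ϖ : 𝒪[F]) : integerPair E ⟶ bbPlusPair p π ϖ :=
  (⟨ofInteger p (residueFieldToInteger p E F), continuous_ofInteger p hπ ϖ,
    fun _ _ => Subring.mem_top _⟩ : Pair.Hom (integerPair E) (bbPlusPair p π ϖ))

/-- The reduction map `B^{b,+} = W_{𝒪_E}(𝒪_F) → W_{𝒪_E}(k_F)`, where `k_F` is the residue field of
`F`. -/
def reduction : BbPlus p E F →+*
    RamifiedWitt p ((IsLocalRing.residue 𝒪[F]).comp (residueFieldToInteger p E F)) :=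
  RamifiedWitt.map p _ _ (IsLocalRing.residue 𝒪[F]) rfl

variable (F) in
/-- The point `0`, as a one-point set: the equivalence class of the pullback to `B^{b,+}` of the
`π`-adic valuation on `W_{𝒪_E}(k_F)`. -/
def zeroPoint (π : 𝒪[E]) : Set (ValuativeRel (BbPlus p E F)) :=
  {x | ∀ a b : BbPlus p E F, x.vle a b ↔
    emultiplicity (ofInteger p _ π) (reduction p b) ≤
      emultiplicity (ofInteger p _ π) (reduction p a)}

/-- The adic generic fibre of `Spf B^{b,+}`: the base change of `Spa(B^{b,+}, B^{b,+})` along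
`Spa(E, 𝒪_E) → Spa(𝒪_E, 𝒪_E)`. -/
def genericFibre (hπ : Irreducible π) (ϖ : 𝒪[F]) : AdicSheaf.{u} :=
  Limits.pullback (Spa.map (integerToBbPlus p hπ ϖ).op) (Spa.map (integerToField E).op)

/-- The projection from the generic fibre of `Spf B^{b,+}` to `Spa(B^{b,+}, B^{b,+})`. -/
def genericFibreι (hπ : Irreducible π) (ϖ : 𝒪[F]) :
    genericFibre p hπ ϖ ⟶ Spa.obj (op (bbPlusPair p π ϖ)) :=
  Limits.pullback.fst _ _

/-- `Y^ad`: the complement of `0` in the adic generic fibre of `Spf B^{b,+}`. -/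
def Yad (hπ : Irreducible π) (ϖ : 𝒪[F]) : AdicSheaf.{u} :=
  complement (genericFibreι p hπ ϖ) (zeroPoint p F π)

/-- The natural map `Y^ad → Spa(B^{b,+}, B^{b,+})`. -/
def Yadι (hπ : Irreducible π) (ϖ : 𝒪[F]) : Yad p hπ ϖ ⟶ Spa.obj (op (bbPlusPair p π ϖ)) :=
  complementι (genericFibreι p hπ ϖ) (zeroPoint p F π) ≫ genericFibreι p hπ ϖ

variable [CharP F p] [PerfectRing F p] (hπ : Irreducible π)

variable (F) in
/-- `(B_I, B_I°)`. -/
def intervalPair (I : ClosedInterval) : Pair.{u} where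
  carrier := BI p F hπ I
  plus := BICirc p F hπ I

variable (F) in
/-- The identity of `B^b`, from the norm `|·|_J` to the norm `|·|_I`. -/
def changeNorm (I J : ClosedInterval) : BbNormed p F hπ J →+* BbNormed p F hπ I :=
  RingHom.id (Bb p (F := F) hπ)

theorem norm_changeNorm_le {I J : ClosedInterval} (h : I ≤ J) (x : BbNormed p F hπ J) :
    ‖changeNorm p F hπ I J x‖ ≤ ‖x‖ :=
  intervalNorm_mono p hπ x.2 h

theorem continuous_changeNorm {I J : ClosedInterval} (h : I ≤ J) :
    Continuous (changeNorm p F hπ I J) :=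
  AddMonoidHomClass.continuous_of_bound _ 1 fun x => by
    rw [one_mul]
    exact norm_changeNorm_le p hπ h x

variable (F) in
/-- The homomorphism `B_J → B_I` for `I ⊆ J` extending the identity of `B^b`. -/
def restrictBI {I J : ClosedInterval} (h : I ≤ J) : BI p F hπ J →+* BI p F hπ I :=
  UniformSpace.Completion.mapRingHom (changeNorm p F hπ I J) (continuous_changeNorm p hπ h)

theorem continuous_restrictBI {I J : ClosedInterval} (h : I ≤ J) :
    Continuous (restrictBI p F hπ h) :=
  UniformSpace.Completion.continuous_map

theorem norm_restrictBI_le {I J : ClosedInterval} (h : I ≤ J) (x : BI p F hπ J) :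
    ‖restrictBI p F hπ h x‖ ≤ ‖x‖ := by
  induction x using UniformSpace.Completion.induction_on with
  | hp => exact isClosed_le (continuous_restrictBI p hπ h).norm continuous_norm
  | ih x =>
    have : restrictBI p F hπ h (x : BI p F hπ J) = (changeNorm p F hπ I J x : BI p F hπ I) :=
      UniformSpace.Completion.mapRingHom_coe _ x
    rw [this, UniformSpace.Completion.norm_coe, UniformSpace.Completion.norm_coe]
    exact norm_changeNorm_le p hπ h x

variable (F) in
/-- The morphism `(B_J, B_J°) → (B_I, B_I°)` for `I ⊆ J`. -/
def restrictPair {I J : ClosedInterval} (h : I ≤ J) :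
    intervalPair p F hπ J ⟶ intervalPair p F hπ I :=
  (⟨restrictBI p F hπ h, continuous_restrictBI p hπ h,
    fun x hx => (norm_restrictBI_le p hπ h x).trans hx⟩ :
    Pair.Hom (intervalPair p F hπ J) (intervalPair p F hπ I))

variable (F) in
/-- The inductive system of the `Spa(B_I, B_I°)`, indexed by the closed intervals `I ⊆ (0, 1)`. -/
def intervalSystem : ClosedInterval ⥤ AdicSheaf.{u} :=
  { obj := fun I => op (intervalPair p F hπ I)
    map := fun h => (restrictPair p F hπ (leOfHom h)).op
    map_id := fun I => congr_arg Quiver.Hom.op (Pair.Hom.ext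
      (UniformSpace.Completion.mapRingHom_id (α := BbNormed p F hπ I)))
    map_comp := fun f g => congr_arg Quiver.Hom.op (Pair.Hom.ext
      (UniformSpace.Completion.mapRingHom_comp (continuous_changeNorm p hπ (leOfHom f))
        (continuous_changeNorm p hπ (leOfHom g))).symm) :
    ClosedInterval ⥤ Pair.{u}ᵒᵖ } ⋙ Spa

variable (F) in
/-- The homomorphism `B^{b,+} → B_I`. -/
def toBI (I : ClosedInterval) : BbPlus p E F →+* BI p F hπ I :=
  (UniformSpace.Completion.coeRingHom : BbNormed p F hπ I →+* BI p F hπ I).comp (toBb p hπ)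

theorem norm_toBI (I : ClosedInterval) (z : BbPlus p E F) :
    ‖toBI p F hπ I z‖ = intervalNorm p hπ I (toBb p hπ z : WittFInv p E F π) :=
  UniformSpace.Completion.norm_coe (E := BbNormed p F hπ I) (toBb p hπ z)

theorem norm_toBI_le_one (I : ClosedInterval) (z : BbPlus p E F) : ‖toBI p F hπ I z‖ ≤ 1 :=
  (norm_toBI p hπ I z).trans_le (intervalNorm_toBb_le p hπ z I)

theorem norm_toBI_le_pow (I : ClosedInterval) (ϖ : 𝒪[F]) (n : ℕ) {z : BbPlus p E F}
    (hz : z ∈ idealOfDefinition p π ϖ ^ n) :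
    ‖toBI p F hπ I z‖ ≤ max ‖ϖ‖ (I.snd : ℝ) ^ n := by
  set q := max ‖ϖ‖ (I.snd : ℝ) with hq
  have hq0 : 0 ≤ q := (norm_nonneg ϖ).trans (le_max_left _ _)
  let T : ℕ → Ideal (BbPlus p E F) := fun n =>
    { carrier := {z | ‖toBI p F hπ I z‖ ≤ q ^ n}
      add_mem' := fun {a b} ha hb => by
        rw [Set.mem_ofPred_eq] at *
        rw [map_add]
        exact (norm_BI_add_le p hπ I _ _).trans (max_le ha hb)
      zero_mem' := by
        rw [Set.mem_ofPred_eq, map_zero, norm_zero]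
        exact pow_nonneg hq0 n
      smul_mem' := fun c x hx => by
        rw [Set.mem_ofPred_eq] at *
        rw [smul_eq_mul, map_mul]
        exact (norm_mul_le _ _).trans
          ((mul_le_of_le_one_left (norm_nonneg _) (norm_toBI_le_one p hπ I c)).trans hx) }
  have h1 : idealOfDefinition p π ϖ ≤ T 1 := by
    rw [idealOfDefinition, Ideal.span_le]
    rintro _ (rfl | rfl)
    · change ‖toBI p F hπ I _‖ ≤ q ^ 1
      rw [norm_toBI, pow_one, intervalNorm_le_iff p hπ (toBb p hπ _).2]
      intro ρ hρ n
      obtain ⟨h0, h1⟩ := mem_interval_bounds hρ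
      exact (bound_teichmuller p hπ ϖ h0 h1 n).trans (le_max_left _ _)
    · change ‖toBI p F hπ I _‖ ≤ q ^ 1
      rw [norm_toBI, pow_one, intervalNorm_le_iff p hπ (toBb p hπ _).2]
      intro ρ hρ n
      obtain ⟨h0, h1⟩ := mem_interval_bounds hρ
      exact (bound_uniformizer p hπ h0 h1 n).trans (hρ.2.trans (le_max_right _ _))
  have h2 : ∀ n, idealOfDefinition p π ϖ ^ n ≤ T n := by
    intro n
    induction n with
    | zero =>
      intro z _
      change ‖toBI p F hπ I z‖ ≤ q ^ 0
      rw [pow_zero]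
      exact norm_toBI_le_one p hπ I z
    | succ n ih =>
      rw [pow_succ]
      refine (Ideal.mul_mono ih h1).trans (Ideal.mul_le.2 fun a ha b hb => ?_)
      change ‖toBI p F hπ I (a * b)‖ ≤ q ^ (n + 1)
      have ha' : ‖toBI p F hπ I a‖ ≤ q ^ n := ha
      have hb' : ‖toBI p F hπ I b‖ ≤ q ^ 1 := hb
      rw [map_mul, pow_succ]
      rw [pow_one] at hb'
      exact (norm_mul_le _ _).trans (mul_le_mul ha' hb' (norm_nonneg _) (pow_nonneg hq0 n))
  exact h2 n hz

theorem continuous_toBI (I : ClosedInterval) {ϖ : 𝒪[F]} (hϖ : ‖ϖ‖ < 1) :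
    Continuous (X := (bbPlusPair p π ϖ).carrier) (Y := BI p F hπ I) (toBI p F hπ I) := by
  let f : (bbPlusPair p π ϖ).carrier →+* BI p F hπ I := toBI p F hπ I
  refine continuous_of_continuousAt_zero f ?_
  intro s hs
  rw [map_zero] at hs
  obtain ⟨ε, hε, h⟩ := Metric.mem_nhds_iff.1 hs
  obtain ⟨n, hn⟩ := exists_pow_lt_of_lt_one hε (max_lt hϖ I.snd.2.2)
  refine (mem_nhds_bbPlus p).2 ⟨n, fun z hz => h ?_⟩
  rw [mem_ball_zero_iff]
  exact (norm_toBI_le_pow p hπ I ϖ n hz).trans_lt hn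

variable (F) in
/-- The natural morphism `(B^{b,+}, B^{b,+}) → (B_I, B_I°)`. -/
def bbPlusToInterval (I : ClosedInterval) {ϖ : 𝒪[F]} (hϖ : ‖ϖ‖ < 1) :
    bbPlusPair p π ϖ ⟶ intervalPair p F hπ I :=
  (⟨toBI p F hπ I, continuous_toBI p hπ I hϖ, fun z _ => norm_toBI_le_one p hπ I z⟩ :
    Pair.Hom (bbPlusPair p π ϖ) (intervalPair p F hπ I))

end YAd

end PerfectoidField

end

end FarguesFontaine

/-!
A point of `Y^ad` with values in a complete affinoid ring `(T, T⁺)` is, locally on `T`, a continuous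
homomorphism `g : B^{b,+} → T` for which `π` and `[ϖ]` become invertible; let `unitLocus` be the
functor of these `g`. The proof identifies `Y^ad` with the sheaf associated with `unitLocus`, and
`unitLocus`, as a presheaf, with the increasing union of the functors `Hom((B_I, B_I°), -)`. Since
sheafification is a left adjoint which preserves monomorphisms, both claims about the
`Spa(B_I, B_I°)` follow.

*From `Y^ad` to `unitLocus`.* `Spa(E, 𝒪_E) → Spa(𝒪_E, 𝒪_E)` is a monomorphism whose points are the
maps inverting `π`, so `Y^ad → Spa(B^{b,+}, B^{b,+})` is a monomorphism. If `[ϖ]` is invertible in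
`T`, no point of `Spa(T, T⁺)` is sent to `0`, because `[ϖ]` reduces to zero in `W_{𝒪_E}(k_F)`.
Conversely let `π` be invertible in `T` and let `g` avoid `0`. By `mem_zeroPoint`, Teichmüller
expansions show that `0` is the only point of `Spa(B^{b,+}, B^{b,+})` with `|[ϖ]| = 0 ≠ |π|`; hence
`[ϖ]` vanishes at no point of `Spa(T, T⁺)`. By `isUnit_of_forall_points`, in a complete affinoid
ring with a topologically nilpotent unit such an element is invertible: otherwise a maximal ideal
containing it, together with a valuation ring dominating the image of `T⁺`, would give a point
where it vanishes. This is `isIso_unitLocusToYad`.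

*From `unitLocus` to the `B_I`.* The norm `|·|_I` is power-multiplicative, so `B_I°` is integrally
closed and `(B_I, B_I°)` is a complete affinoid ring. The ring `B^{b,+}[1 / π [ϖ]]` is dense in
`B_I`, so a morphism out of `(B_I, B_I°)` is determined by its restriction to `B^{b,+}`. If `g`
inverts `π` and `[ϖ]`, then `π^k / [ϖ]` and `[ϖ]^r / π` tend to zero in `T` as `k` and `r` grow,
hence for suitable `k` and `r` they lie in `T⁺` and in a ring of definition. For
`I = [|ϖ|^r, |ϖ|^{1/k}]` every term of an expansion `∑ [b_i] π^i / (π [ϖ])^N` with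
`|·|_I ≤ 1` is, up to taking a `k`-th power, an element of
`B^{b,+}` times a power of `π^k / [ϖ]` or of `[ϖ]^r / π`. So `g` is continuous for `|·|_I` and maps
the unit ball into `T⁺`, and it extends to `B_I` by completeness; this is
`exists_bbPlusToInterval_comp`.
-/

namespace FarguesFontaine

open AdicSpaces RamifiedWitt

/-! ### The adic generic fibre and the functor of points with `π` and `[ϖ]` invertible -/

section FieldPair

variable {E : Type u} [NontriviallyNormedField E] [IsUltrametricDist E]

theorem integerToField_cancel {T : Pair.{u}} (h h' : fieldPair E ⟶ T)
    (hh : integerToField E ≫ h = integerToField E ≫ h') : h = h' := by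
  exact Pair.Hom.ext (IsLocalization.ringHom_ext (R := 𝒪[E]) (S := E) (nonZeroDivisors 𝒪[E])
    (congr_arg Pair.Hom.toRingHom hh))

theorem isUnit_of_isUnit_uniformizer [IsDiscreteValuationRing 𝒪[E]] {π : 𝒪[E]}
    (hπ : Irreducible π) {R : Type u} [CommRing R] (f : 𝒪[E] →+* R) (h : IsUnit (f π))
    (a : 𝒪[E]) (ha : a ≠ 0) : IsUnit (f a) := by
  obtain ⟨n, v, rfl⟩ := IsDiscreteValuationRing.eq_unit_mul_pow_irreducible ha hπ
  rw [map_mul, map_pow]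
  exact (v.isUnit.map f).mul (h.pow n)

/-- A morphism out of `(𝒪_E, 𝒪_E)` sending the uniformizer to a unit extends to `(E, 𝒪_E)`. -/
theorem exists_integerToField_comp [IsDiscreteValuationRing 𝒪[E]] {π : 𝒪[E]}
    (hπ : Irreducible π) {T : Pair.{u}} (f : integerPair E ⟶ T)
    (h : IsUnit (Pair.Hom.toRingHom f π)) :
    ∃ h : fieldPair E ⟶ T, integerToField E ≫ h = f := by
  let f₀ : 𝒪[E] →+* T.carrier := Pair.Hom.toRingHom f
  have hu : ∀ y : nonZeroDivisors 𝒪[E], IsUnit (f₀ y) := fun y =>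
    isUnit_of_isUnit_uniformizer hπ f₀ h y (nonZeroDivisors.ne_zero y.2)
  let g : E →+* T.carrier := IsLocalization.lift (M := nonZeroDivisors 𝒪[E]) hu
  have hg : ∀ a : 𝒪[E], g (a : E) = f₀ a := fun a => IsLocalization.lift_eq hu a
  have hc : Continuous g := by
    refine continuous_of_continuousAt_zero g ?_
    have hopen : IsOpen ((𝒪[E] : Subring E) : Set E) :=
      Valued.isOpen_integer (R := E)
    have h1 : Filter.map (fun a : 𝒪[E] => (a : E)) (𝓝 0) = 𝓝 ((0 : 𝒪[E]) : E) :=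
      hopen.isOpenEmbedding_subtypeVal.map_nhds_eq 0
    have h2 : (0 : E) = ((0 : 𝒪[E]) : E) := rfl
    rw [ContinuousAt, h2, ← h1, Filter.tendsto_map'_iff]
    have h3 : (g ∘ fun a : 𝒪[E] => (a : E)) = f₀ := funext hg
    rw [h3, hg]
    exact (f.continuous' : Continuous f₀).continuousAt
  refine ⟨(⟨g, hc, fun a ha => ?_⟩ : Pair.Hom (fieldPair E) T), Pair.Hom.ext (RingHom.ext hg)⟩
  have := f.map_plus' ⟨a, ha⟩ (Subring.mem_top _)
  exact (hg ⟨a, ha⟩).symm ▸ this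

end FieldPair

section Sheaves

/-- An epimorphism of pairs induces a monomorphism of the associated sheaves. -/
theorem mono_spa_map {A B : Pair.{u}} (f : A ⟶ B)
    (h : ∀ (T : Pair.{u}) (g g' : B ⟶ T), f ≫ g = f ≫ g' → g = g') : Mono (Spa.map f.op) := by
  have : Mono (homPresheaf.map f.op) := by
    refine @NatTrans.mono_of_mono_app _ _ _ _ _ _ _ fun U => ?_
    refine (mono_iff_injective _).2 fun g g' hg => ?_
    exact ULift.ext _ _ (h _ _ _ (congr_arg ULift.down hg))
  change Mono ((presheafToSheaf rationalTopology (Type (u + 1))).map (homPresheaf.map f.op))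
  infer_instance

variable (p : ℕ) [Fact p.Prime] {E : Type u} [NontriviallyNormedField E] [IsUltrametricDist E]
  [NormedAlgebra ℚ_[p] E] [FiniteDimensional ℚ_[p] E]
  {F : Type u} [NontriviallyNormedField F] [IsUltrametricDist F] [Algebra 𝓀[E] F]
  {π : 𝒪[E]} (hπ : Irreducible π) (ϖ : 𝒪[F])

theorem mono_genericFibreι : Mono (genericFibreι p hπ ϖ) := by
  have : Mono (Spa.map (integerToField E).op) :=
    mono_spa_map _ fun T g g' h => integerToField_cancel g g' h
  exact Limits.pullback.fst_of_mono (f := Spa.map (integerToBbPlus p hπ ϖ).op)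

theorem mono_complementι {X : AdicSheaf.{u}} {A : Pair.{u}} (f : X ⟶ Spa.obj (op A))
    (Z : Set (ValuativeRel A.carrier)) : Mono (complementι f Z) := by
  refine (sheafToPresheaf rationalTopology (Type (u + 1))).mono_of_mono_map ?_
  change Mono ((avoiding f Z).sheafify rationalTopology).ι
  infer_instance

theorem mono_Yadι : Mono (Yadι p hπ ϖ) := by
  have := mono_genericFibreι p hπ ϖ
  have := mono_complementι (A := bbPlusPair p π ϖ) (genericFibreι p hπ ϖ) (zeroPoint p F π)
  exact mono_comp (complementι (genericFibreι p hπ ϖ) (zeroPoint p F π)) (genericFibreι p hπ ϖ)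

/-- The functor of those `(T, T⁺)`-valued points of `B^{b,+}` for which `π` and `[ϖ]` are
invertible, as a subfunctor of `(T, T⁺) ↦ Hom((B^{b,+}, B^{b,+}), (T, T⁺))`. -/
def unitLocus (π : 𝒪[E]) (ϖ : 𝒪[F]) : Subfunctor (homPresheaf.obj (op (bbPlusPair p π ϖ))) where
  obj U := {g : ULift (bbPlusPair p π ϖ ⟶ U.unop.unop.obj) |
    IsUnit (Pair.Hom.toRingHom g.down (ofInteger p (residueFieldToInteger p E F) π)) ∧
    IsUnit (Pair.Hom.toRingHom g.down (teichmuller p (residueFieldToInteger p E F) ϖ))}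
  map i _ hg := ⟨hg.1.map (Pair.Hom.toRingHom i.unop.unop.hom),
    hg.2.map (Pair.Hom.toRingHom i.unop.unop.hom)⟩

/-- The morphism of pairs underlying a section of `unitLocus`. -/
def unitLocusHom {U : CompleteAffinoid.{u}ᵒᵖᵒᵖ} (g : (unitLocus p (F := F) π ϖ).toFunctor.obj U) :
    bbPlusPair p π ϖ ⟶ U.unop.unop.obj :=
  (g.1 : ULift (bbPlusPair p π ϖ ⟶ U.unop.unop.obj)).down

theorem exists_unitLocus_toField {U : CompleteAffinoid.{u}ᵒᵖᵒᵖ}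
    (g : (unitLocus p (F := F) π ϖ).toFunctor.obj U) :
    ∃ h : fieldPair E ⟶ U.unop.unop.obj,
      integerToField E ≫ h = integerToBbPlus p hπ ϖ ≫ unitLocusHom p ϖ g := by
  have := (isDVR_and_finite p E).1
  exact exists_integerToField_comp hπ _ g.2.1

/-- The `(E, 𝒪_E)`-structure on the points of `unitLocus`. -/
noncomputable def unitLocusToField :
    (unitLocus p (F := F) π ϖ).toFunctor ⟶ homPresheaf.obj (op (fieldPair E)) where
  app U := ↾fun g => ULift.up (exists_unitLocus_toField p hπ ϖ g).choose
  naturality U V i := by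
    ext g
    refine ULift.ext _ _ (integerToField_cancel _ _ ?_)
    exact (exists_unitLocus_toField p hπ ϖ
      ((unitLocus p π ϖ).toFunctor.map i g)).choose_spec.trans
      (congr_arg (· ≫ i.unop.unop.hom) (exists_unitLocus_toField p hπ ϖ g).choose_spec).symm

theorem unitLocusToField_comp :
    unitLocusToField p hπ ϖ ≫ homPresheaf.map (integerToField E).op =
      (unitLocus p (F := F) π ϖ).ι ≫ homPresheaf.map (integerToBbPlus p hπ ϖ).op := by
  ext U g
  exact ULift.ext _ _ (exists_unitLocus_toField p hπ ϖ g).choose_spec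

/-- The map from the sheaf associated with `unitLocus` to the adic generic fibre. -/
noncomputable def unitLocusToGenericFibre :
    (presheafToSheaf rationalTopology (Type (u + 1))).obj (unitLocus p (F := F) π ϖ).toFunctor ⟶
      genericFibre p hπ ϖ :=
  Limits.pullback.lift ((presheafToSheaf _ _).map (unitLocus p π ϖ).ι)
    ((presheafToSheaf _ _).map (unitLocusToField p hπ ϖ)) (by
      change _ ≫ (presheafToSheaf _ _).map _ = _ ≫ (presheafToSheaf _ _).map _
      rw [← Functor.map_comp, ← Functor.map_comp, unitLocusToField_comp])

theorem unitLocusToGenericFibre_comp :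
    unitLocusToGenericFibre p hπ ϖ ≫ genericFibreι p hπ ϖ =
      (presheafToSheaf _ _).map (unitLocus p (F := F) π ϖ).ι :=
  Limits.pullback.lift_fst _ _ _

end Sheaves

/-! ### Comparison of `Y^ad` with the sheaf associated with `unitLocus` -/

section SheafSections

/-- Locally, every section of `Spa(A, A⁺)` is given by a morphism of pairs. -/
theorem locally_exists_sectionOfHom {A : Pair.{u}} {U : CompleteAffinoid.{u}ᵒᵖ}
    (t : (Spa.obj (op A)).obj.obj (op U)) :
    ∃ S ∈ rationalTopology U, ∀ ⦃V : CompleteAffinoid.{u}ᵒᵖ⦄ (f : V ⟶ U), S f →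
      ∃ h : A ⟶ V.unop.obj, (Spa.obj (op A)).obj.map f.op t = sectionOfHom h := by
  have hs : Presheaf.IsLocallySurjective rationalTopology
    (toSheafify rationalTopology (homPresheaf.obj (op A))) := inferInstance
  let t' : (sheafify rationalTopology (homPresheaf.obj (op A))).obj (op U) := t
  refine ⟨_, hs.imageSieve_mem t', ?_⟩
  rintro V f ⟨h, hh⟩
  exact ⟨(h : ULift.{u + 1} (A ⟶ V.unop.obj)).down, hh.symm⟩

/-- Morphisms of pairs giving the same section of `Spa(A, A⁺)` agree locally. -/
theorem locally_eq_of_sectionOfHom_eq {A : Pair.{u}} {U : CompleteAffinoid.{u}ᵒᵖ}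
    {g g' : A ⟶ U.unop.obj} (h : sectionOfHom g = sectionOfHom g') :
    ∃ S ∈ rationalTopology U, ∀ ⦃V : CompleteAffinoid.{u}ᵒᵖ⦄ (f : V ⟶ U), S f →
      g ≫ f.unop.hom = g' ≫ f.unop.hom := by
  refine ⟨_, Presheaf.equalizerSieve_mem rationalTopology
    (toSheafify rationalTopology (homPresheaf.obj (op A))) (X := op U)
    (ULift.up g : ULift.{u + 1} (A ⟶ U.unop.obj))
    (ULift.up g' : ULift.{u + 1} (A ⟶ U.unop.obj)) h, ?_⟩
  intro V f hf
  exact congr_arg (ULift.down : ULift.{u + 1} (A ⟶ V.unop.obj) → _) hf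

theorem spa_map_sectionOfHom {A B : Pair.{u}} (f : A ⟶ B) {T : CompleteAffinoid.{u}}
    (g : B ⟶ T.obj) :
    (Spa.map f.op).hom.app (op (op T)) (sectionOfHom g) = sectionOfHom (f ≫ g) := by
  have := toSheafify_naturality rationalTopology (homPresheaf.map f.op)
  have := ConcreteCategory.congr_hom (NatTrans.congr_app this (op (op T)))
    (ULift.up g : ULift.{u + 1} (B ⟶ T.obj))
  exact this.symm

theorem injective_of_mono {X Y : AdicSheaf.{u}} (f : X ⟶ Y) [Mono f]
    (U : CompleteAffinoid.{u}ᵒᵖᵒᵖ) : Function.Injective (f.hom.app U) := by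
  have : Mono f.hom := inferInstance
  exact (mono_iff_injective _).1 inferInstance

end SheafSections

section Yad

variable (p : ℕ) [Fact p.Prime] {E : Type u} [NontriviallyNormedField E] [IsUltrametricDist E]
  [NormedAlgebra ℚ_[p] E] [FiniteDimensional ℚ_[p] E]
  {F : Type u} [NontriviallyNormedField F] [IsUltrametricDist F] [Algebra 𝓀[E] F]
  {π : 𝒪[E]} (hπ : Irreducible π) (ϖ : 𝒪[F])

theorem toSheafify_unitLocus_ι {U : CompleteAffinoid.{u}ᵒᵖᵒᵖ}
    (g : (unitLocus p (F := F) π ϖ).toFunctor.obj U) :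
    ((presheafToSheaf rationalTopology (Type (u + 1))).map (unitLocus p (F := F) π ϖ).ι).hom.app U
      ((toSheafify rationalTopology (unitLocus p (F := F) π ϖ).toFunctor).app U g) =
        sectionOfHom (unitLocusHom p ϖ g) := by
  have := toSheafify_naturality rationalTopology (unitLocus p (F := F) π ϖ).ι
  exact (ConcreteCategory.congr_hom (NatTrans.congr_app this U) g).symm

/-- A point of `Spa(B^{b,+}, B^{b,+})` at which `[ϖ]` does not vanish is not the point `0`. -/
theorem not_mem_zeroPoint {ϖ : 𝒪[F]} (hϖ1 : ‖ϖ‖ < 1) {x : ValuativeRel (BbPlus p E F)}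
    (hx : ¬ x.vle (teichmuller p (residueFieldToInteger p E F) ϖ) 0) : x ∉ zeroPoint p F π := by
  intro h
  refine hx ((h _ _).2 ?_)
  have h0 : IsLocalRing.residue 𝒪[F] ϖ = 0 := by
    rw [IsLocalRing.residue_eq_zero_iff]
    intro hu
    exact hϖ1.ne (Valued.integer.isUnit_iff_norm_eq_one.1 hu)
  have h1 : reduction p (teichmuller p (residueFieldToInteger p E F) ϖ) = 0 := by
    refine (RamifiedWitt.map_teichmuller ..).trans ?_
    rw [h0]
    change ofWitt p _ (WittVector.teichmuller p 0) = 0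
    rw [WittVector.teichmuller_zero, map_zero]
  rw [h1, emultiplicity_zero]
  exact le_top

theorem not_vle_zero_of_isUnit {R : Type u} [CommRing R] (x : ValuativeRel R) {a : R}
    (ha : IsUnit a) : ¬ x.vle a 0 := by
  intro h
  obtain ⟨b, hb⟩ := ha.exists_left_inv
  refine x.not_vle_one_zero ?_
  have := x.mul_vle_mul_left h b
  rwa [zero_mul, mul_comm, hb] at this

theorem unitLocus_avoids {ϖ : 𝒪[F]} (hϖ1 : ‖ϖ‖ < 1) {T : Pair.{u}} (g : bbPlusPair p π ϖ ⟶ T)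
    (h : IsUnit (Pair.Hom.toRingHom g (teichmuller p (residueFieldToInteger p E F) ϖ)))
    (x : ValuativeRel T.carrier) : comapValuation (Pair.Hom.toRingHom g) x ∉ zeroPoint p F π := by
  refine not_mem_zeroPoint p hϖ1 fun hx => not_vle_zero_of_isUnit x h ?_
  have hx' : x.vle (Pair.Hom.toRingHom g (teichmuller p (residueFieldToInteger p E F) ϖ))
    (Pair.Hom.toRingHom g 0) := hx
  rwa [map_zero] at hx'

/-- The map from `unitLocus` to `Y^ad`. -/
noncomputable def unitLocusToYadPresheaf {ϖ : 𝒪[F]} (hϖ1 : ‖ϖ‖ < 1) :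
    (unitLocus p (F := F) π ϖ).toFunctor ⟶ (Yad p hπ ϖ).obj :=
  Subfunctor.lift (G := (avoiding (genericFibreι p hπ ϖ) (zeroPoint p F π)).sheafify _)
    (toSheafify rationalTopology _ ≫ (unitLocusToGenericFibre p hπ ϖ).hom) (by
    refine le_trans ?_ (Subfunctor.le_sheafify _ _)
    rintro U _ ⟨g, rfl⟩
    refine ⟨unitLocusHom p ϖ g, ?_, fun x _ => unitLocus_avoids p hϖ1 _ g.2.2 x⟩
    rw [← toSheafify_unitLocus_ι, ← unitLocusToGenericFibre_comp p hπ]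
    rfl)

/-- The map to `Y^ad` from the sheaf associated with `unitLocus`. -/
noncomputable def unitLocusToYad {ϖ : 𝒪[F]} (hϖ1 : ‖ϖ‖ < 1) :
    (presheafToSheaf rationalTopology (Type (u + 1))).obj (unitLocus p (F := F) π ϖ).toFunctor ⟶
      Yad p hπ ϖ where
  hom := sheafifyLift _ (unitLocusToYadPresheaf p hπ hϖ1) (Yad p hπ ϖ).property

theorem unitLocusToYad_comp {ϖ : 𝒪[F]} (hϖ1 : ‖ϖ‖ < 1) :
    unitLocusToYad p hπ hϖ1 ≫ Yadι p hπ ϖ =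
      (presheafToSheaf _ _).map (unitLocus p (F := F) π ϖ).ι := by
  have h : unitLocusToYad p hπ hϖ1 ≫ complementι (genericFibreι p hπ ϖ) (zeroPoint p F π) =
      unitLocusToGenericFibre p hπ ϖ := by
    refine Sheaf.hom_ext (sheafify_hom_ext _ _ _ (genericFibre p hπ ϖ).property ?_)
    change toSheafify _ _ ≫ sheafifyLift _ (unitLocusToYadPresheaf p hπ hϖ1) _ ≫
      Subfunctor.ι _ = _
    exact (Category.assoc _ _ _).symm.trans (congr_arg (· ≫ Subfunctor.ι _)
      (toSheafify_sheafifyLift _ (unitLocusToYadPresheaf p hπ hϖ1) _))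
  rw [← unitLocusToGenericFibre_comp p hπ, ← h]
  rfl

theorem mono_unitLocusToYad {ϖ : 𝒪[F]} (hϖ1 : ‖ϖ‖ < 1) : Mono (unitLocusToYad p hπ hϖ1) := by
  have : Mono (unitLocusToYad p hπ hϖ1 ≫ Yadι p hπ ϖ) := by
    rw [unitLocusToYad_comp]
    have : Mono (unitLocus p (F := F) π ϖ).ι := inferInstance
    exact (presheafToSheaf rationalTopology (Type (u + 1))).map_mono _
  exact mono_of_mono (unitLocusToYad p hπ hϖ1) (Yadι p hπ ϖ)

/-- If a section of the generic fibre maps to the section of `Spa(B^{b,+}, B^{b,+})` given by `g`,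
then `g(π)` is locally invertible. -/
theorem locally_isUnit_uniformizer {U : CompleteAffinoid.{u}ᵒᵖ}
    (s : (genericFibre p hπ ϖ).obj.obj (op U)) (g : bbPlusPair p π ϖ ⟶ U.unop.obj)
    (hg : (genericFibreι p hπ ϖ).hom.app (op U) s = sectionOfHom g) :
    ∃ S ∈ rationalTopology U, ∀ ⦃V : CompleteAffinoid.{u}ᵒᵖ⦄ (f : V ⟶ U), S f →
      IsUnit (Pair.Hom.toRingHom (g ≫ f.unop.hom)
        (ofInteger p (residueFieldToInteger p E F) π)) := by
  let snd : genericFibre p hπ ϖ ⟶ Spa.obj (op (fieldPair E)) := Limits.pullback.snd _ _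
  have hcond : genericFibreι p hπ ϖ ≫ Spa.map (integerToBbPlus p hπ ϖ).op =
      snd ≫ Spa.map (integerToField E).op := Limits.pullback.condition
  obtain ⟨S, hS, hS'⟩ := locally_exists_sectionOfHom (snd.hom.app (op U) s)
  have key : ∀ ⦃V : CompleteAffinoid.{u}ᵒᵖ⦄ (f : V ⟶ U), S f →
      ∃ R ∈ rationalTopology V, ∀ ⦃W : CompleteAffinoid.{u}ᵒᵖ⦄ (k : W ⟶ V), R k →
        IsUnit (Pair.Hom.toRingHom (g ≫ (k ≫ f).unop.hom)
          (ofInteger p (residueFieldToInteger p E F) π)) := by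
    intro V f hf
    obtain ⟨h, hh⟩ := hS' f hf
    have h1 : (sectionOfHom (integerToField E ≫ h) : (Spa.obj (op (integerPair E))).obj.obj _) =
        sectionOfHom (integerToBbPlus p hπ ϖ ≫ g ≫ f.unop.hom) := by
      rw [← spa_map_sectionOfHom, ← spa_map_sectionOfHom, ← map_sectionOfHom, ← hg]
      have h2 : (Spa.obj (op (bbPlusPair p π ϖ))).obj.map f.op
          ((genericFibreι p hπ ϖ).hom.app (op U) s) =
          (genericFibreι p hπ ϖ).hom.app (op V) ((genericFibre p hπ ϖ).obj.map f.op s) :=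
        (NatTrans.naturality_apply (genericFibreι p hπ ϖ).hom f.op s).symm
      have h3 : (Spa.obj (op (fieldPair E))).obj.map f.op (snd.hom.app (op U) s) =
          snd.hom.app (op V) ((genericFibre p hπ ϖ).obj.map f.op s) :=
        (NatTrans.naturality_apply snd.hom f.op s).symm
      refine Eq.trans ?_ (congr_arg
        ((Spa.map (integerToBbPlus p hπ ϖ).op).hom.app (op V)) h2.symm)
      have h4 : (sectionOfHom h : (Spa.obj (op (fieldPair E))).obj.obj (op V)) = _ :=
        hh.symm.trans h3
      refine (congr_arg ((Spa.map (integerToField E).op).hom.app (op V)) h4).trans ?_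
      exact (ConcreteCategory.congr_hom (NatTrans.congr_app
        (congr_arg (fun m : genericFibre p hπ ϖ ⟶ Spa.obj (op (integerPair E)) => m.hom) hcond)
        (op V)) _).symm
    obtain ⟨R, hR, hR'⟩ := locally_eq_of_sectionOfHom_eq h1
    refine ⟨R, hR, fun W k hk => ?_⟩
    have h2 := congr_arg (fun m : integerPair E ⟶ W.unop.obj => Pair.Hom.toRingHom m π) (hR' k hk)
    have h3 : IsUnit (π : E) := by
      rw [isUnit_iff_ne_zero]
      exact fun h => hπ.ne_zero (Subtype.ext h)
    have h4 := (h3.map (Pair.Hom.toRingHom h)).map (Pair.Hom.toRingHom k.unop.hom)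
    exact h2 ▸ h4
  choose R hR hR' using key
  refine ⟨Sieve.bind S R, GrothendieckTopology.bind_covering _ hS hR, ?_⟩
  rintro W _ ⟨V, k, f, hf, hk, rfl⟩
  exact hR' f hf k hk

/-- If the points of `B^{b,+}` with `π` invertible which avoid the point `0` have `[ϖ]`
invertible, then `Y^ad` is the sheaf associated with `unitLocus`. -/
theorem isIso_unitLocusToYad {ϖ : 𝒪[F]} (hϖ1 : ‖ϖ‖ < 1)
    (H : ∀ (T : CompleteAffinoid.{u}) (g : bbPlusPair p π ϖ ⟶ T.obj),
      IsUnit (Pair.Hom.toRingHom g (ofInteger p (residueFieldToInteger p E F) π)) →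
      (∀ x ∈ T.obj.points, comapValuation (Pair.Hom.toRingHom g) x ∉ zeroPoint p F π) →
      IsUnit (Pair.Hom.toRingHom g (teichmuller p (residueFieldToInteger p E F) ϖ))) :
    IsIso (unitLocusToYad p hπ hϖ1) := by
  have hmono := mono_unitLocusToYad p hπ hϖ1
  have hmono' := mono_Yadι p hπ ϖ
  refine (Sheaf.isLocallyBijective_iff_isIso _).1 ⟨?_, ?_⟩
  · exact Presheaf.isLocallyInjective_of_injective _ _ fun U => injective_of_mono _ U
  -- local surjectivity: locally on `U`, a section of `Y^ad` is a morphism out of `B^{b,+}` which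
  -- avoids `0`, and locally once more `π` becomes invertible
  constructor
  intro U s
  have s2 : (avoiding (genericFibreι p hπ ϖ) (zeroPoint p F π)).sieveOfSection s.1 ∈
    rationalTopology U := s.2
  have key : ∀ ⦃V : CompleteAffinoid.{u}ᵒᵖ⦄ (f : V ⟶ U),
      (avoiding (genericFibreι p hπ ϖ) (zeroPoint p F π)).sieveOfSection s.1 f →
      ∃ R ∈ rationalTopology V, ∀ ⦃W : CompleteAffinoid.{u}ᵒᵖ⦄ (k : W ⟶ V), R k →
        Presheaf.imageSieve (unitLocusToYad p hπ hϖ1).hom s (k ≫ f) := by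
    rintro V f ⟨g, hg, hZ⟩
    obtain ⟨R, hR, hR'⟩ := locally_isUnit_uniformizer p hπ ϖ _ g hg
    refine ⟨R, hR, fun W k hk => ?_⟩
    have hu := hR' k hk
    let g' : (unitLocus p (F := F) π ϖ).toFunctor.obj (op W) :=
      ⟨(ULift.up (g ≫ k.unop.hom) : ULift (bbPlusPair p π ϖ ⟶ W.unop.obj)), hu,
        H _ _ hu fun x hx => hZ _ (Pair.Hom.comap_mem_points k.unop.hom hx)⟩
    refine ⟨(toSheafify rationalTopology (unitLocus p (F := F) π ϖ).toFunctor).app (op W) g', ?_⟩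
    refine injective_of_mono (Yadι p hπ ϖ) (op W) ?_
    have h1 : (Yadι p hπ ϖ).hom.app (op W) ((unitLocusToYad p hπ hϖ1).hom.app (op W)
        ((toSheafify rationalTopology (unitLocus p (F := F) π ϖ).toFunctor).app (op W) g')) =
          sectionOfHom (g ≫ k.unop.hom) := by
      refine Eq.trans ?_ (toSheafify_unitLocus_ι p ϖ g')
      rw [← unitLocusToYad_comp p hπ hϖ1]
      rfl
    refine h1.trans ?_
    rw [← map_sectionOfHom, ← hg]
    have h2 := NatTrans.naturality_apply (genericFibreι p hπ ϖ).hom k.op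
      ((genericFibre p hπ ϖ).obj.map f.op s.1)
    refine h2.symm.trans ?_
    change _ = (genericFibreι p hπ ϖ).hom.app (op W) ((genericFibre p hπ ϖ).obj.map (k ≫ f).op s.1)
    rw [op_comp, Functor.map_comp]
    rfl
  choose R hR hR' using key
  refine GrothendieckTopology.superset_covering _ ?_
    (GrothendieckTopology.bind_covering _ s2 hR)
  rintro W _ ⟨V, k, f, hf, hk, rfl⟩
  exact hR' f hf k hk

end Yad

/-! ### Units in complete affinoid rings -/

section FAdic

variable {A : Type u} [CommRing A] [TopologicalSpace A] [IsTopologicalRing A]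

/-- An f-adic ring has an open subring `A₀` for which the open `A₀`-submodules form a basis of
neighbourhoods of `0`. -/
theorem _root_.AdicSpaces.IsFAdic.exists_subring (h : IsFAdic A) :
    ∃ A₀ : Subring A, IsOpen (A₀ : Set A) ∧ ∀ U ∈ 𝓝 (0 : A), ∃ W : AddSubgroup A,
      IsOpen (W : Set A) ∧ (W : Set A) ⊆ U ∧ ∀ a ∈ A₀, ∀ w ∈ W, a * w ∈ W := by
  obtain ⟨A₀, hA₀, I, -, hI⟩ := h
  obtain ⟨h1, h2⟩ := isAdic_iff.1 hI
  refine ⟨A₀, hA₀, fun U hU => ?_⟩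
  obtain ⟨n, hn⟩ := h2 ((↑) ⁻¹' U) (continuous_subtype_val.continuousAt.preimage_mem_nhds hU)
  refine ⟨(I ^ n).toAddSubgroup.map A₀.subtype.toAddMonoidHom, ?_, ?_, ?_⟩
  · exact hA₀.isOpenEmbedding_subtypeVal.isOpenMap _ (h1 n)
  · rintro _ ⟨x, hx, rfl⟩
    exact hn hx
  · rintro a ha _ ⟨x, hx, rfl⟩
    exact ⟨⟨a, ha⟩ * x, (I ^ n).mul_mem_left _ hx, rfl⟩

theorem _root_.AdicSpaces.IsFAdic.nonarchimedeanRing (h : IsFAdic A) : NonarchimedeanRing A where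
  is_nonarchimedean U hU := by
    obtain ⟨A₀, -, hb⟩ := h.exists_subring
    obtain ⟨W, hW, hWU, -⟩ := hb U hU
    exact ⟨⟨W, hW⟩, hWU⟩

/-- In a complete f-adic ring `1 - u` is invertible for topologically nilpotent `u`. -/
theorem isUnit_one_sub_of_tendsto (hA : IsFAdic A) (ht2 : T2Space A)
    (hc : @CompleteSpace A (IsTopologicalAddGroup.rightUniformSpace A)) {u : A}
    (hu : Filter.Tendsto (fun n : ℕ => u ^ n) Filter.atTop (𝓝 0)) : IsUnit (1 - u) := by
  let : UniformSpace A := IsTopologicalAddGroup.rightUniformSpace A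
  have : IsUniformAddGroup A := isUniformAddGroup_of_addCommGroup
  have := hA.nonarchimedeanRing
  have hs : Summable (u ^ · : ℕ → A) :=
    NonarchimedeanAddGroup.summable_of_tendsto_cofinite_zero (by rwa [Nat.cofinite_eq_atTop])
  exact .of_mul_eq_one _ hs.one_sub_mul_tsum_pow

end FAdic

section CofinalRank

variable {R K : Type u} [CommRing R] [Field K] {Γ : Type*} [LinearOrderedCommGroupWithZero Γ]

/-- A valuation `w` on `R` together with an element `t` with `|t| < 1` such that each element of
`R` is bounded by a power of `|t|⁻¹`. Killing the elements which are smaller than all powers of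
`t` gives a valuation for which the powers of `t` are cofinal. -/
@[reducible] def cofinalValuation (w : Valuation R Γ) (t : R) (h1 : w t < 1)
    (hb : ∀ a, ∃ n : ℕ, w a * w t ^ n ≤ 1) : ValuativeRel R where
  vle a b := w a ≤ w b ∨ ∀ n : ℕ, w a ≤ w t ^ n
  vle_total a b := (le_total (w a) (w b)).imp Or.inl Or.inl
  vle_trans := by
    rintro a b c (h | h) (h' | h')
    · exact .inl (h.trans h')
    · exact .inr fun n => h.trans (h' n)
    · exact .inr h
    · exact .inr h
  vle_add := by
    rintro a b c (h | h) (h' | h')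
    · exact .inl (w.map_add_le h h')
    · by_cases hc : ∀ n : ℕ, w c ≤ w t ^ n
      · exact .inr fun n => w.map_add_le (h.trans (hc n)) (h' n)
      · push Not at hc
        obtain ⟨n, hn⟩ := hc
        exact .inl (w.map_add_le h ((h' n).trans hn.le))
    · by_cases hc : ∀ n : ℕ, w c ≤ w t ^ n
      · exact .inr fun n => w.map_add_le (h n) (h'.trans (hc n))
      · push Not at hc
        obtain ⟨n, hn⟩ := hc
        exact .inl (w.map_add_le ((h n).trans hn.le) h')
    · exact .inr fun n => w.map_add_le (h n) (h' n)
  mul_vle_mul_left := by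
    rintro a b (h | h) c
    · refine .inl ?_
      rw [map_mul, map_mul]
      exact mul_le_mul_left h _
    · refine .inr fun n => ?_
      obtain ⟨m, hm⟩ := hb c
      rw [map_mul]
      calc w a * w c ≤ w t ^ (m + n) * w c := mul_le_mul_left (h _) _
        _ = (w c * w t ^ m) * w t ^ n := by rw [pow_add]; ac_rfl
        _ ≤ 1 * w t ^ n := mul_le_mul_left hm _
        _ = _ := one_mul _
  vle_mul_cancel := by
    rintro a b c hc h
    rw [map_zero, not_or] at hc
    have hc0 : 0 < w c := not_le.1 hc.1
    obtain ⟨-, hc⟩ := hc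
    push Not at hc
    obtain ⟨m, hm⟩ := hc
    rw [map_mul, map_mul] at h
    rcases h with h | h
    · exact .inl ((mul_le_mul_iff_left₀ hc0).1 h)
    · refine .inr fun n => ?_
      refine (mul_le_mul_iff_left₀ hc0).1 ((h (n + m)).trans ?_)
      rw [pow_add]
      exact mul_le_mul_right hm.le _
  not_vle_one_zero := by
    rw [map_one, map_zero, not_or]
    exact ⟨not_le.2 zero_lt_one, fun h => (h 1).not_gt (by rwa [pow_one])⟩
  vle_mul_comm := by
    intro a b
    rw [mul_comm]
    exact .inl le_rfl

theorem exists_lt_of_not_vle_zero {w : Valuation R Γ} {t : R} {h1 : w t < 1}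
    {hb : ∀ a, ∃ n : ℕ, w a * w t ^ n ≤ 1} {b : R}
    (h : ¬ (cofinalValuation w t h1 hb).vle b 0) : ∃ n : ℕ, w t ^ n < w b := by
  obtain ⟨-, h⟩ := not_or.1 h
  push Not at h
  exact h

end CofinalRank

section UnitCriterion

variable {T : Pair.{u}}

/-- In a complete affinoid ring `1 - t s` is invertible for topologically nilpotent `t` and
power-bounded `s`. -/
theorem isUnit_one_sub_mul (hT : T.IsAffinoid) (hc : T.IsComplete) {t s : T.carrier}
    (ht : Filter.Tendsto (fun n : ℕ => t ^ n) Filter.atTop (𝓝 0)) (hs : s ∈ T.plus) :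
    IsUnit (1 - t * s) := by
  refine isUnit_one_sub_of_tendsto hT.isFAdic hc.t2 hc.complete fun U hU => ?_
  obtain ⟨V, hV, h⟩ := hT.powerBounded s hs U hU
  change ∀ᶠ n : ℕ in Filter.atTop, (t * s) ^ n ∈ U
  filter_upwards [ht.eventually_mem hV] with n hn
  rw [mul_pow]
  exact h _ hn n

theorem exists_pow_mul_mem_plus (hT : T.IsAffinoid) {t : T.carrier}
    (ht : Filter.Tendsto (fun n : ℕ => t ^ n) Filter.atTop (𝓝 0)) (a : T.carrier) :
    ∃ n : ℕ, a * t ^ n ∈ T.plus := by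
  have h1 : Filter.Tendsto (fun n : ℕ => a * t ^ n) Filter.atTop (𝓝 (a * 0)) :=
    ht.const_mul a
  rw [mul_zero] at h1
  exact (h1.eventually_mem (hT.isOpen.mem_nhds T.plus.zero_mem)).exists

/-- A complete affinoid ring with a topologically nilpotent unit has enough continuous valuations:
an element which vanishes at no point of `Spa(T, T⁺)` is invertible. A maximal ideal `m` yields a
point, because the image of `T⁺` in the field `T / m` is dominated by a valuation ring in which
the topologically nilpotent unit `t` is not invertible. -/
theorem isUnit_of_forall_points (hT : T.IsAffinoid) (hc : T.IsComplete) {t : T.carrier}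
    (ht : Filter.Tendsto (fun n : ℕ => t ^ n) Filter.atTop (𝓝 0)) (hu : IsUnit t)
    (htp : t ∈ T.plus) {f : T.carrier} (hf : ∀ x ∈ T.points, ¬ x.vle f 0) : IsUnit f := by
  by_contra hfu
  obtain ⟨m, hm, hfm⟩ := exists_max_ideal_of_mem_nonunits hfu
  let : Field (T.carrier ⧸ m) := Ideal.Quotient.field m
  let q : T.carrier →+* T.carrier ⧸ m := Ideal.Quotient.mk m
  let R : Subring (T.carrier ⧸ m) := T.plus.map q
  let τ : R := ⟨q t, t, htp, rfl⟩
  have hτ : Ideal.span {τ} ≠ ⊤ := by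
    rw [Ne, Ideal.span_singleton_eq_top]
    intro h
    obtain ⟨⟨_, s, hs, rfl⟩, h⟩ := h.exists_right_inv
    have h1 : q t * q s = 1 := congr_arg Subtype.val h
    have h2 : 1 - t * s ∈ m := by
      rw [← Ideal.Quotient.eq_zero_iff_mem, map_sub, map_mul, map_one]
      exact sub_eq_zero.2 h1.symm
    exact hm.ne_top (Ideal.eq_top_of_isUnit_mem _ h2 (isUnit_one_sub_mul hT hc ht hs))
  obtain ⟨V, hRV, hτV⟩ := Ideal.image_subset_nonunits_valuationSubring _ hτ
  let w : Valuation T.carrier V.ValueGroup := V.valuation.comap q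
  have hw1 : ∀ a ∈ T.plus, w a ≤ 1 := fun a ha =>
    (V.valuation_le_one_iff _).2 (hRV ⟨a, ha, rfl⟩)
  have hwt : w t < 1 :=
    (V.mem_nonunits_iff).1 (hτV ⟨τ, Ideal.mem_span_singleton_self τ, rfl⟩)
  have hb : ∀ a, ∃ n : ℕ, w a * w t ^ n ≤ 1 := fun a => by
    obtain ⟨n, hn⟩ := exists_pow_mul_mem_plus hT ht a
    refine ⟨n, ?_⟩
    rw [← map_pow, ← map_mul]
    exact hw1 _ hn
  let x := cofinalValuation w t hwt hb
  have hx : x ∈ T.points := by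
    refine ⟨fun b c hb0 _ => ?_, fun a ha => .inl ?_⟩
    · obtain ⟨k, hk⟩ := exists_lt_of_not_vle_zero hb0
      have hset : {a | ¬ x.vle b (a * c)} = {a | w (a * c) < w b} := by
        ext a
        refine ⟨fun h => not_le.1 fun h' => h (.inl h'), fun h h' => ?_⟩
        rcases h' with h' | h'
        · exact h.not_ge h'
        · exact hk.not_ge (h' k)
      rw [hset, isOpen_iff_mem_nhds]
      intro a ha
      obtain ⟨j, hj⟩ := hb c
      have hV : IsOpen ((fun d => t ^ (j + k) * d) '' (T.plus : Set T.carrier)) := by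
        obtain ⟨v, hv⟩ := hu.pow (j + k)
        rw [← hv]
        exact (Homeomorph.smul v).isOpenMap _ hT.isOpen
      have hV0 : (fun d => t ^ (j + k) * d) '' (T.plus : Set T.carrier) ∈ 𝓝 (a - a) :=
        hV.mem_nhds ⟨0, T.plus.zero_mem, by simp⟩
      have hcont : Filter.Tendsto (fun a' => a' - a) (𝓝 a) (𝓝 (a - a)) :=
        (continuous_id.sub continuous_const).continuousAt
      filter_upwards [hcont.eventually_mem hV0]
      rintro a' ⟨d, hd, hda⟩
      have h1 : a' * c = t ^ (j + k) * d * c + a * c := by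
        rw [show t ^ (j + k) * d = a' - a from hda]
        ring
      change w (a' * c) < w b
      rw [h1]
      refine w.map_add_lt ?_ ha
      refine lt_of_le_of_lt ?_ hk
      calc w (t ^ (j + k) * d * c) = (w c * w t ^ j) * (w t ^ k * w d) := by
            rw [map_mul, map_mul, map_pow, pow_add]
            ac_rfl
        _ ≤ 1 * (w t ^ k * 1) := mul_le_mul' hj (mul_le_mul_right (hw1 d hd) _)
        _ = _ := by rw [one_mul, mul_one]
    · rw [map_one]
      exact hw1 a ha
  refine hf x hx (.inl ?_)
  have : q f = 0 := Ideal.Quotient.eq_zero_iff_mem.2 hfm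
  change V.valuation (q f) ≤ _
  rw [this, map_zero]
  exact zero_le

end UnitCriterion

/-! ### The point `0` of `Spa(B^{b,+}, B^{b,+})` -/

section ZeroPoint

variable (p : ℕ) [Fact p.Prime] {E : Type u} [NontriviallyNormedField E] [IsUltrametricDist E]
  [NormedAlgebra ℚ_[p] E] [FiniteDimensional ℚ_[p] E]

section Expansion

variable {R S : Type u} [CommRing R] [CommRing S] {j : 𝓀[E] →+* R} {j' : 𝓀[E] →+* S} {π : 𝒪[E]}

theorem isExpansion_map (f : R →+* S) (h : f.comp j = j') {z : RamifiedWitt p j} {b : ℕ → R}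
    (hz : IsExpansion p j π z b) :
    IsExpansion p j' π (RamifiedWitt.map p j j' f h z) (fun i => f (b i)) := by
  intro m
  have h1 := map_dvd (RamifiedWitt.map p j j' f h) (hz m)
  rw [map_pow, map_ofInteger, map_sub, partialSum, map_sum] at h1
  rw [partialSum]
  convert h1 using 3 with i
  rw [map_mul, map_pow, map_teichmuller, map_ofInteger]

end Expansion

variable {F : Type u} [NontriviallyNormedField F] [IsUltrametricDist F] [Algebra 𝓀[E] F]

theorem charP_residueField_integer [CharP F p] : CharP 𝓀[F] p := by
  have := charP_integer p F
  refine (CharP.charP_iff_prime_eq_zero Fact.out).2 ?_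
  rw [← map_natCast (IsLocalRing.residue 𝒪[F]), CharP.cast_eq_zero, map_zero]

theorem perfectRing_residueField_integer [CharP F p] [PerfectRing F p] [CharP 𝓀[F] p] :
    PerfectRing 𝓀[F] p := by
  have := charP_integer p F
  have := perfectRing_integer p F
  refine ⟨(frobenius 𝓀[F] p).injective, fun x => ?_⟩
  obtain ⟨x, rfl⟩ := IsLocalRing.residue_surjective x
  obtain ⟨y, rfl⟩ := (frobeniusEquiv 𝒪[F] p).surjective x
  exact ⟨IsLocalRing.residue _ y, (map_pow (IsLocalRing.residue 𝒪[F]) y p).symm⟩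

variable {π : 𝒪[E]}

theorem residue_eq_zero_iff_norm_lt (a : 𝒪[F]) :
    IsLocalRing.residue 𝒪[F] a = 0 ↔ ‖a‖ < 1 := by
  rw [IsLocalRing.residue_eq_zero_iff, IsLocalRing.mem_maximalIdeal, mem_nonunits_iff,
    Valued.integer.isUnit_iff_norm_eq_one]
  exact ⟨fun h => lt_of_le_of_ne (Valued.integer.mem_iff.1 a.2) h, fun h => h.ne⟩

/-- The `π`-adic valuation of the reduction of `∑ [b_i] π^i` in `W_{𝒪_E}(k_F)` is the smallest
index `i` for which `b_i` is a unit. -/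
theorem le_emultiplicity_reduction [CharP F p] [PerfectRing F p] (hπ : Irreducible π)
    {z : BbPlus p E F} {b : ℕ → 𝒪[F]} (hz : IsExpansion p _ π z b) (m : ℕ) :
    (m : ℕ∞) ≤ emultiplicity (ofInteger p _ π) (reduction p z) ↔ ∀ i < m, ‖b i‖ < 1 := by
  have := charP_residueField_integer p (F := F)
  have := perfectRing_residueField_integer p (F := F)
  have h1 := isExpansion_map p (IsLocalRing.residue 𝒪[F]) rfl hz
  have h2 := coeff_eq p _ hπ h1
  rw [← pow_dvd_iff_le_emultiplicity]
  constructor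
  · rintro ⟨c, hc⟩ i hi
    rw [← residue_eq_zero_iff_norm_lt, ← congr_fun h2 i]
    refine Eq.trans (congr_arg (coeff p _ hπ · i) hc) ?_
    exact coeff_pow_mul_of_lt p _ hπ m c i hi
  · intro h
    refine dvd_of_coeff_eq_zero p _ hπ fun i hi => ?_
    exact (congr_fun h2 i).trans ((residue_eq_zero_iff_norm_lt _).2 (h i hi))

variable {Γ : Type*} [LinearOrderedCommGroupWithZero Γ]

theorem map_teichmuller_eq_zero {ϖ : 𝒪[F]} (hϖ0 : ϖ ≠ 0) (v : Valuation (BbPlus p E F) Γ)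
    (h : v (teichmuller p _ ϖ) = 0) {a : 𝒪[F]} (ha : ‖a‖ < 1) : v (teichmuller p _ a) = 0 := by
  obtain ⟨n, hn⟩ := exists_pow_lt_of_lt_one (norm_pos_iff.2 hϖ0) ha
  obtain ⟨c, hc⟩ : ϖ ∣ a ^ n := dvd_iff_norm_le.2 (by rw [norm_pow]; exact hn.le)
  have h1 : v (teichmuller p _ a) ^ n = 0 := by
    rw [← map_pow, ← map_pow, hc, map_mul, map_mul, h, zero_mul]
  exact eq_zero_of_pow_eq_zero h1

theorem map_teichmuller_eq_one (v : Valuation (BbPlus p E F) Γ) (h1 : ∀ a, v a ≤ 1)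
    {a : 𝒪[F]} (ha : ¬ ‖a‖ < 1) : v (teichmuller p _ a) = 1 := by
  have hu : IsUnit a := Valued.integer.isUnit_iff_norm_eq_one.2
    (le_antisymm (Valued.integer.mem_iff.1 a.2) (not_lt.1 ha))
  obtain ⟨c, hc⟩ := (hu.map (teichmuller p (residueFieldToInteger p E F))).exists_right_inv
  refine le_antisymm (h1 _) ?_
  rw [← map_one v, ← hc, map_mul]
  exact mul_le_of_le_one_right' (h1 c)

/-- If `|[ϖ]| = 0`, then `|∑ [b_i] π^i| ≤ |π|^m` as soon as `|b_i| < 1` for `i < m`. -/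
theorem map_le_pow_of_norm_lt {ϖ : 𝒪[F]} (hϖ0 : ϖ ≠ 0) (v : Valuation (BbPlus p E F) Γ)
    (h1 : ∀ a, v a ≤ 1) (h : v (teichmuller p _ ϖ) = 0) {z : BbPlus p E F} {b : ℕ → 𝒪[F]}
    (hz : IsExpansion p _ π z b) {m : ℕ} (hb : ∀ i < m, ‖b i‖ < 1) :
    v z ≤ v (ofInteger p _ π) ^ m := by
  obtain ⟨c, hc⟩ := hz m
  have h2 : v (partialSum p _ π b m) ≤ v (ofInteger p _ π) ^ m := by
    refine v.map_sum_le fun i hi => ?_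
    rw [map_mul, map_teichmuller_eq_zero p hϖ0 v h (hb i (Finset.mem_range.1 hi)), zero_mul]
    exact zero_le
  rw [← sub_add_cancel z (partialSum p _ π b m), hc]
  refine v.map_add_le ?_ h2
  rw [map_mul, map_pow]
  exact mul_le_of_le_one_right' (h1 c)

theorem map_eq_pow_of_norm_lt {ϖ : 𝒪[F]} (hϖ0 : ϖ ≠ 0) (v : Valuation (BbPlus p E F) Γ)
    (h1 : ∀ a, v a ≤ 1) (h : v (teichmuller p _ ϖ) = 0) (hπ0 : v (ofInteger p _ π) ≠ 0)
    (hπ1 : v (ofInteger p _ π) < 1) {z : BbPlus p E F} {b : ℕ → 𝒪[F]}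
    (hz : IsExpansion p _ π z b) {m : ℕ} (hb : ∀ i < m, ‖b i‖ < 1) (hm : ¬ ‖b m‖ < 1) :
    v z = v (ofInteger p _ π) ^ m := by
  have hpos : 0 < v (ofInteger p _ π) ^ m := zero_lt_iff.2 (pow_ne_zero m hπ0)
  have hterm : v (teichmuller p _ (b m) * ofInteger p _ π ^ m) = v (ofInteger p _ π) ^ m := by
    rw [map_mul, map_teichmuller_eq_one p v h1 hm, one_mul, map_pow]
  obtain ⟨c, hc⟩ := hz (m + 1)
  have h2 : v (partialSum p _ π b m) < v (ofInteger p _ π) ^ m := by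
    refine v.map_sum_lt hpos.ne' fun i hi => ?_
    rw [map_mul, map_teichmuller_eq_zero p hϖ0 v h (hb i (Finset.mem_range.1 hi)), zero_mul]
    exact hpos
  have h3 : v (ofInteger p _ π ^ (m + 1) * c) < v (ofInteger p _ π) ^ m := by
    rw [map_mul, map_pow, pow_succ]
    calc _ ≤ v (ofInteger p _ π) ^ m * v (ofInteger p _ π) := mul_le_of_le_one_right' (h1 c)
      _ < v (ofInteger p _ π) ^ m * 1 := by gcongr
      _ = _ := mul_one _
  have h4 : z = (ofInteger p _ π ^ (m + 1) * c + partialSum p _ π b m) +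
      teichmuller p _ (b m) * ofInteger p _ π ^ m := by
    rw [← hc, partialSum, Finset.sum_range_succ, ← partialSum]
    ring
  rw [h4, v.map_add_eq_of_lt_right, hterm]
  rw [hterm]
  exact v.map_add_lt h3 h2

/-- The point `0` is the only continuous valuation on `B^{b,+}` with `|[ϖ]| = 0 ≠ |π|`. -/
theorem mem_zeroPoint [CharP F p] [PerfectRing F p] (hπ : Irreducible π) {ϖ : 𝒪[F]} (hϖ0 : ϖ ≠ 0)
    {x : ValuativeRel (BbPlus p E F)} (hx : x ∈ (bbPlusPair p π ϖ).points)
    (h0 : x.vle (teichmuller p _ ϖ) 0) (hπ0 : ¬ x.vle (ofInteger p _ π) 0) :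
    x ∈ zeroPoint p F π := by
  let v := ValuativeRel.valuation (BbPlus p E F)
  have hv : ∀ a b : BbPlus p E F, x.vle a b ↔ v a ≤ v b := fun a b => v.vle_iff_le
  have h1 : ∀ a, v a ≤ 1 := fun a => by
    rw [← map_one v, ← hv]
    exact hx.2 a (Subring.mem_top _)
  have h0' : v (teichmuller p _ ϖ) = 0 := by
    rw [hv, map_zero] at h0
    exact le_zero_iff.1 h0
  have hπ0' : v (ofInteger p _ π) ≠ 0 := by
    rw [hv, map_zero, le_zero_iff] at hπ0
    exact hπ0
  have hcof : ∀ c, v c ≠ 0 → ∃ n : ℕ, v (ofInteger p _ π) ^ n < v c := by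
    intro c hc
    have hc' : ¬ x.vle c 0 := by rwa [hv, map_zero, le_zero_iff]
    have hopen := hx.1 c 1 hc' x.not_vle_one_zero
    obtain ⟨n, hn⟩ := (mem_nhds_bbPlus p).1 (hopen.mem_nhds (by
      change ¬ x.vle c ((0 : BbPlus p E F) * 1)
      rwa [zero_mul]))
    refine ⟨n, ?_⟩
    have h2 : ¬ x.vle c (ofInteger p _ π ^ n * 1) :=
      hn (Ideal.pow_mem_pow (Ideal.subset_span (by simp)) n)
    rw [mul_one, hv, not_le, map_pow] at h2
    exact h2
  have hπ1 : v (ofInteger p _ π) < 1 := by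
    obtain ⟨n, hn⟩ := hcof 1 (by rw [map_one]; exact one_ne_zero)
    rw [map_one] at hn
    exact lt_of_le_of_ne (h1 _) fun h => hn.ne (by rw [h, one_pow])
  have hchar := charP_integer p F
  have hperf := perfectRing_integer p F
  -- the valuation of `z` is determined by the `π`-adic valuation of its reduction
  have key : ∀ z : BbPlus p E F,
      (∃ m : ℕ, emultiplicity (ofInteger p _ π) (reduction p z) = m ∧
        v z = v (ofInteger p _ π) ^ m) ∨
      (emultiplicity (ofInteger p _ π) (reduction p z) = ⊤ ∧ v z = 0) := by
    intro z
    obtain ⟨b, hb⟩ := exists_isExpansion p _ hπ z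
    have hle := le_emultiplicity_reduction p hπ hb
    by_cases hall : ∀ i, ‖b i‖ < 1
    · refine .inr ⟨ENat.eq_top_iff_forall_ge.2 fun m => (hle m).2 fun i _ => hall i, ?_⟩
      by_contra hz
      obtain ⟨n, hn⟩ := hcof z hz
      exact hn.not_ge (map_le_pow_of_norm_lt p hϖ0 v h1 h0' hb fun i _ => hall i)
    · classical
      push Not at hall
      have hm := Nat.find_spec hall
      have hlt : ∀ i < Nat.find hall, ‖b i‖ < 1 := fun i hi => not_le.1 (Nat.find_min hall hi)
      refine .inl ⟨Nat.find hall, le_antisymm ?_ ((hle _).2 hlt),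
        map_eq_pow_of_norm_lt p hϖ0 v h1 h0' hπ0' hπ1 hb hlt hm.not_gt⟩
      by_contra hcon
      have h3 : ((Nat.find hall + 1 : ℕ) : ℕ∞) ≤
          emultiplicity (ofInteger p _ π) (reduction p z) := by
        push_cast
        exact Order.add_one_le_of_lt (not_le.1 hcon)
      exact ((hle _).1 h3 _ (Nat.lt_succ_self _)).not_ge hm
  intro a b
  rw [hv]
  rcases key a with ⟨m, hm, hva⟩ | ⟨hm, hva⟩ <;> rcases key b with ⟨n, hn, hvb⟩ | ⟨hn, hvb⟩ <;>
    rw [hva, hvb, hm, hn]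
  · rw [pow_le_pow_iff_right_of_lt_one₀ (zero_lt_iff.2 hπ0') hπ1, Nat.cast_le]
  · simp [hπ0']
  · simp
  · simp

/-- The ring homomorphism underlying a point of `B^{b,+}`. -/
def pointHom {ϖ : 𝒪[F]} {T : Pair.{u}} (g : bbPlusPair p π ϖ ⟶ T) : BbPlus p E F →+* T.carrier :=
  Pair.Hom.toRingHom g

theorem exists_pow_le_preimage {ϖ : 𝒪[F]} {T : Pair.{u}} (g : bbPlusPair p π ϖ ⟶ T)
    {U : Set T.carrier} (hU : U ∈ 𝓝 0) :
    ∃ n : ℕ, ∀ a ∈ idealOfDefinition p π ϖ ^ n, pointHom p g a ∈ U := by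
  have hc : Filter.Tendsto (Pair.Hom.toRingHom g) (𝓝 0) (𝓝 0) := by
    have := g.continuous'.continuousAt (x := 0)
    rwa [ContinuousAt, map_zero] at this
  obtain ⟨n, hn⟩ := (mem_nhds_bbPlus p).1 (hc hU)
  exact ⟨n, fun a ha => hn ha⟩

theorem tendsto_pointHom_pow {ϖ : 𝒪[F]} {T : Pair.{u}} (g : bbPlusPair p π ϖ ⟶ T)
    {a : BbPlus p E F} (ha : a ∈ idealOfDefinition p π ϖ) :
    Filter.Tendsto (fun n : ℕ => pointHom p g a ^ n) Filter.atTop (𝓝 0) := by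
  intro U hU
  obtain ⟨n, hn⟩ := exists_pow_le_preimage p g hU
  change ∀ᶠ n : ℕ in Filter.atTop, _ ∈ U
  filter_upwards [Filter.eventually_ge_atTop n] with m hm
  rw [← map_pow]
  exact hn _ (Ideal.pow_le_pow_right hm (Ideal.pow_mem_pow ha m))

theorem uniformizer_mem (π : 𝒪[E]) (ϖ : 𝒪[F]) : ofInteger p _ π ∈ idealOfDefinition p π ϖ :=
  Ideal.subset_span (by simp)

theorem teichmuller_mem (π : 𝒪[E]) (ϖ : 𝒪[F]) : teichmuller p _ ϖ ∈ idealOfDefinition p π ϖ :=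
  Ideal.subset_span (by simp)

/-- A point of `B^{b,+}` in a complete affinoid ring which avoids the point `0` and for which `π`
is invertible has `[ϖ]` invertible. -/
theorem isUnit_teichmuller_of_avoids [CharP F p] [PerfectRing F p] (hπ : Irreducible π)
    {ϖ : 𝒪[F]} (hϖ0 : ϖ ≠ 0) (T : CompleteAffinoid.{u}) (g : bbPlusPair p π ϖ ⟶ T.obj)
    (hg : IsUnit (Pair.Hom.toRingHom g (ofInteger p (residueFieldToInteger p E F) π)))
    (hZ : ∀ x ∈ T.obj.points, comapValuation (Pair.Hom.toRingHom g) x ∉ zeroPoint p F π) :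
    IsUnit (Pair.Hom.toRingHom g (teichmuller p (residueFieldToInteger p E F) ϖ)) := by
  refine isUnit_of_forall_points T.property.1 T.property.2
    (tendsto_pointHom_pow p g (uniformizer_mem p π ϖ)) hg
    (g.map_plus' _ (Subring.mem_top _)) fun x hx h0 => hZ x hx ?_
  refine mem_zeroPoint p hπ hϖ0 (Pair.Hom.comap_mem_points g hx) ?_ ?_
  · change x.vle (Pair.Hom.toRingHom g _) (Pair.Hom.toRingHom g 0)
    rwa [map_zero]
  · intro h
    have h' : x.vle (Pair.Hom.toRingHom g (ofInteger p _ π)) (Pair.Hom.toRingHom g 0) := h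
    rw [map_zero] at h'
    exact not_vle_zero_of_isUnit x hg h'

end ZeroPoint

/-! ### Power-multiplicativity of `|·|_I` -/

section GaussNorm

variable (p : ℕ) [Fact p.Prime] {E : Type u} [NontriviallyNormedField E] [IsUltrametricDist E]
  [NormedAlgebra ℚ_[p] E] [FiniteDimensional ℚ_[p] E]

section Coefficients

variable {F : Type u} [Field F] [CharP F p] [PerfectRing F p] (j : 𝓀[E] →+* F) {π : 𝒪[E]}
  (hπ : Irreducible π)

theorem coeff_zero_eq_residue (z : RamifiedWitt p j) : coeff p j hπ z 0 = residue p j z := by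
  have h := isExpansion_coeff p j hπ z 1
  rw [partialSum_succ, partialSum, Finset.sum_range_zero, mul_zero, add_zero, pow_one] at h
  obtain ⟨c, hc⟩ := h
  have h1 := congr_arg (residue p j) hc
  rw [map_mul, residue_uniformizer p j hπ, zero_mul, map_sub, residue_teichmuller,
    sub_eq_zero] at h1
  exact h1.symm

theorem partialSum_add (b : ℕ → F) (m k : ℕ) : partialSum p j π b (m + k) =
    partialSum p j π b m + ofInteger p j π ^ m * partialSum p j π (fun i => b (i + m)) k := by
  rw [partialSum, Finset.sum_range_add, partialSum, partialSum, Finset.mul_sum]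
  congr 1
  refine Finset.sum_congr rfl fun i _ => ?_
  rw [pow_add, add_comm m i]
  ring

theorem coeff_of_eq_partialSum_add {z y : RamifiedWitt p j} {m : ℕ}
    (h : z - partialSum p j π (coeff p j hπ z) m = ofInteger p j π ^ m * y) (i : ℕ) :
    coeff p j hπ y i = coeff p j hπ z (i + m) := by
  refine congr_fun (coeff_eq p j hπ (b := fun i => coeff p j hπ z (i + m)) fun k => ?_) i
  obtain ⟨c, hc⟩ := isExpansion_coeff p j hπ z (m + k)
  refine ⟨c, pow_regular p j hπ m _ _ ?_⟩
  rw [partialSum_add] at hc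
  rw [mul_sub, ← h, ← mul_assoc, ← pow_add, ← hc]
  ring

end Coefficients

variable {F : Type u} [NontriviallyNormedField F] [IsUltrametricDist F] [Algebra 𝓀[E] F]
  [CharP F p] [PerfectRing F p] {π : 𝒪[E]} (hπ : Irreducible π)

theorem norm_coeff_one_le (i : ℕ) : ‖coeff p (algebraMap 𝓀[E] F) hπ 1 i‖ ≤ 1 := by
  rw [← map_one (toWittF p E F)]
  exact norm_coeff_toWittF p hπ 1 i

theorem weighted_neg {ρ C : ℝ} (h0 : 0 < ρ) (h1 : ρ ≤ 1) {x : WittF p E F}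
    (hx : ∀ i, ‖coeff p _ hπ x i‖ * ρ ^ i ≤ C) (i : ℕ) : ‖coeff p _ hπ (-x) i‖ * ρ ^ i ≤ C := by
  have h := weighted_mul p hπ h0 h1 (x := toWittF p E F (-1)) (y := x) (C := 1) (fun i =>
    mul_le_one₀ (norm_coeff_toWittF p hπ _ i) (pow_nonneg h0.le i) (pow_le_one₀ h0.le h1)) hx i
  rwa [map_neg, map_one, neg_one_mul, one_mul] at h

theorem weighted_partialSum {ρ C : ℝ} (h0 : 0 < ρ) (h1 : ρ ≤ 1) (hC : 0 ≤ C) (b : ℕ → F) (m : ℕ)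
    (hb : ∀ i < m, ‖b i‖ * ρ ^ i ≤ C) (i : ℕ) :
    ‖coeff p _ hπ (partialSum p (algebraMap 𝓀[E] F) π b m) i‖ * ρ ^ i ≤ C := by
  induction m generalizing i with
  | zero =>
    rw [partialSum, Finset.sum_range_zero, coeff_zero, norm_zero, zero_mul]
    exact hC
  | succ m ih =>
    rw [partialSum, Finset.sum_range_succ, ← partialSum]
    refine weighted_add p hπ h0 h1 (ih fun i hi => hb i (by omega)) (fun k => ?_) i
    rw [mul_comm (teichmuller p _ (b m))]
    by_cases hk : k < m
    · rw [coeff_pow_mul_of_lt p _ hπ _ _ _ hk, norm_zero, zero_mul]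
      exact hC
    · obtain ⟨l, rfl⟩ : ∃ l, k = l + m := ⟨k - m, by omega⟩
      have h2 := coeff_teichmuller_mul p (algebraMap 𝓀[E] F) hπ (b m) 1 l
      rw [mul_one] at h2
      rw [coeff_pow_mul, h2, norm_mul]
      refine le_trans ?_ (hb m (Nat.lt_succ_self m))
      refine mul_le_mul ?_ (pow_le_pow_of_le_one h0.le h1 (by omega)) (pow_nonneg h0.le _)
        (norm_nonneg _)
      exact mul_le_of_le_one_right (norm_nonneg _) (norm_coeff_one_le p hπ l)

theorem exists_bound_lt {a : ℕ → ℝ} {A : ℝ} (hA : 0 < A) {m : ℕ} (h : ∀ i < m, a i < A) :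
    ∃ A', 0 ≤ A' ∧ A' < A ∧ ∀ i < m, a i ≤ A' := by
  induction m with
  | zero => exact ⟨0, le_rfl, hA, fun i hi => absurd hi (Nat.not_lt_zero i)⟩
  | succ m ih =>
    obtain ⟨A', h2, h3, h4⟩ := ih fun i hi => h i (by omega)
    refine ⟨max A' (a m), le_max_of_le_left h2, max_lt h3 (h m (Nat.lt_succ_self m)),
      fun i hi => ?_⟩
    rcases Nat.lt_succ_iff_lt_or_eq.1 hi with hi | rfl
    · exact le_max_of_le_left (h4 i hi)
    · exact le_max_right _ _

/-- If `|z_i| ρ^i` takes its largest value for the first time at the index `m`, then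
`|z²|_ρ ≥ (|z_m| ρ^m)²`: modulo terms of smaller norm, `z²` is divisible by `π^{2m}`, and its
coefficient of index `2m` is `z_m²`. -/
theorem sq_le_of_weighted {ρ D : ℝ} (h0 : 0 < ρ) (h1 : ρ ≤ 1) {z : WittF p E F} {m : ℕ}
    (hle : ∀ i, ‖coeff p _ hπ z i‖ * ρ ^ i ≤ ‖coeff p _ hπ z m‖ * ρ ^ m)
    (hlt : ∀ i < m, ‖coeff p _ hπ z i‖ * ρ ^ i < ‖coeff p _ hπ z m‖ * ρ ^ m)
    (hD : ∀ i, ‖coeff p _ hπ (z * z) i‖ * ρ ^ i ≤ D) :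
    (‖coeff p _ hπ z m‖ * ρ ^ m) ^ 2 ≤ D := by
  set A := ‖coeff p _ hπ z m‖ * ρ ^ m with hA
  have hA0 : 0 ≤ A := mul_nonneg (norm_nonneg _) (pow_nonneg h0.le _)
  have hD0 : 0 ≤ D := (mul_nonneg (norm_nonneg _) (pow_nonneg h0.le _)).trans (hD 0)
  rcases hA0.eq_or_lt with hA1 | hA1
  · rw [← hA1]
    simpa using hD0
  obtain ⟨A', hA'0, hA'A, hA'⟩ : ∃ A', 0 ≤ A' ∧ A' < A ∧
      ∀ i < m, ‖coeff p _ hπ z i‖ * ρ ^ i ≤ A' :=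
    exists_bound_lt hA1 hlt
  obtain ⟨y, hy⟩ := isExpansion_coeff p _ hπ z m
  have hyc := coeff_of_eq_partialSum_add p _ hπ hy
  set z₁ := partialSum p (algebraMap 𝓀[E] F) π (coeff p _ hπ z) m with hz₁
  set z₂ := ofInteger p (algebraMap 𝓀[E] F) π ^ m * y with hz₂
  have hz₁A := weighted_partialSum p hπ h0 h1 hA'0 (coeff p _ hπ z) m hA'
  rw [← hz₁] at hz₁A
  have hz₂A : ∀ i, ‖coeff p _ hπ z₂ i‖ * ρ ^ i ≤ A := by
    intro i
    by_cases hi : i < m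
    · rw [hz₂, coeff_pow_mul_of_lt p _ hπ _ _ _ hi, norm_zero, zero_mul]
      exact hA0
    · obtain ⟨l, rfl⟩ : ∃ l, i = l + m := ⟨i - m, by omega⟩
      rw [hz₂, coeff_pow_mul, hyc]
      exact hle _
  -- `z₁` collects the terms before the maximum, so `z₂²` differs from `z²` by terms of norm `< A²`
  have hsq : z₂ * z₂ = z * z + -(z₁ * (z + z₂)) := by
    rw [← hy]
    ring
  have hbound : ∀ i, ‖coeff p _ hπ (z₂ * z₂) i‖ * ρ ^ i ≤ max D (A' * A) := by
    rw [hsq]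
    refine weighted_add p hπ h0 h1 (fun i => (hD i).trans (le_max_left _ _)) fun i => ?_
    refine (weighted_neg p hπ h0 h1 ?_ i).trans (le_max_right D _)
    exact weighted_mul p hπ h0 h1 hz₁A (weighted_add p hπ h0 h1 hle hz₂A)
  have h2 := hbound (0 + (m + m))
  have h3 : z₂ * z₂ = ofInteger p (algebraMap 𝓀[E] F) π ^ (m + m) * (y * y) := by
    rw [hz₂, pow_add]
    ring
  rw [h3, coeff_pow_mul, coeff_zero_eq_residue, map_mul, ← coeff_zero_eq_residue p _ hπ, hyc,
    zero_add, zero_add, norm_mul, pow_add] at h2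
  have h4 : A ^ 2 ≤ max D (A' * A) := by
    refine le_trans (le_of_eq ?_) h2
    rw [hA]
    ring
  rcases le_max_iff.1 h4 with h | h
  · exact h
  · exact absurd h (not_le.2 (by rw [sq]; exact mul_lt_mul_of_pos_right hA'A hA1))

/-- A sequence of nonnegative real numbers converging to `0` has a first largest term. -/
theorem exists_first_max {a : ℕ → ℝ} (h0 : ∀ i, 0 ≤ a i)
    (ha : Filter.Tendsto a Filter.atTop (𝓝 0)) :
    ∃ m, (∀ i, a i ≤ a m) ∧ ∀ i < m, a i < a m := by
  classical
  have hex : ∃ m, ∀ i, a i ≤ a m := by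
    by_cases hz : ∀ i, a i = 0
    · exact ⟨0, fun i => by rw [hz, hz]⟩
    · push Not at hz
      obtain ⟨k, hk⟩ := hz
      have hk' : 0 < a k := lt_of_le_of_ne (h0 k) hk.symm
      obtain ⟨N, hN⟩ := Filter.eventually_atTop.1 (ha.eventually_lt_const hk')
      obtain ⟨m, hm, hmax⟩ := (Finset.range (N + k + 1)).exists_max_image a ⟨k, by simp⟩
      refine ⟨m, fun i => ?_⟩
      by_cases hi : i < N + k + 1
      · exact hmax i (Finset.mem_range.2 hi)
      · exact (hN i (by omega)).le.trans (hmax k (by simp))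
  refine ⟨Nat.find hex, Nat.find_spec hex, fun i hi => ?_⟩
  have := Nat.find_min hex hi
  push Not at this
  obtain ⟨l, hl⟩ := this
  exact hl.trans_le (Nat.find_spec hex l)

/-- The norm `|·|_I` is power-multiplicative. -/
theorem sq_intervalNorm_le {x : WittFInv p E F π} (hx : x ∈ Bb p hπ) (I : ClosedInterval) :
    intervalNorm p hπ I x ^ 2 ≤ intervalNorm p hπ I (x * x) := by
  have hxx := (Bb p hπ).mul_mem hx hx
  have hnn := intervalNorm_nonneg p hπ hxx I
  have key : intervalNorm p hπ I x ≤ √(intervalNorm p hπ I (x * x)) := by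
    rw [intervalNorm_le_iff p hπ hx]
    intro ρ hρ
    obtain ⟨h0, h1⟩ := mem_interval_bounds hρ
    have hρ1 : ρ < 1 := hρ.2.trans_lt I.snd.2.2
    obtain ⟨N, y, hy⟩ := exists_pow_mul p x
    have hN := pow_pos h0 N
    rw [bound_iff p hπ hy h0]
    obtain ⟨C, hC⟩ := hx
    obtain ⟨-, hxy⟩ := (isTeichmullerExpansion p hπ x).apply_eq p hπ hy
    have ht : Filter.Tendsto (fun i : ℕ => ‖coeff p _ hπ y i‖ * ρ ^ i) Filter.atTop (𝓝 0) := by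
      refine squeeze_zero (g := fun i : ℕ => C * ρ ^ i)
        (fun i => mul_nonneg (norm_nonneg _) (pow_nonneg h0.le i)) (fun i => ?_) ?_
      · rw [← hxy]
        exact mul_le_mul_of_nonneg_right (hC _) (pow_nonneg h0.le i)
      · have := (tendsto_pow_atTop_nhds_zero_of_lt_one h0.le hρ1).const_mul C
        rwa [mul_zero] at this
    obtain ⟨m, hle, hlt⟩ := exists_first_max
      (fun i => mul_nonneg (norm_nonneg _) (pow_nonneg h0.le i)) ht
    have hyy : algebraMap (WittF p E F) (WittFInv p E F π) (y * y) =
        algebraMap (WittF p E F) (WittFInv p E F π) (ofInteger p _ π) ^ (N + N) * (x * x) := by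
      rw [map_mul, hy, pow_add]
      ring
    have hD := (bound_iff p hπ hyy h0).1 (bound_intervalNorm p hπ hxx I ρ hρ)
    have h2 := sq_le_of_weighted p hπ h0 h1 hle hlt hD
    intro i
    refine (hle i).trans ?_
    rw [← div_le_iff₀ hN]
    refine Real.le_sqrt_of_sq_le ?_
    rw [div_pow, div_le_iff₀ (pow_pos hN 2)]
    refine h2.trans_eq ?_
    rw [pow_add]
    ring
  calc _ ≤ √(intervalNorm p hπ I (x * x)) ^ 2 :=
        pow_le_pow_left₀ (intervalNorm_nonneg p hπ hx I) key 2
    _ = _ := Real.sq_sqrt hnn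

theorem norm_BI_sq (I : ClosedInterval) (x : BI p F hπ I) : ‖x‖ ^ 2 ≤ ‖x * x‖ := by
  induction x using UniformSpace.Completion.induction_on with
  | hp => exact isClosed_le (by fun_prop) (by fun_prop)
  | ih x =>
    rw [← UniformSpace.Completion.coe_mul, UniformSpace.Completion.norm_coe,
      UniformSpace.Completion.norm_coe]
    exact sq_intervalNorm_le p hπ x.2 I

end GaussNorm

/-! ### The pairs `(B_I, B_I°)` are complete affinoid rings -/

section Affinoid

variable (p : ℕ) [Fact p.Prime] {E : Type u} [NontriviallyNormedField E] [IsUltrametricDist E]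
  [NormedAlgebra ℚ_[p] E] [FiniteDimensional ℚ_[p] E]
  {F : Type u} [NontriviallyNormedField F] [IsUltrametricDist F] [Algebra 𝓀[E] F]
  [CharP F p] [PerfectRing F p] {π : 𝒪[E]} (hπ : Irreducible π)

theorem mem_Bb_of_bound {z : WittFInv p E F π} {N : ℕ} {y : WittF p E F}
    (hy : algebraMap (WittF p E F) (WittFInv p E F π) y =
      algebraMap (WittF p E F) (WittFInv p E F π) (ofInteger p _ π) ^ N * z)
    {C : ℝ} (hC : ∀ i, ‖coeff p _ hπ y i‖ ≤ C) : z ∈ Bb p hπ := by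
  refine ⟨C, ?_⟩
  have := (bound_iff p hπ hy (C := C) one_pos).2 (by simpa using hC)
  simpa using this

/-- `π` is invertible in `B^b`, and `|π⁻¹|_I` is at most the inverse of the lower end of `I`. -/
theorem exists_uniformizer_inv : ∃ b : Bb p (F := F) hπ,
    toBb p hπ (ofInteger p (residueFieldToInteger p E F) π) * b = 1 ∧
    ∀ I : ClosedInterval, intervalNorm p hπ I (b : WittFInv p E F π) ≤ (I.fst : ℝ)⁻¹ := by
  set z : WittFInv p E F π :=
    IsLocalization.Away.invSelf (ofInteger p (algebraMap 𝓀[E] F) π) with hz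
  have h1 : algebraMap (WittF p E F) (WittFInv p E F π) (ofInteger p _ π) * z = 1 :=
    IsLocalization.Away.mul_invSelf _
  have hy : algebraMap (WittF p E F) (WittFInv p E F π) 1 =
      algebraMap (WittF p E F) (WittFInv p E F π) (ofInteger p _ π) ^ 1 * z := by
    rw [pow_one, h1, map_one]
  have hmem : z ∈ Bb p hπ := mem_Bb_of_bound p hπ hy (norm_coeff_one_le p hπ)
  refine ⟨⟨z, hmem⟩, Subtype.ext ?_, fun I => ?_⟩
  · refine Eq.trans ?_ h1
    exact congr_arg (fun w => algebraMap (WittF p E F) (WittFInv p E F π) w * z)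
      (toWittF_ofInteger p π)
  · rw [intervalNorm_le_iff p hπ hmem]
    intro ρ hρ
    obtain ⟨h0, hρ1⟩ := mem_interval_bounds hρ
    rw [bound_iff p hπ hy h0]
    intro i
    have h2 : ‖coeff p (algebraMap 𝓀[E] F) hπ 1 i‖ * ρ ^ i ≤ 1 :=
      mul_le_one₀ (norm_coeff_one_le p hπ i) (pow_nonneg h0.le i) (pow_le_one₀ h0.le hρ1)
    refine h2.trans ?_
    rw [pow_one, inv_mul_eq_div, one_le_div I.fst.2.1]
    exact hρ.1

theorem isUnit_toBb_teichmuller {ϖ : 𝒪[F]} (hϖ0 : ϖ ≠ 0) :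
    IsUnit (toBb p hπ (teichmuller p (residueFieldToInteger p E F) ϖ)) := by
  have hϖ0' : (ϖ : F) ≠ 0 := fun h => hϖ0 (Subtype.ext h)
  set y : WittF p E F := teichmuller p _ (ϖ : F)⁻¹ with hy
  have hmem : algebraMap (WittF p E F) (WittFInv p E F π) y ∈ Bb p hπ := by
    refine mem_Bb_of_bound p hπ (N := 0) (C := ‖(ϖ : F)⁻¹‖) (by rw [pow_zero, one_mul])
      fun i => ?_
    have := coeff_teichmuller_mul p (algebraMap 𝓀[E] F) hπ (ϖ : F)⁻¹ 1 i
    rw [mul_one] at this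
    rw [hy, this, norm_mul]
    exact mul_le_of_le_one_right (norm_nonneg _) (norm_coeff_one_le p hπ i)
  refine .of_mul_eq_one ⟨_, hmem⟩ (Subtype.ext ?_)
  have h1 : toWittF p E F (teichmuller p _ ϖ) * y = 1 := by
    rw [toWittF_teichmuller, hy, ← map_mul, mul_inv_cancel₀ hϖ0', map_one]
  refine Eq.trans ?_ ((congr_arg (algebraMap (WittF p E F) (WittFInv p E F π)) h1).trans
    (map_one _))
  rw [map_mul]
  rfl

theorem isUnit_toBI_uniformizer (I : ClosedInterval) :
    IsUnit (toBI p F hπ I (ofInteger p (residueFieldToInteger p E F) π)) := by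
  obtain ⟨b, hb, -⟩ := exists_uniformizer_inv p (F := F) hπ
  exact (IsUnit.of_mul_eq_one b hb).map
    (UniformSpace.Completion.coeRingHom : BbNormed p F hπ I →+* BI p F hπ I)

theorem isUnit_toBI_teichmuller {ϖ : 𝒪[F]} (hϖ0 : ϖ ≠ 0) (I : ClosedInterval) :
    IsUnit (toBI p F hπ I (teichmuller p (residueFieldToInteger p E F) ϖ)) :=
  (isUnit_toBb_teichmuller p hπ hϖ0).map
    (UniformSpace.Completion.coeRingHom : BbNormed p F hπ I →+* BI p F hπ I)

theorem norm_toBI_uniformizer_le (I : ClosedInterval) :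
    ‖toBI p F hπ I (ofInteger p (residueFieldToInteger p E F) π)‖ ≤ I.snd := by
  rw [norm_toBI, intervalNorm_le_iff p hπ (toBb p hπ _).2]
  intro ρ hρ n
  obtain ⟨h0, h1⟩ := mem_interval_bounds hρ
  exact (bound_uniformizer p hπ h0 h1 n).trans hρ.2

theorem exists_toBI_uniformizer_inv (I : ClosedInterval) : ∃ c : BI p F hπ I,
    toBI p F hπ I (ofInteger p (residueFieldToInteger p E F) π) * c = 1 ∧
    ‖c‖ ≤ (I.fst : ℝ)⁻¹ := by
  obtain ⟨b, hb, hb'⟩ := exists_uniformizer_inv p (F := F) hπ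
  let ι : BbNormed p F hπ I →+* BI p F hπ I := UniformSpace.Completion.coeRingHom
  refine ⟨ι b, ?_, ?_⟩
  · refine Eq.trans ?_ ((congr_arg ι hb).trans (map_one ι))
    exact (map_mul ι _ _).symm
  · refine le_trans (le_of_eq ?_) (hb' I)
    exact UniformSpace.Completion.norm_coe (E := BbNormed p F hπ I) b

theorem norm_BI_pow_le (I : ClosedInterval) {x : BI p F hπ I} {C : ℝ} (hx : ‖x‖ ≤ C) (n : ℕ) :
    ‖x ^ n‖ ≤ C ^ n := by
  have hC := (norm_nonneg x).trans hx
  induction n with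
  | zero => simpa using norm_BI_one_le p hπ I
  | succ n ih =>
    rw [pow_succ, pow_succ]
    exact (norm_mul_le _ _).trans (mul_le_mul ih hx (norm_nonneg _) (pow_nonneg hC _))

/-- The powers `x^{2^k}` satisfy `|x|^{2^k} ≤ |x^{2^k}|` by `norm_BI_sq`; a general `x^n` is a
factor of `x^{2^n}`. -/
theorem norm_BI_pow (I : ClosedInterval) (x : BI p F hπ I) (n : ℕ) (hx : 1 < ‖x‖) :
    ‖x‖ ^ n ≤ ‖x ^ n‖ := by
  have h1 : ∀ k : ℕ, ‖x‖ ^ 2 ^ k ≤ ‖x ^ 2 ^ k‖ := by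
    intro k
    induction k with
    | zero => simp
    | succ k ih =>
      calc ‖x‖ ^ 2 ^ (k + 1) = (‖x‖ ^ 2 ^ k) ^ 2 := by rw [← pow_mul, pow_succ]
        _ ≤ ‖x ^ 2 ^ k‖ ^ 2 := pow_le_pow_left₀ (pow_nonneg (norm_nonneg _) _) ih 2
        _ ≤ ‖x ^ 2 ^ k * x ^ 2 ^ k‖ := norm_BI_sq p hπ I _
        _ = _ := by rw [← sq, ← pow_mul, ← pow_succ]
  obtain ⟨l, hl⟩ : ∃ l, 2 ^ n = n + l :=
    ⟨2 ^ n - n, by have := (Nat.lt_two_pow_self (n := n)).le; omega⟩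
  have h2 := h1 n
  rw [hl, pow_add, pow_add] at h2
  have h3 : 0 < ‖x‖ ^ l := pow_pos (one_pos.trans hx) l
  refine le_of_mul_le_mul_right (h2.trans ((norm_mul_le _ _).trans ?_)) h3
  exact mul_le_mul_of_nonneg_left (norm_BI_pow_le p hπ I le_rfl l) (norm_nonneg _)

theorem norm_BI_sum_le (I : ClosedInterval) {ι : Type*} (s : Finset ι) (f : ι → BI p F hπ I)
    {C : ℝ} (hC : 0 ≤ C) (h : ∀ i ∈ s, ‖f i‖ ≤ C) : ‖∑ i ∈ s, f i‖ ≤ C := by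
  classical
  induction s using Finset.induction_on with
  | empty => rwa [Finset.sum_empty, norm_zero]
  | insert a s ha ih =>
    rw [Finset.sum_insert ha]
    exact (norm_BI_add_le p hπ I _ _).trans (max_le (h a (Finset.mem_insert_self _ _))
      (ih fun i hi => h i (Finset.mem_insert_of_mem hi)))

/-- The unit ball of `B_I` is integrally closed, since the norm is power-multiplicative. -/
theorem norm_le_one_of_isIntegral (I : ClosedInterval) {a : BI p F hπ I}
    (ha : IsIntegral (BICirc p F hπ I) a) : ‖a‖ ≤ 1 := by
  by_contra hcon
  have hlt : 1 < ‖a‖ := not_le.1 hcon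
  obtain ⟨P, hP, hPa⟩ := ha
  rw [Polynomial.eval₂_eq_sum_range, Finset.sum_range_succ, hP.coeff_natDegree, map_one,
    one_mul] at hPa
  have hPa' : a ^ P.natDegree = -∑ i ∈ Finset.range P.natDegree,
      algebraMap (BICirc p F hπ I) (BI p F hπ I) (P.coeff i) * a ^ i :=
    eq_neg_of_add_eq_zero_right hPa
  rcases Nat.eq_zero_or_pos P.natDegree with h0 | h0
  · rw [h0, Finset.range_zero, Finset.sum_empty, neg_zero, pow_zero] at hPa'
    have : a = 0 := by rw [← mul_one a, hPa', mul_zero]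
    rw [this, norm_zero] at hlt
    exact absurd hlt (by norm_num)
  · have h1 := norm_BI_pow p hπ I a P.natDegree hlt
    rw [hPa', norm_neg] at h1
    have h2 : ‖a‖ ^ P.natDegree ≤ ‖a‖ ^ (P.natDegree - 1) := by
      refine h1.trans (norm_BI_sum_le p hπ I _ _ (pow_nonneg (norm_nonneg _) _) fun i hi => ?_)
      have hi' := Finset.mem_range.1 hi
      refine (norm_mul_le _ _).trans ?_
      have hc : ‖algebraMap (BICirc p F hπ I) (BI p F hπ I) (P.coeff i)‖ ≤ 1 := (P.coeff i).2
      refine (mul_le_of_le_one_left (norm_nonneg _) hc).trans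
        ((norm_BI_pow_le p hπ I le_rfl i).trans ?_)
      exact pow_le_pow_right₀ hlt.le (by omega)
    exact h2.not_gt (pow_lt_pow_right₀ hlt (by omega))

theorem isOpen_BI_of_ball_subset (I : ClosedInterval) (S : AddSubgroup (BI p F hπ I)) {r : ℝ}
    (hr : 0 < r) (h : ∀ x, ‖x‖ < r → x ∈ S) : IsOpen (S : Set (BI p F hπ I)) :=
  S.isOpen_of_mem_nhds (g := 0) (Metric.mem_nhds_iff.2
    ⟨r, hr, fun x hx => h x (mem_ball_zero_iff.1 hx)⟩)

/-- The unit ball is a ring of definition of `B_I`, with the `π`-adic topology. -/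
theorem isFAdic_BI (I : ClosedInterval) : IsFAdic (BI p F hπ I) := by
  have hopen : IsOpen (BICirc p F hπ I : Set (BI p F hπ I)) :=
    isOpen_BI_of_ball_subset p hπ I (BICirc p F hπ I).toAddSubgroup one_pos fun x hx => hx.le
  set t := toBI p F hπ I (ofInteger p (residueFieldToInteger p E F) π) with ht
  have htn := norm_toBI_uniformizer_le p (F := F) hπ I
  rw [← ht] at htn
  have hsnd : (I.snd : ℝ) < 1 := I.snd.2.2
  have hfst : (0 : ℝ) < I.fst := I.fst.2.1
  obtain ⟨c, hc, hcn⟩ := exists_toBI_uniformizer_inv p (F := F) hπ I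
  rw [← ht] at hc
  let τ : BICirc p F hπ I := ⟨t, htn.trans hsnd.le⟩
  have htpow : ∀ n : ℕ, ‖t ^ n‖ ≤ (I.snd : ℝ) ^ n := norm_BI_pow_le p hπ I htn
  have hcpow : ∀ n : ℕ, ‖c ^ n‖ ≤ ((I.fst : ℝ)⁻¹) ^ n := norm_BI_pow_le p hπ I hcn
  refine ⟨BICirc p F hπ I, hopen, Ideal.span {τ}, ⟨{τ}, by simp⟩, isAdic_iff.2 ⟨fun n => ?_, ?_⟩⟩
  · have h1 : IsOpen (((Ideal.span {τ} ^ n).toAddSubgroup.map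
        (BICirc p F hπ I).subtype.toAddMonoidHom : AddSubgroup (BI p F hπ I)) :
        Set (BI p F hπ I)) := by
      refine isOpen_BI_of_ball_subset p hπ I _ (pow_pos hfst n) fun x hx => ?_
      have hx1 : ‖c ^ n * x‖ ≤ 1 := by
        refine (norm_mul_le _ _).trans ((mul_le_mul (hcpow n) hx.le (norm_nonneg _)
          (pow_nonneg (inv_nonneg.2 hfst.le) _)).trans_eq ?_)
        rw [← mul_pow, inv_mul_cancel₀ hfst.ne', one_pow]
      refine ⟨τ ^ n * ⟨c ^ n * x, hx1⟩, ?_, ?_⟩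
      · exact Ideal.mul_mem_right _ _
          (Ideal.pow_mem_pow (Ideal.mem_span_singleton_self τ) n)
      · change t ^ n * (c ^ n * x) = x
        rw [← mul_assoc, ← mul_pow, hc, one_pow, one_mul]
    convert h1.preimage continuous_subtype_val using 1
    ext x
    refine ⟨fun hx => ⟨x, hx, rfl⟩, ?_⟩
    rintro ⟨y, hy, hyx⟩
    have : y = x := Subtype.ext hyx
    exact this ▸ hy
  · intro s hs
    obtain ⟨ε, hε, h⟩ := Metric.mem_nhds_iff.1 hs
    obtain ⟨n, hn⟩ := exists_pow_lt_of_lt_one hε hsnd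
    refine ⟨n, fun x hx => h ?_⟩
    rw [SetLike.mem_coe, Ideal.span_singleton_pow, Ideal.mem_span_singleton] at hx
    obtain ⟨y, rfl⟩ := hx
    rw [Metric.mem_ball, Subtype.dist_eq, dist_eq_norm]
    have h2 : ((τ ^ n * y : BICirc p F hπ I) : BI p F hπ I) - ((0 : BICirc p F hπ I) : BI p F hπ I)
        = t ^ n * (y : BI p F hπ I) := sub_zero _
    rw [h2]
    refine lt_of_le_of_lt ((norm_mul_le _ _).trans ?_) hn
    exact (mul_le_of_le_one_right (norm_nonneg _) y.2).trans (htpow n)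

theorem isPowerBounded_of_norm_le_one (I : ClosedInterval) {a : BI p F hπ I} (ha : ‖a‖ ≤ 1) :
    IsPowerBounded a := by
  intro U hU
  obtain ⟨ε, hε, h⟩ := Metric.mem_nhds_iff.1 hU
  refine ⟨_, Metric.ball_mem_nhds (0 : BI p F hπ I) hε,
      fun (v : BI p F hπ I) hv n => h (mem_ball_zero_iff.2 ?_)⟩
  have hv' : ‖v‖ < ε := mem_ball_zero_iff.1 hv
  have h1 : ‖a ^ n‖ ≤ 1 := (BICirc p F hπ I).pow_mem ha n
  exact lt_of_le_of_lt ((norm_mul_le _ _).trans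
      (mul_le_of_le_one_right (norm_nonneg _) h1)) hv'

theorem isAffinoid_intervalPair (I : ClosedInterval) : (intervalPair p F hπ I).IsAffinoid where
  isFAdic := isFAdic_BI p hπ I
  isOpen := isOpen_BI_of_ball_subset p hπ I (BICirc p F hπ I).toAddSubgroup one_pos
    fun _ hx => hx.le
  integrallyClosed _ ha := norm_le_one_of_isIntegral p hπ I ha
  powerBounded _ ha := isPowerBounded_of_norm_le_one p hπ I ha

theorem isComplete_intervalPair (I : ClosedInterval) : (intervalPair p F hπ I).IsComplete where
  t2 := inferInstanceAs (T2Space (BI p F hπ I))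
  complete := by
    have h : IsTopologicalAddGroup.rightUniformSpace (BI p F hπ I) =
        (inferInstance : UniformSpace (BI p F hπ I)) :=
      IsUniformAddGroup.rightUniformSpace_eq
    change @CompleteSpace (BI p F hπ I) (IsTopologicalAddGroup.rightUniformSpace (BI p F hπ I))
    rw [h]
    infer_instance

end Affinoid

/-! ### Teichmüller expansions under a point of `B^{b,+}` -/

section Terms

variable (p : ℕ) [Fact p.Prime] {E : Type u} [NontriviallyNormedField E] [IsUltrametricDist E]
  [NormedAlgebra ℚ_[p] E] [FiniteDimensional ℚ_[p] E]
  {F : Type u} [NontriviallyNormedField F] [IsUltrametricDist F] [Algebra 𝓀[E] F]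
  {π : 𝒪[E]} {ϖ : 𝒪[F]} {T : Pair.{u}} (g : bbPlusPair p π ϖ ⟶ T)

/-- The image of a Teichmüller representative under a point of `B^{b,+}`. -/
noncomputable def pointTeichmuller : 𝒪[F] →* T.carrier :=
  (pointHom p g).toMonoidHom.comp (teichmuller p (residueFieldToInteger p E F))

/-- An open subgroup containing all `[b_i] π^i u` contains `(∑ [b_i] π^i) u`. -/
theorem pointHom_mul_mem {W : AddSubgroup T.carrier} (hW : IsOpen (W : Set T.carrier))
    {z : BbPlus p E F} {b : ℕ → 𝒪[F]} (hz : IsExpansion p _ π z b) (u : T.carrier)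
    (h : ∀ i, pointTeichmuller p g (b i) * pointHom p g (ofInteger p _ π) ^ i * u ∈ W) :
    pointHom p g z * u ∈ W := by
  have hU : (fun a => a * u) ⁻¹' (W : Set T.carrier) ∈ 𝓝 (0 : T.carrier) :=
    (hW.preimage (continuous_id.mul continuous_const)).mem_nhds (by
      change 0 * u ∈ W
      rw [zero_mul]
      exact W.zero_mem)
  obtain ⟨m, hm⟩ := exists_pow_le_preimage p g hU
  obtain ⟨c, hc⟩ := hz m
  have h1 : pointHom p g (ofInteger p _ π ^ m * c) * u ∈ W :=
    hm _ (Ideal.mul_mem_right _ _ (Ideal.pow_mem_pow (uniformizer_mem p π ϖ) m))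
  have h2 : pointHom p g z * u = pointHom p g (ofInteger p _ π ^ m * c) * u +
      ∑ i ∈ Finset.range m,
        pointTeichmuller p g (b i) * pointHom p g (ofInteger p _ π) ^ i * u := by
    rw [← hc, map_sub, partialSum, map_sum, sub_mul, Finset.sum_mul]
    simp only [map_mul, map_pow]
    exact (sub_add_cancel _ _).symm
  rw [h2]
  exact W.add_mem h1 (W.sum_mem fun i _ => h i)

variable {P' Q' : T.carrier}

/-- Terms of negative degree: if `|b| ρ^i ≤ |ϖ|^{M + N} ρ^N` for `ρ = |ϖ|^r`, then
`[b] π^i / (π [ϖ])^N` is a multiple of `[ϖ]^M ([ϖ]^r / π)^d`, where `d = N - i`. -/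
theorem exists_term_eq_of_neg (hP : pointHom p g (ofInteger p _ π) * P' = 1)
    (hQ : pointTeichmuller p g ϖ * Q' = 1) (hϖ0 : ϖ ≠ 0) {b : 𝒪[F]} {i d M r : ℕ}
    (hb : ‖b‖ * (‖ϖ‖ ^ r) ^ i ≤ ‖ϖ‖ ^ M * ‖ϖ‖ ^ (i + d) * (‖ϖ‖ ^ r) ^ (i + d)) : ∃ c : 𝒪[F],
    pointTeichmuller p g b * pointHom p g (ofInteger p _ π) ^ i * (P' ^ (i + d) * Q' ^ (i + d)) =
      pointTeichmuller p g c * pointTeichmuller p g ϖ ^ M *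
        (pointTeichmuller p g ϖ ^ r * P') ^ d := by
  have hpos : 0 < ‖ϖ‖ := norm_pos_iff.2 hϖ0
  obtain ⟨c, rfl⟩ : ϖ ^ (M + (i + d) + r * d) ∣ b := by
    rw [dvd_iff_norm_le, norm_pow]
    refine le_of_mul_le_mul_right (hb.trans_eq ?_) (pow_pos (pow_pos hpos r) i)
    ring
  refine ⟨c, ?_⟩
  set P := pointHom p g (ofInteger p _ π)
  set Q := pointTeichmuller p g ϖ
  have h1 : P ^ i * P' ^ i = 1 := by rw [← mul_pow, hP, one_pow]
  have h2 : Q ^ (i + d) * Q' ^ (i + d) = 1 := by rw [← mul_pow, hQ, one_pow]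
  rw [map_mul, map_pow, mul_pow, ← pow_mul, pow_add Q (M + (i + d)), pow_add Q M, pow_add P']
  calc Q ^ M * Q ^ (i + d) * Q ^ (r * d) * pointTeichmuller p g c * P ^ i *
        (P' ^ i * P' ^ d * Q' ^ (i + d)) = (P ^ i * P' ^ i) * (Q ^ (i + d) * Q' ^ (i + d)) *
        (pointTeichmuller p g c * Q ^ M * (Q ^ (r * d) * P' ^ d)) := by ring
    _ = _ := by rw [h1, h2, one_mul, one_mul]

/-- Terms of positive degree: if `|b| ρ^i ≤ |ϖ|^{M + 1 + N} ρ^N` for `ρ = |ϖ|^{1/k}`, then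
`[b] π^i / (π [ϖ])^N` is a multiple of `[ϖ]^M (π^k / [ϖ])^q`, where `q = ⌊(i - N) / k⌋`. -/
theorem exists_term_eq_of_nonneg (hP : pointHom p g (ofInteger p _ π) * P' = 1)
    (hQ : pointTeichmuller p g ϖ * Q' = 1) (hϖ0 : ϖ ≠ 0) {b : 𝒪[F]} {N e M k : ℕ} {ρ : ℝ}
    (hρ0 : 0 < ρ) (hρ1 : ρ ≤ 1) (hk : 0 < k) (hρ : ρ ^ k = ‖ϖ‖)
    (hb : ‖b‖ * ρ ^ (N + e) ≤ ‖ϖ‖ ^ (M + 1) * ‖ϖ‖ ^ N * ρ ^ N) : ∃ (c : 𝒪[F]) (q s : ℕ),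
    pointTeichmuller p g b * pointHom p g (ofInteger p _ π) ^ (N + e) * (P' ^ N * Q' ^ N) =
      pointTeichmuller p g c * pointTeichmuller p g ϖ ^ M *
        pointHom p g (ofInteger p _ π) ^ s * (pointHom p g (ofInteger p _ π) ^ k * Q') ^ q := by
  have hpos : 0 < ‖ϖ‖ := norm_pos_iff.2 hϖ0
  obtain ⟨q, s, hs, rfl⟩ : ∃ q s, s < k ∧ e = k * q + s :=
    ⟨e / k, e % k, Nat.mod_lt _ hk, (Nat.div_add_mod e k).symm⟩
  have hb' : ‖b‖ * ρ ^ (k * q + s) ≤ ‖ϖ‖ ^ (M + 1) * ‖ϖ‖ ^ N := by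
    rw [pow_add, mul_comm (ρ ^ N), ← mul_assoc] at hb
    exact le_of_mul_le_mul_right hb (pow_pos hρ0 N)
  have hs' : ‖ϖ‖ ^ (q + 1) ≤ ρ ^ (k * q + s) := by
    rw [← hρ, ← pow_mul]
    refine pow_le_pow_of_le_one hρ0.le hρ1 ?_
    rw [mul_add, mul_one]
    omega
  obtain ⟨c, hc⟩ : ϖ ^ (M + 1 + N) ∣ b * ϖ ^ (q + 1) := by
    rw [dvd_iff_norm_le, norm_pow, norm_mul, norm_pow]
    exact (mul_le_mul_of_nonneg_left hs' (norm_nonneg _)).trans (hb'.trans_eq (pow_add _ _ _).symm)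
  refine ⟨c, q, s, ?_⟩
  have hc' := congr_arg (pointTeichmuller p g) hc
  rw [map_mul, map_mul, map_pow, map_pow] at hc'
  set P := pointHom p g (ofInteger p _ π)
  set Q := pointTeichmuller p g ϖ
  have h1 : P ^ N * P' ^ N = 1 := by rw [← mul_pow, hP, one_pow]
  have h2 : ∀ n : ℕ, Q ^ n * Q' ^ n = 1 := fun n => by rw [← mul_pow, hQ, one_pow]
  rw [mul_pow, ← pow_mul]
  calc pointTeichmuller p g b * P ^ (N + (k * q + s)) * (P' ^ N * Q' ^ N)
      = (pointTeichmuller p g b * Q ^ (q + 1)) * Q' ^ (q + 1) * (P ^ N * P' ^ N) *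
          (P ^ (k * q) * P ^ s * Q' ^ N) := by
        rw [mul_assoc _ (Q ^ (q + 1)), h2, mul_one]
        ring
    _ = (Q ^ N * Q' ^ N) * (Q ^ 1 * Q' ^ 1) * (pointTeichmuller p g c * Q ^ M * P ^ s *
          (P ^ (k * q) * Q' ^ q)) := by
        rw [hc', h1]
        ring
    _ = _ := by rw [h2, h2, one_mul, one_mul]

/-- Terms of positive degree: if `|b| ρ^i ≤ |ϖ|^N ρ^N` for `ρ = |ϖ|^{1/k}`, then the `k`-th power
of `[b] π^i / (π [ϖ])^N` is a multiple of a power of `π^k / [ϖ]`. -/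
theorem exists_term_pow_eq (hP : pointHom p g (ofInteger p _ π) * P' = 1)
    (hQ : pointTeichmuller p g ϖ * Q' = 1) (hϖ0 : ϖ ≠ 0) {b : 𝒪[F]} {N e k : ℕ} {ρ : ℝ}
    (hρ0 : 0 < ρ) (hρ : ρ ^ k = ‖ϖ‖) (hb : ‖b‖ * ρ ^ (N + e) ≤ ‖ϖ‖ ^ N * ρ ^ N) : ∃ c : 𝒪[F],
    (pointTeichmuller p g b * pointHom p g (ofInteger p _ π) ^ (N + e) * (P' ^ N * Q' ^ N)) ^ k =
      pointTeichmuller p g c * (pointHom p g (ofInteger p _ π) ^ k * Q') ^ e := by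
  have hpos : 0 < ‖ϖ‖ := norm_pos_iff.2 hϖ0
  have hb' : ‖b‖ * ρ ^ e ≤ ‖ϖ‖ ^ N := by
    rw [pow_add, mul_comm (ρ ^ N), ← mul_assoc] at hb
    exact le_of_mul_le_mul_right hb (pow_pos hρ0 N)
  obtain ⟨c, hc⟩ : ϖ ^ (N * k) ∣ b ^ k * ϖ ^ e := by
    rw [dvd_iff_norm_le, norm_pow, norm_mul, norm_pow, norm_pow, ← hρ, ← pow_mul, ← pow_mul,
      mul_comm k e, pow_mul ρ e k, ← mul_pow]
    refine (pow_le_pow_left₀ (mul_nonneg (norm_nonneg _) (pow_nonneg hρ0.le _)) hb' k).trans_eq ?_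
    rw [← hρ, ← pow_mul, ← pow_mul]
  refine ⟨c, ?_⟩
  have hc' := congr_arg (pointTeichmuller p g) hc
  rw [map_mul, map_mul, map_pow, map_pow, map_pow] at hc'
  set P := pointHom p g (ofInteger p _ π)
  set Q := pointTeichmuller p g ϖ
  have h1 : P ^ (N * k) * P' ^ (N * k) = 1 := by rw [← mul_pow, hP, one_pow]
  have h2 : ∀ n : ℕ, Q ^ n * Q' ^ n = 1 := fun n => by rw [← mul_pow, hQ, one_pow]
  calc (pointTeichmuller p g b * P ^ (N + e) * (P' ^ N * Q' ^ N)) ^ k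
      = (pointTeichmuller p g b ^ k * Q ^ e) * Q' ^ e * (P ^ (N * k) * P' ^ (N * k)) *
          (P ^ (e * k) * Q' ^ (N * k)) := by
        rw [mul_assoc _ (Q ^ e), h2, mul_one]
        ring
    _ = (Q ^ (N * k) * Q' ^ (N * k)) * (pointTeichmuller p g c * (P ^ k * Q') ^ e) := by
        rw [hc', h1]
        ring
    _ = _ := by rw [h2, one_mul]

end Terms

/-! ### Density of `B^{b,+}[1 / π [ϖ]]` in `B_I` -/

section Density

variable (p : ℕ) [Fact p.Prime] {E : Type u} [NontriviallyNormedField E] [IsUltrametricDist E]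
  [NormedAlgebra ℚ_[p] E] [FiniteDimensional ℚ_[p] E]
  {F : Type u} [NontriviallyNormedField F] [IsUltrametricDist F] [Algebra 𝓀[E] F]
  {π : 𝒪[E]} {ϖ : 𝒪[F]}

variable (π ϖ) in
/-- The element `π [ϖ]` of `B^{b,+}`, which becomes invertible in all the rings `B_I`. -/
noncomputable abbrev annulusElement : BbPlus p E F :=
  ofInteger p _ π * teichmuller p _ ϖ

variable [CharP F p] [PerfectRing F p] (hπ : Irreducible π)

/-- If `x = z / (π [ϖ])^N`, then `π^N x = [ϖ^{-N}] z`. -/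
theorem algebraMap_teichmuller_mul (hϖ0 : ϖ ≠ 0) {x : WittFInv p E F π} {z : BbPlus p E F} {N : ℕ}
    (hx : x * toWittFInv p π (annulusElement p π ϖ) ^ N = toWittFInv p π z) :
    algebraMap (WittF p E F) (WittFInv p E F π)
        (teichmuller p _ ((ϖ : F)⁻¹ ^ N) * toWittF p E F z) =
      algebraMap (WittF p E F) (WittFInv p E F π) (ofInteger p _ π) ^ N * x := by
  have hϖ0' : (ϖ : F) ≠ 0 := fun h => hϖ0 (Subtype.ext h)
  have h1 : algebraMap (WittF p E F) (WittFInv p E F π) (teichmuller p _ ((ϖ : F)⁻¹ ^ N)) *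
      algebraMap (WittF p E F) (WittFInv p E F π) (teichmuller p _ (ϖ : F)) ^ N = 1 := by
    rw [← map_pow, ← map_pow, ← map_mul, ← map_mul, ← mul_pow, inv_mul_cancel₀ hϖ0', one_pow,
      map_one, map_one]
  have h2 : toWittFInv p π (annulusElement p π ϖ) =
      algebraMap (WittF p E F) (WittFInv p E F π) (ofInteger p _ π) *
        algebraMap (WittF p E F) (WittFInv p E F π) (teichmuller p _ (ϖ : F)) := by
    rw [← map_mul]
    exact congr_arg (algebraMap (WittF p E F) (WittFInv p E F π))
      ((map_mul (toWittF p E F) _ _).trans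
        (congr_arg₂ (· * ·) (toWittF_ofInteger p π) (toWittF_teichmuller p ϖ)))
  rw [map_mul]
  refine (congr_arg (_ * ·) hx.symm).trans ?_
  rw [h2, mul_pow]
  linear_combination (algebraMap (WittF p E F) (WittFInv p E F π) (ofInteger p _ π) ^ N * x) * h1

/-- For `x = z / (π [ϖ])^N` and `z = ∑ [b_i] π^i`, the bound `|x|_I ≤ C` in terms of the `b_i`. -/
theorem norm_le_of_intervalNorm_le (hϖ0 : ϖ ≠ 0) {I : ClosedInterval} {x : WittFInv p E F π}
    (hxb : x ∈ Bb p hπ) {z : BbPlus p E F} {N : ℕ}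
    (hx : x * toWittFInv p π (annulusElement p π ϖ) ^ N = toWittFInv p π z) {b : ℕ → 𝒪[F]}
    (hb : IsExpansion p _ π z b) {C : ℝ} (hC : intervalNorm p hπ I x ≤ C) {ρ : ℝ}
    (hρ : ρ ∈ Set.Icc (I.fst : ℝ) (I.snd : ℝ)) (i : ℕ) :
    ‖b i‖ * ρ ^ i ≤ C * ‖ϖ‖ ^ N * ρ ^ N := by
  obtain ⟨h0, h1⟩ := mem_interval_bounds hρ
  have hpos : 0 < ‖ϖ‖ := norm_pos_iff.2 hϖ0
  have h2 := (bound_iff p hπ (algebraMap_teichmuller_mul p hϖ0 hx) h0).1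
    ((intervalNorm_le_iff p hπ hxb I).1 hC ρ hρ) i
  have h3 : coeff p _ hπ (toWittF p E F z) i = b i :=
    congr_fun (coeff_eq p _ hπ (isExpansion_map p (Subring.subtype 𝒪[F]) rfl hb)) i
  rw [coeff_teichmuller_mul, h3, norm_mul, norm_pow, norm_inv, inv_pow, mul_assoc,
    inv_mul_le_iff₀ (pow_pos (show (0 : ℝ) < ‖(ϖ : F)‖ from hpos) N)] at h2
  refine h2.trans_eq ?_
  rw [mul_left_comm, ← mul_assoc]
  exact rfl

/-- `B^{b,+}[1 / π [ϖ]]` is dense in `B^b` for `|·|_I`. -/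
theorem exists_intervalNorm_sub_lt (hϖ0 : ϖ ≠ 0) (hϖ1 : ‖ϖ‖ < 1) (I : ClosedInterval)
    {x : WittFInv p E F π} (hxb : x ∈ Bb p hπ) {ε : ℝ} (hε : 0 < ε) :
    ∃ (N : ℕ) (z : BbPlus p E F), ∀ x' ∈ Bb p hπ,
      x' * toWittFInv p π (annulusElement p π ϖ) ^ N = toWittFInv p π z →
      intervalNorm p hπ I (x - x') < ε := by
  have hpos : 0 < ‖(ϖ : F)‖ := norm_pos_iff.2 fun h => hϖ0 (Subtype.ext h)
  have hϖ0' : (ϖ : F) ≠ 0 := norm_pos_iff.1 hpos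
  obtain ⟨C, hC⟩ := hxb
  obtain ⟨M, hM⟩ := exists_pow_lt_of_lt_one
    (inv_pos.2 (lt_max_of_lt_right one_pos : 0 < max C 1)) hϖ1
  obtain ⟨N₀, y₀, hy₀⟩ := exists_pow_mul p x
  have hy := pow_mul_of_le p hy₀ M
  set N := M + N₀
  set y := ofInteger p (algebraMap 𝓀[E] F) π ^ M * y₀
  have hyC : ∀ i, ‖coeff p _ hπ y i‖ ≤ C := fun i => by
    have := (bound_iff p hπ hy (C := C) one_pos).1 (by simpa using hC) i
    simpa using this
  -- `N` is so large that `[ϖ]^N π^N x` has integral coefficients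
  set v : WittF p E F := teichmuller p _ ((ϖ : F) ^ N) * y
  have hv : ∀ i, ‖coeff p _ hπ v i‖ ≤ 1 := fun i => by
    rw [coeff_teichmuller_mul, norm_mul, norm_pow]
    calc ‖(ϖ : F)‖ ^ N * ‖coeff p _ hπ y i‖ ≤ ‖(ϖ : F)‖ ^ M * max C 1 :=
          mul_le_mul (pow_le_pow_of_le_one hpos.le hϖ1.le (Nat.le_add_right _ _))
            ((hyC i).trans (le_max_left _ _)) (norm_nonneg _) (pow_nonneg hpos.le _)
      _ ≤ (max C 1)⁻¹ * max C 1 :=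
          mul_le_mul_of_nonneg_right hM.le (le_max_of_le_right zero_le_one)
      _ = 1 := inv_mul_cancel₀ (lt_max_of_lt_right one_pos).ne'
  have ha := I.fst.2.1
  have hb0 : (0 : ℝ) < I.snd := I.snd.2.1
  set K : ℝ := (‖(ϖ : F)‖ ^ N * (I.fst : ℝ) ^ N)⁻¹ with hK
  have hK0 : 0 < K := inv_pos.2 (mul_pos (pow_pos hpos N) (pow_pos ha N))
  obtain ⟨m, hm⟩ := exists_pow_lt_of_lt_one (mul_pos hε (inv_pos.2 hK0)) I.snd.2.2
  obtain ⟨z, w, hw⟩ := exists_toWittF p hπ (z := v) (m := m) fun i _ => hv i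
  refine ⟨N, z, fun x' hx'b hx' => ?_⟩
  have h1 := algebraMap_teichmuller_mul p hϖ0 hx'
  have h2 : algebraMap (WittF p E F) (WittFInv p E F π)
      (teichmuller p _ ((ϖ : F)⁻¹ ^ N) * (v - toWittF p E F z)) =
      algebraMap (WittF p E F) (WittFInv p E F π) (ofInteger p _ π) ^ N * (x - x') := by
    have h3 : teichmuller p (algebraMap 𝓀[E] F) ((ϖ : F)⁻¹ ^ N) * v = y := by
      rw [← mul_assoc, ← map_mul, ← mul_pow, inv_mul_cancel₀ hϖ0', one_pow, map_one, one_mul]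
    rw [mul_sub, h3, map_sub, h1, hy, mul_sub]
  have h4 : ∀ i, ‖coeff p _ hπ (v - toWittF p E F z) i‖ ≤ 1 := by
    have h5 := weighted_add p hπ one_pos le_rfl (x := v) (y := -toWittF p E F z) (C := 1)
      (by simpa using hv) (by
        rw [← map_neg]
        simpa using norm_coeff_toWittF p hπ (-z))
    rw [← sub_eq_add_neg] at h5
    simpa using h5
  refine lt_of_le_of_lt (b := K * (I.snd : ℝ) ^ m) ?_ ?_
  · rw [intervalNorm_le_iff p hπ ((Bb p hπ).sub_mem ⟨C, hC⟩ hx'b)]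
    intro ρ hρ
    obtain ⟨h0, hρ1⟩ := mem_interval_bounds hρ
    rw [bound_iff p hπ h2 h0]
    intro i
    have hR : 0 ≤ K * (I.snd : ℝ) ^ m * ρ ^ N := by positivity
    rw [coeff_teichmuller_mul]
    by_cases hi : i < m
    · rw [hw, coeff_pow_mul_of_lt p _ hπ _ _ _ hi, mul_zero, norm_zero, zero_mul]
      exact hR
    · rw [norm_mul, norm_pow, norm_inv]
      have h6 : ρ ^ i ≤ (I.snd : ℝ) ^ m :=
        (pow_le_pow_of_le_one h0.le hρ1 (not_lt.1 hi)).trans (pow_le_pow_left₀ h0.le hρ.2 m)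
      have h7 : 1 ≤ ((I.fst : ℝ) ^ N)⁻¹ * ρ ^ N := by
        rw [inv_mul_eq_div, one_le_div (pow_pos ha N)]
        exact pow_le_pow_left₀ ha.le hρ.1 N
      calc ‖(ϖ : F)‖⁻¹ ^ N * ‖coeff p _ hπ (v - toWittF p E F z) i‖ * ρ ^ i
          ≤ ‖(ϖ : F)‖⁻¹ ^ N * 1 * (I.snd : ℝ) ^ m := by gcongr; exact h4 i
        _ ≤ ‖(ϖ : F)‖⁻¹ ^ N * 1 * (I.snd : ℝ) ^ m * (((I.fst : ℝ) ^ N)⁻¹ * ρ ^ N) :=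
          le_mul_of_one_le_right (by positivity) h7
        _ = K * (I.snd : ℝ) ^ m * ρ ^ N := by
          rw [hK, mul_inv, inv_pow]
          ring
  · calc K * (I.snd : ℝ) ^ m < K * (ε * K⁻¹) := mul_lt_mul_of_pos_left hm hK0
      _ = ε := by field_simp

end Density

section Localization

variable (p : ℕ) [Fact p.Prime] {E : Type u} [NontriviallyNormedField E] [IsUltrametricDist E]
  [NormedAlgebra ℚ_[p] E] [FiniteDimensional ℚ_[p] E]
  {F : Type u} [NontriviallyNormedField F] [IsUltrametricDist F] [Algebra 𝓀[E] F]
  {π : 𝒪[E]} {ϖ : 𝒪[F]} [CharP F p] [PerfectRing F p] (hπ : Irreducible π)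

variable (π ϖ) in
/-- The ring `B^{b,+}[1 / π [ϖ]]`. -/
abbrev BbPlusInv : Type u := Localization.Away (annulusElement p (E := E) (F := F) π ϖ)

theorem isUnit_toBb_annulusElement (hϖ0 : ϖ ≠ 0) : IsUnit (toBb p hπ (annulusElement p π ϖ)) := by
  obtain ⟨b, hb, -⟩ := exists_uniformizer_inv p (F := F) hπ
  rw [map_mul]
  exact (IsUnit.of_mul_eq_one b hb).mul (isUnit_toBb_teichmuller p hπ hϖ0)

/-- The inclusion `B^{b,+}[1 / π [ϖ]] → B^b`. -/
noncomputable def invToBb (hϖ0 : ϖ ≠ 0) : BbPlusInv p (F := F) π ϖ →+* Bb p (F := F) hπ :=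
  IsLocalization.Away.lift _ (isUnit_toBb_annulusElement p hπ hϖ0)

/-- The homomorphism `B^{b,+}[1 / π [ϖ]] → B_I`. -/
noncomputable def invToBI (hϖ0 : ϖ ≠ 0) (I : ClosedInterval) :
    BbPlusInv p (F := F) π ϖ →+* BI p F hπ I :=
  (UniformSpace.Completion.coeRingHom : BbNormed p F hπ I →+* BI p F hπ I).comp
    (invToBb p hπ hϖ0)

theorem invToBI_algebraMap (hϖ0 : ϖ ≠ 0) (I : ClosedInterval) (z : BbPlus p E F) :
    invToBI p hπ hϖ0 I (algebraMap _ _ z) = toBI p F hπ I z :=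
  congr_arg (UniformSpace.Completion.coeRingHom : BbNormed p F hπ I →+* BI p F hπ I)
    (IsLocalization.Away.lift_eq _ (isUnit_toBb_annulusElement p hπ hϖ0) z)

theorem norm_invToBI (hϖ0 : ϖ ≠ 0) (I : ClosedInterval) (l : BbPlusInv p (F := F) π ϖ) :
    ‖invToBI p hπ hϖ0 I l‖ = intervalNorm p hπ I (invToBb p hπ hϖ0 l : WittFInv p E F π) :=
  UniformSpace.Completion.norm_coe (E := BbNormed p F hπ I) (invToBb p hπ hϖ0 l)

theorem invToBb_mul_pow (hϖ0 : ϖ ≠ 0) {l : BbPlusInv p (F := F) π ϖ} {N : ℕ} {z : BbPlus p E F}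
    (h : l * algebraMap _ _ (annulusElement p π ϖ) ^ N = algebraMap _ _ z) :
    (invToBb p hπ hϖ0 l : WittFInv p E F π) * toWittFInv p π (annulusElement p π ϖ) ^ N =
      toWittFInv p π z := by
  have h1 := congr_arg (invToBb p hπ hϖ0) h
  have h2 : ∀ z, invToBb p hπ hϖ0 (algebraMap _ _ z) = toBb p hπ z :=
    IsLocalization.Away.lift_eq _ (isUnit_toBb_annulusElement p hπ hϖ0)
  rw [map_mul, map_pow, h2, h2] at h1
  exact congr_arg Subtype.val h1

theorem denseRange_invToBI (hϖ0 : ϖ ≠ 0) (hϖ1 : ‖ϖ‖ < 1) (I : ClosedInterval) :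
    DenseRange (invToBI p hπ hϖ0 I) := by
  let i : BbPlusInv p (F := F) π ϖ → BbNormed p F hπ I := invToBb p hπ hϖ0
  have hi : DenseRange i := Metric.denseRange_iff.2 fun x ε hε => by
    obtain ⟨N, z, h⟩ := exists_intervalNorm_sub_lt p hπ hϖ0 hϖ1 I
      (Subtype.prop (p := fun x => x ∈ Bb p hπ) x) hε
    refine ⟨IsLocalization.mk' _ z
      (⟨annulusElement p π ϖ ^ N, N, rfl⟩ : Submonoid.powers (annulusElement p π ϖ)), ?_⟩
    rw [dist_eq_norm]
    refine h _ (Subtype.prop _) (invToBb_mul_pow p hπ hϖ0 ?_)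
    rw [← map_pow]
    exact IsLocalization.mk'_spec _ z
      (⟨annulusElement p π ϖ ^ N, N, rfl⟩ : Submonoid.powers (annulusElement p π ϖ))
  exact (UniformSpace.Completion.denseRange_coe (α := BbNormed p F hπ I)).comp hi
    (UniformSpace.Completion.continuous_coe _)

/-- A morphism out of `(B_I, B_I°)` is determined by its restriction to `B^{b,+}`. -/
theorem bbPlusToInterval_cancel (hϖ0 : ϖ ≠ 0) (hϖ1 : ‖ϖ‖ < 1) (I : ClosedInterval) {T : Pair.{u}}
    (hT : T2Space T.carrier) (h h' : intervalPair p F hπ I ⟶ T)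
    (hh : bbPlusToInterval p F hπ I hϖ1 ≫ h = bbPlusToInterval p F hπ I hϖ1 ≫ h') : h = h' := by
  let f : BI p F hπ I →+* T.carrier := Pair.Hom.toRingHom h
  let f' : BI p F hπ I →+* T.carrier := Pair.Hom.toRingHom h'
  have h1 : f.comp (invToBI p hπ hϖ0 I) = f'.comp (invToBI p hπ hϖ0 I) := by
    refine IsLocalization.ringHom_ext (Submonoid.powers (annulusElement p π ϖ))
      (RingHom.ext fun z => ?_)
    change f (invToBI p hπ hϖ0 I _) = f' (invToBI p hπ hϖ0 I _)
    rw [invToBI_algebraMap]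
    exact congr_arg (fun m : bbPlusPair p π ϖ ⟶ T => pointHom p m z) hh
  refine Pair.Hom.ext (RingHom.ext fun x => congr_fun ?_ x)
  exact (denseRange_invToBI p hπ hϖ0 hϖ1 I).equalizer h.continuous' h'.continuous'
    (funext fun l => RingHom.congr_fun h1 l)

theorem bbPlusToInterval_restrictPair (hϖ1 : ‖ϖ‖ < 1) {I J : ClosedInterval} (h : I ≤ J) :
    bbPlusToInterval p F hπ J hϖ1 ≫ restrictPair p F hπ h = bbPlusToInterval p F hπ I hϖ1 := by
  refine Pair.Hom.ext (RingHom.ext fun z => ?_)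
  exact UniformSpace.Completion.mapRingHom_coe (continuous_changeNorm p hπ h) _

end Localization

section Extension

/-- A ring homomorphism on a dense subring extends to the ring if it is continuous for the induced
topology and the target is complete. -/
theorem exists_continuous_extension {L B T : Type u} [CommRing L] [CommRing B] [UniformSpace B]
    [IsUniformAddGroup B] [IsTopologicalRing B] [CommRing T] [TopologicalSpace T]
    [IsTopologicalRing T] (hT : T2Space T)
    (hc : @CompleteSpace T (IsTopologicalAddGroup.rightUniformSpace T)) (i : L →+* B)
    (hi : DenseRange i) (f : L →+* T)
    (hf : ∀ U ∈ 𝓝 (0 : T), ∃ V ∈ 𝓝 (0 : B), ∀ l, i l ∈ V → f l ∈ U) :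
    ∃ h : B →+* T, Continuous h ∧ ∀ l, h (i l) = f l := by
  let : UniformSpace T := IsTopologicalAddGroup.rightUniformSpace T
  have : IsUniformAddGroup T := isUniformAddGroup_of_addCommGroup
  let : UniformSpace L := UniformSpace.comap i inferInstance
  have hui : IsUniformInducing i := ⟨rfl⟩
  have : IsUniformAddGroup L := IsUniformAddGroup.comap i
  have hfc : UniformContinuous f := by
    refine uniformContinuous_of_continuousAt_zero f ?_
    rw [ContinuousAt, map_zero]
    intro U hU
    obtain ⟨V, hV, h⟩ := hf U hU
    have h0 : i ⁻¹' V ∈ 𝓝 (0 : L) :=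
      hui.uniformContinuous.continuous.continuousAt.preimage_mem_nhds (by rwa [map_zero])
    exact Filter.mem_map.2 (Filter.mem_of_superset h0 fun l hl => h l hl)
  refine ⟨IsDenseInducing.extendRingHom hui hi hfc, ?_, ?_⟩
  · exact (uniformContinuous_uniformly_extend hui hi hfc).continuous
  · exact fun l => uniformly_extend_of_ind hui hi hfc l

end Extension

/-! ### Factorization of points through the rings `B_I` -/

section Factorization

variable (p : ℕ) [Fact p.Prime] {E : Type u} [NontriviallyNormedField E] [IsUltrametricDist E]
  [NormedAlgebra ℚ_[p] E] [FiniteDimensional ℚ_[p] E]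
  {F : Type u} [NontriviallyNormedField F] [IsUltrametricDist F] [Algebra 𝓀[E] F]
  {π : 𝒪[E]} {ϖ : 𝒪[F]} {T : Pair.{u}} (g : bbPlusPair p π ϖ ⟶ T) {P' Q' : T.carrier}

/-- The interval `[|ϖ|^r, |ϖ|^{1/k}]`. -/
theorem exists_closedInterval (hϖ0 : ϖ ≠ 0) (hϖ1 : ‖ϖ‖ < 1) {k r : ℕ} (hk : 0 < k) (hr : 0 < r) :
    ∃ I : ClosedInterval, (I.fst : ℝ) = ‖ϖ‖ ^ r ∧ (I.snd : ℝ) ^ k = ‖ϖ‖ := by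
  have hpos : 0 < ‖ϖ‖ := norm_pos_iff.2 hϖ0
  set b : ℝ := ‖ϖ‖ ^ ((k : ℝ)⁻¹)
  have hb0 : 0 < b := Real.rpow_pos_of_pos hpos _
  have hbk : b ^ k = ‖ϖ‖ := Real.rpow_inv_natCast_pow hpos.le hk.ne'
  have hb1 : b < 1 := by
    refine (pow_lt_one_iff_of_nonneg hb0.le hk.ne').1 ?_
    rwa [hbk]
  have hab : ‖ϖ‖ ^ r ≤ b := by
    rw [← hbk, ← pow_mul]
    exact pow_le_of_le_one hb0.le hb1.le (Nat.mul_pos hk hr).ne'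
  exact ⟨⟨(⟨‖ϖ‖ ^ r, pow_pos hpos r, pow_lt_one₀ hpos.le hϖ1 hr.ne'⟩, ⟨b, hb0, hb1⟩), hab⟩,
    rfl, hbk⟩

section Estimates

variable {I : ClosedInterval} {k r : ℕ} {z : BbPlus p E F} {b : ℕ → 𝒪[F]} {N : ℕ}

/-- On an interval where `|π^k| ≤ |[ϖ]|` and `|[ϖ]^r| ≤ |π|`, the bound `|z / (π [ϖ])^N|_I ≤ 1`
implies that the image of `z / (π [ϖ])^N` lies in `T⁺`, provided that the images of `π^k / [ϖ]`
and `[ϖ]^r / π` do. -/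
theorem pointHom_mul_mem_plus (hT : T.IsAffinoid) (hϖ0 : ϖ ≠ 0)
    (hP : pointHom p g (ofInteger p _ π) * P' = 1) (hQ : pointTeichmuller p g ϖ * Q' = 1)
    (hk : 0 < k) (hI1 : (I.fst : ℝ) = ‖ϖ‖ ^ r) (hI2 : (I.snd : ℝ) ^ k = ‖ϖ‖)
    (hkT : pointHom p g (ofInteger p _ π) ^ k * Q' ∈ T.plus)
    (hrT : pointTeichmuller p g ϖ ^ r * P' ∈ T.plus) (hz : IsExpansion p _ π z b)
    (hb : ∀ ρ ∈ Set.Icc (I.fst : ℝ) (I.snd : ℝ), ∀ i, ‖b i‖ * ρ ^ i ≤ 1 * ‖ϖ‖ ^ N * ρ ^ N) :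
    pointHom p g z * (P' ^ N * Q' ^ N) ∈ T.plus := by
  have hg : ∀ a, pointHom p g a ∈ T.plus := fun a => g.map_plus' a (Subring.mem_top _)
  refine pointHom_mul_mem p g (W := T.plus.toAddSubgroup) hT.isOpen hz _ fun i => ?_
  by_cases hi : i < N
  · obtain ⟨d, rfl⟩ := Nat.exists_eq_add_of_lt hi
    have h1 := hb _ ⟨le_rfl, I.fst_le_snd⟩ i
    rw [hI1, add_assoc] at h1
    rw [← pow_zero ‖ϖ‖] at h1
    obtain ⟨c, hc⟩ := exists_term_eq_of_neg p g hP hQ hϖ0 h1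
    rw [add_assoc, hc, pow_zero, mul_one]
    exact T.plus.mul_mem (hg _) (T.plus.pow_mem hrT _)
  · obtain ⟨e, rfl⟩ := Nat.exists_eq_add_of_le (not_lt.1 hi)
    have h1 := hb _ ⟨I.fst_le_snd, le_rfl⟩ (N + e)
    rw [one_mul] at h1
    obtain ⟨c, hc⟩ := exists_term_pow_eq p g hP hQ hϖ0 I.snd.2.1 hI2 h1
    refine hT.integrallyClosed _ (IsIntegral.of_pow hk ?_)
    rw [hc]
    exact isIntegral_algebraMap
      (x := (⟨_, T.plus.mul_mem (hg _) (T.plus.pow_mem hkT e)⟩ : T.plus))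

/-- The continuity estimate: on the same interval, `z / (π [ϖ])^N` is sent to a small element if
`|z / (π [ϖ])^N|_I` is small. -/
theorem pointHom_mul_mem_submodule {W : AddSubgroup T.carrier} (hW : IsOpen (W : Set T.carrier))
    {A₀ : Subring T.carrier} (hA : ∀ a ∈ A₀, ∀ w ∈ W, a * w ∈ W) {n : ℕ}
    (hn : ∀ a ∈ idealOfDefinition p π ϖ ^ n, pointHom p g a ∈ W) (hϖ0 : ϖ ≠ 0)
    (hP : pointHom p g (ofInteger p _ π) * P' = 1) (hQ : pointTeichmuller p g ϖ * Q' = 1)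
    (hk : 0 < k) (hI1 : (I.fst : ℝ) = ‖ϖ‖ ^ r) (hI2 : (I.snd : ℝ) ^ k = ‖ϖ‖)
    (hkA : pointHom p g (ofInteger p _ π) ^ k * Q' ∈ A₀)
    (hrA : pointTeichmuller p g ϖ ^ r * P' ∈ A₀) (hz : IsExpansion p _ π z b)
    (hb : ∀ ρ ∈ Set.Icc (I.fst : ℝ) (I.snd : ℝ), ∀ i,
      ‖b i‖ * ρ ^ i ≤ ‖ϖ‖ ^ (n + 1) * ‖ϖ‖ ^ N * ρ ^ N) :
    pointHom p g z * (P' ^ N * Q' ^ N) ∈ W := by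
  have hn' : ∀ (c : 𝒪[F]) (s : ℕ), pointTeichmuller p g c * pointTeichmuller p g ϖ ^ n *
      pointHom p g (ofInteger p _ π) ^ s ∈ W := fun c s => by
    have h := hn (teichmuller p _ c * teichmuller p _ ϖ ^ n * ofInteger p _ π ^ s)
      (Ideal.mul_mem_right _ _ (Ideal.mul_mem_left _ _
        (Ideal.pow_mem_pow (teichmuller_mem p π ϖ) n)))
    rwa [map_mul, map_mul, map_pow, map_pow] at h
  refine pointHom_mul_mem p g hW hz _ fun i => ?_
  by_cases hi : i < N
  · obtain ⟨d, rfl⟩ := Nat.exists_eq_add_of_lt hi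
    have h1 := hb _ ⟨le_rfl, I.fst_le_snd⟩ i
    rw [hI1, add_assoc] at h1
    obtain ⟨c, hc⟩ := exists_term_eq_of_neg p g hP hQ hϖ0 h1
    have h2 := hn' (c * ϖ) 0
    rw [pow_zero, mul_one, map_mul, mul_assoc, ← pow_succ'] at h2
    rw [add_assoc, hc, mul_comm]
    exact hA _ (A₀.pow_mem hrA _) _ h2
  · obtain ⟨e, rfl⟩ := Nat.exists_eq_add_of_le (not_lt.1 hi)
    have h1 := hb _ ⟨I.fst_le_snd, le_rfl⟩ (N + e)
    obtain ⟨c, q, s, hc⟩ :=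
      exists_term_eq_of_nonneg p g hP hQ hϖ0 I.snd.2.1 I.snd.2.2.le hk hI2 h1
    rw [hc, mul_comm]
    exact hA _ (A₀.pow_mem hkA _) _ (hn' c s)

end Estimates

theorem exists_pos_pow_mul_mem {t : T.carrier}
    (ht : Filter.Tendsto (fun n : ℕ => t ^ n) Filter.atTop (𝓝 0)) (a : T.carrier)
    {U : Set T.carrier} (hU : U ∈ 𝓝 0) : ∃ n : ℕ, 0 < n ∧ t ^ n * a ∈ U := by
  have h1 : Filter.Tendsto (fun n : ℕ => t ^ n * a) Filter.atTop (𝓝 (0 * a)) := ht.mul_const a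
  rw [zero_mul] at h1
  exact ((Filter.eventually_gt_atTop 0).and (h1.eventually_mem hU)).exists

variable [CharP F p] [PerfectRing F p] (hπ : Irreducible π)

/-- A point of `B^{b,+}` in a complete affinoid ring for which `π` and `[ϖ]` are invertible factors
through some `B_I`. -/
theorem exists_bbPlusToInterval_comp (hT : T.IsAffinoid) (hc : T.IsComplete) (hϖ0 : ϖ ≠ 0)
    (hϖ1 : ‖ϖ‖ < 1)
    (hgπ : IsUnit (Pair.Hom.toRingHom g (ofInteger p (residueFieldToInteger p E F) π)))
    (hgϖ : IsUnit (Pair.Hom.toRingHom g (teichmuller p (residueFieldToInteger p E F) ϖ))) :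
    ∃ (I : ClosedInterval) (h : intervalPair p F hπ I ⟶ T),
      bbPlusToInterval p F hπ I hϖ1 ≫ h = g := by
  obtain ⟨P', hP⟩ := hgπ.exists_right_inv
  obtain ⟨Q', hQ⟩ := hgϖ.exists_right_inv
  replace hP : pointHom p g (ofInteger p _ π) * P' = 1 := hP
  replace hQ : pointTeichmuller p g ϖ * Q' = 1 := hQ
  obtain ⟨A₀, hA₀, hbasis⟩ := hT.isFAdic.exists_subring
  have hU : (A₀ : Set T.carrier) ∩ T.plus ∈ 𝓝 (0 : T.carrier) :=
    Filter.inter_mem (hA₀.mem_nhds A₀.zero_mem) (hT.isOpen.mem_nhds T.plus.zero_mem)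
  -- `π^k / [ϖ]` and `[ϖ]^r / π` are to lie in `T⁺` (for `|·| ≤ 1`) and in `A₀` (for continuity)
  obtain ⟨k, hk, hkA, hkT⟩ :=
    exists_pos_pow_mul_mem (tendsto_pointHom_pow p g (uniformizer_mem p π ϖ)) Q' hU
  obtain ⟨r, hr, hrA, hrT⟩ :=
    exists_pos_pow_mul_mem (tendsto_pointHom_pow p g (teichmuller_mem p π ϖ)) P' hU
  obtain ⟨I, hI1, hI2⟩ := exists_closedInterval hϖ0 hϖ1 hk hr
  have hpos : 0 < ‖ϖ‖ := norm_pos_iff.2 hϖ0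
  have hu : IsUnit (pointHom p g (annulusElement p π ϖ)) := by
    rw [map_mul]
    exact hgπ.mul hgϖ
  let f : BbPlusInv p (F := F) π ϖ →+* T.carrier := IsLocalization.Away.lift _ hu
  have hf : ∀ z, f (algebraMap _ _ z) = pointHom p g z := IsLocalization.Away.lift_eq _ hu
  have := charP_integer p F
  have := perfectRing_integer p F
  -- `l = z / (π [ϖ])^N`, with bounds on the Teichmüller coefficients of `z`
  have key : ∀ l : BbPlusInv p (F := F) π ϖ, ∃ (N : ℕ) (z : BbPlus p E F) (b : ℕ → 𝒪[F]),
      IsExpansion p _ π z b ∧ f l = pointHom p g z * (P' ^ N * Q' ^ N) ∧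
      ∀ C : ℝ, ‖invToBI p hπ hϖ0 I l‖ ≤ C → ∀ ρ ∈ Set.Icc (I.fst : ℝ) (I.snd : ℝ), ∀ i,
        ‖b i‖ * ρ ^ i ≤ C * ‖ϖ‖ ^ N * ρ ^ N := by
    intro l
    obtain ⟨N, z, hl⟩ := IsLocalization.Away.surj (annulusElement p π ϖ) l
    obtain ⟨b, hb⟩ := exists_isExpansion p _ hπ z
    refine ⟨N, z, b, hb, ?_, fun C hC ρ hρ i => ?_⟩
    · have h1 := congr_arg f hl
      have h2 : (pointHom p g (ofInteger p _ π) * pointTeichmuller p g ϖ) ^ N *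
          (P' ^ N * Q' ^ N) = 1 := by
        rw [← mul_pow, ← mul_pow, mul_mul_mul_comm, hP, hQ, one_mul, one_pow]
      rw [map_mul, map_pow, hf, hf, map_mul] at h1
      rw [← h1, mul_assoc]
      exact ((congr_arg (f l * ·) h2).trans (mul_one _)).symm
    · rw [norm_invToBI] at hC
      exact norm_le_of_intervalNorm_le p hπ hϖ0 (Subtype.prop _) (invToBb_mul_pow p hπ hϖ0 hl)
        hb hC hρ i
  have hcont : ∀ U ∈ 𝓝 (0 : T.carrier), ∃ V ∈ 𝓝 (0 : BI p F hπ I),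
      ∀ l, invToBI p hπ hϖ0 I l ∈ V → f l ∈ U := by
    intro U hU
    obtain ⟨W, hW, hWU, hAW⟩ := hbasis U hU
    obtain ⟨n, hn⟩ := exists_pow_le_preimage p g (hW.mem_nhds W.zero_mem)
    refine ⟨_, Metric.closedBall_mem_nhds 0 (pow_pos hpos (n + 1)), fun l hl => hWU ?_⟩
    obtain ⟨N, z, b, hb, hfl, hle⟩ := key l
    rw [hfl]
    exact pointHom_mul_mem_submodule p g hW hAW hn hϖ0 hP hQ hk hI1 hI2 hkA hrA hb
      (hle _ (mem_closedBall_zero_iff.1 hl))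
  have hdense := denseRange_invToBI p hπ hϖ0 hϖ1 I
  obtain ⟨h, hh, hhf⟩ :=
    exists_continuous_extension hc.t2 hc.complete (invToBI p hπ hϖ0 I) hdense f hcont
  -- an element of the unit ball is congruent to one of `B^{b,+}[1 / π [ϖ]]` modulo `h⁻¹(T⁺)`
  have hplus : ∀ x : BI p F hπ I, ‖x‖ ≤ 1 → h x ∈ T.plus := by
    intro x hx
    have hV : h ⁻¹' (T.plus : Set T.carrier) ∩ Metric.ball 0 1 ∈ 𝓝 (x - x) := by
      rw [sub_self]
      refine Filter.inter_mem ((hT.isOpen.preimage hh).mem_nhds ?_) (Metric.ball_mem_nhds 0 one_pos)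
      change h 0 ∈ T.plus
      rw [map_zero]
      exact T.plus.zero_mem
    have hsub : Filter.Tendsto (fun y : BI p F hπ I => x - y) (𝓝 x) (𝓝 (x - x)) :=
      (continuous_const.sub continuous_id).continuousAt
    obtain ⟨_, ⟨hl1, hl2⟩, l, rfl⟩ := mem_closure_iff_nhds.1 (hdense x) _ (hsub hV)
    have hl3 : ‖invToBI p hπ hϖ0 I l‖ ≤ 1 := by
      rw [← sub_sub_cancel x (invToBI p hπ hϖ0 I l), sub_eq_add_neg]
      refine (norm_BI_add_le p hπ I _ _).trans (max_le hx ?_)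
      rw [norm_neg]
      exact (mem_ball_zero_iff.1 hl2).le
    obtain ⟨N, z, b, hb, hfl, hle⟩ := key l
    have h1 : h (invToBI p hπ hϖ0 I l) ∈ T.plus := by
      rw [hhf, hfl]
      exact pointHom_mul_mem_plus p g hT hϖ0 hP hQ hk hI1 hI2 hkT hrT hb (hle _ hl3)
    have h2 : h (x - invToBI p hπ hϖ0 I l) ∈ T.plus := hl1
    rw [← sub_add_cancel x (invToBI p hπ hϖ0 I l), map_add]
    exact T.plus.add_mem h2 h1
  refine ⟨I, (⟨h, hh, hplus⟩ : Pair.Hom (intervalPair p F hπ I) T),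
    Pair.Hom.ext (RingHom.ext fun z => ?_)⟩
  exact (congr_arg h (invToBI_algebraMap p hπ hϖ0 I z)).symm.trans ((hhf _).trans (hf z))

end Factorization

/-! ### `Y^ad` as a colimit -/

section Colimit

variable (p : ℕ) [Fact p.Prime] {E : Type u} [NontriviallyNormedField E] [IsUltrametricDist E]
  [NormedAlgebra ℚ_[p] E] [FiniteDimensional ℚ_[p] E]
  {F : Type u} [NontriviallyNormedField F] [IsUltrametricDist F] [Algebra 𝓀[E] F]
  [CharP F p] [PerfectRing F p] {π : 𝒪[E]} {ϖ : 𝒪[F]} (hπ : Irreducible π)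

variable (F) in
/-- The pairs `(B_I, B_I°)` as a functor of `I`. -/
noncomputable def intervalPairFunctor : ClosedInterval ⥤ Pair.{u}ᵒᵖ where
  obj I := op (intervalPair p F hπ I)
  map h := (restrictPair p F hπ (leOfHom h)).op
  map_id I := congr_arg Quiver.Hom.op (Pair.Hom.ext
    (UniformSpace.Completion.mapRingHom_id (α := BbNormed p F hπ I)))
  map_comp f g := congr_arg Quiver.Hom.op (Pair.Hom.ext
    (UniformSpace.Completion.mapRingHom_comp (continuous_changeNorm p hπ (leOfHom f))
      (continuous_changeNorm p hπ (leOfHom g))).symm)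

/-- The points of `(B_I, B_I°)` as points of `B^{b,+}` with `π` and `[ϖ]` invertible. -/
noncomputable def intervalToUnitLocus (hϖ0 : ϖ ≠ 0) (hϖ1 : ‖ϖ‖ < 1) (I : ClosedInterval) :
    homPresheaf.obj (op (intervalPair p F hπ I)) ⟶ (unitLocus p (F := F) π ϖ).toFunctor :=
  Subfunctor.lift (homPresheaf.map (bbPlusToInterval p F hπ I hϖ1).op) (by
    rintro U _ ⟨g, rfl⟩
    let g' : intervalPair p F hπ I ⟶ U.unop.unop.obj :=
      (g : ULift.{u + 1} (intervalPair p F hπ I ⟶ U.unop.unop.obj)).down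
    exact ⟨(isUnit_toBI_uniformizer p hπ I).map (Pair.Hom.toRingHom g'),
      (isUnit_toBI_teichmuller p hπ hϖ0 I).map (Pair.Hom.toRingHom g')⟩)

theorem intervalToUnitLocus_comp_ι (hϖ0 : ϖ ≠ 0) (hϖ1 : ‖ϖ‖ < 1) (I : ClosedInterval) :
    intervalToUnitLocus p hπ hϖ0 hϖ1 I ≫ (unitLocus p (F := F) π ϖ).ι =
      homPresheaf.map (bbPlusToInterval p F hπ I hϖ1).op :=
  Subfunctor.lift_ι _ _

theorem injective_homPresheaf_map (hϖ0 : ϖ ≠ 0) (hϖ1 : ‖ϖ‖ < 1) (I : ClosedInterval)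
    (U : CompleteAffinoid.{u}ᵒᵖᵒᵖ) : Function.Injective
      ((homPresheaf.map (bbPlusToInterval p F hπ I hϖ1).op).app U) := fun _ _ h =>
  ULift.ext _ _ (bbPlusToInterval_cancel p hπ hϖ0 hϖ1 I U.unop.unop.property.2.t2 _ _
    (congr_arg ULift.down h))

theorem injective_intervalToUnitLocus (hϖ0 : ϖ ≠ 0) (hϖ1 : ‖ϖ‖ < 1) (I : ClosedInterval)
    (U : CompleteAffinoid.{u}ᵒᵖᵒᵖ) : Function.Injective
      ((intervalToUnitLocus p (F := F) hπ hϖ0 hϖ1 I).app U) := fun _ _ h =>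
  injective_homPresheaf_map p hπ hϖ0 hϖ1 I U (congr_arg Subtype.val h)

/-- The points of the `(B_I, B_I°)` as a cocone with vertex `unitLocus`. -/
noncomputable def unitLocusCocone (hϖ0 : ϖ ≠ 0) (hϖ1 : ‖ϖ‖ < 1) :
    Limits.Cocone (intervalPairFunctor p F hπ ⋙ homPresheaf) where
  pt := (unitLocus p (F := F) π ϖ).toFunctor
  ι :=
    { app := intervalToUnitLocus p hπ hϖ0 hϖ1
      naturality := fun I J f => by
        rw [← cancel_mono (unitLocus p (F := F) π ϖ).ι]
        change _ ≫ intervalToUnitLocus p hπ hϖ0 hϖ1 J ≫ (unitLocus p (F := F) π ϖ).ι =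
          intervalToUnitLocus p hπ hϖ0 hϖ1 I ≫ (unitLocus p (F := F) π ϖ).ι
        rw [intervalToUnitLocus_comp_ι, intervalToUnitLocus_comp_ι,
          ← bbPlusToInterval_restrictPair p hπ hϖ1 (leOfHom f), op_comp, Functor.map_comp]
        rfl }

/-- For complete affinoid `(T, T⁺)`, the points of `B^{b,+}` with `π` and `[ϖ]` invertible are the
union of the points of the `(B_I, B_I°)`. -/
noncomputable def isColimitUnitLocusCocone (hϖ0 : ϖ ≠ 0) (hϖ1 : ‖ϖ‖ < 1) :
    Limits.IsColimit (unitLocusCocone p (F := F) hπ hϖ0 hϖ1) :=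
  Limits.evaluationJointlyReflectsColimits _ fun U =>
    Limits.Types.FilteredColimit.isColimitOf' _ _
      (fun g => by
        obtain ⟨I, h, hh⟩ := exists_bbPlusToInterval_comp p (unitLocusHom p ϖ g) hπ
          U.unop.unop.property.1 U.unop.unop.property.2 hϖ0 hϖ1 g.2.1 g.2.2
        exact ⟨I, (ULift.up h : ULift.{u + 1} (intervalPair p F hπ I ⟶ U.unop.unop.obj)),
          Subtype.ext (ULift.ext _ _ hh.symm)⟩)
      (fun I x y h => ⟨I, 𝟙 I, congr_arg _
        (injective_intervalToUnitLocus p (F := F) hπ hϖ0 hϖ1 I U h)⟩)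

/-- The cocone with vertex `Y^ad` on the system of the `Spa(B_I, B_I°)`. -/
noncomputable def yadCocone (hϖ0 : ϖ ≠ 0) (hϖ1 : ‖ϖ‖ < 1) :
    Limits.Cocone (intervalSystem p F hπ) :=
  ((presheafToSheaf rationalTopology (Type (u + 1))).mapCocone
    (unitLocusCocone p (F := F) hπ hϖ0 hϖ1)).extend (unitLocusToYad p hπ hϖ1)

theorem yadCocone_comp_Yadι (hϖ0 : ϖ ≠ 0) (hϖ1 : ‖ϖ‖ < 1) (I : ClosedInterval) :
    (yadCocone p (F := F) hπ hϖ0 hϖ1).ι.app I ≫ Yadι p hπ ϖ =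
      Spa.map (bbPlusToInterval p F hπ I hϖ1).op := by
  change ((presheafToSheaf rationalTopology (Type (u + 1))).map
    (intervalToUnitLocus p hπ hϖ0 hϖ1 I) ≫ unitLocusToYad p hπ hϖ1) ≫ Yadι p hπ ϖ =
    (presheafToSheaf rationalTopology (Type (u + 1))).map
      (homPresheaf.map (bbPlusToInterval p F hπ I hϖ1).op)
  rw [Category.assoc, unitLocusToYad_comp]
  exact ((presheafToSheaf rationalTopology (Type (u + 1))).map_comp _ _).symm.trans
    (congr_arg _ (intervalToUnitLocus_comp_ι p hπ hϖ0 hϖ1 I))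

theorem mono_yadCocone (hϖ0 : ϖ ≠ 0) (hϖ1 : ‖ϖ‖ < 1) (I : ClosedInterval) :
    Mono ((yadCocone p (F := F) hπ hϖ0 hϖ1).ι.app I) := by
  have h1 : Mono (homPresheaf.map (bbPlusToInterval p F hπ I hϖ1).op) :=
    @NatTrans.mono_of_mono_app _ _ _ _ _ _ _ fun U =>
      (mono_iff_injective _).2 (injective_homPresheaf_map p hπ hϖ0 hϖ1 I U)
  have h2 : Mono ((yadCocone p (F := F) hπ hϖ0 hϖ1).ι.app I ≫ Yadι p hπ ϖ) := by
    rw [yadCocone_comp_Yadι]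
    exact (presheafToSheaf rationalTopology (Type (u + 1))).map_mono _
  exact mono_of_mono _ (Yadι p hπ ϖ)

theorem nonempty_isColimit_yadCocone (hϖ0 : ϖ ≠ 0) (hϖ1 : ‖ϖ‖ < 1) :
    Nonempty (Limits.IsColimit (yadCocone p (F := F) hπ hϖ0 hϖ1)) := by
  let c := (presheafToSheaf rationalTopology (Type (u + 1))).mapCocone
    (unitLocusCocone p (F := F) hπ hϖ0 hϖ1)
  let f : c.pt ⟶ Yad p hπ ϖ := unitLocusToYad p hπ hϖ1
  have : IsIso f :=
    isIso_unitLocusToYad p hπ hϖ1 (isUnit_teichmuller_of_avoids p (F := F) hπ hϖ0)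
  have hc : Limits.IsColimit c := Limits.isColimitOfPreserves _
    (isColimitUnitLocusCocone p (F := F) hπ hϖ0 hϖ1)
  exact ⟨hc.extendIso f⟩

end Colimit

end FarguesFontaine

theorem mainTheorem10 (p : ℕ) [Fact p.Prime]
    (E : Type u) [NontriviallyNormedField E] [IsUltrametricDist E] [NormedAlgebra ℚ_[p] E]
    [FiniteDimensional ℚ_[p] E]
    (F : Type u) [NontriviallyNormedField F] [IsUltrametricDist F] [CompleteSpace F] [CharP F p]
    [PerfectRing F p] [Algebra 𝓀[E] F]
    (π : 𝒪[E]) (hπ : Irreducible π) (ϖ : 𝒪[F]) (hϖ0 : ϖ ≠ 0) (hϖ1 : ‖ϖ‖ < 1) :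
    (∀ I : FarguesFontaine.ClosedInterval,
      (FarguesFontaine.intervalPair p F hπ I).IsAffinoid ∧
      (FarguesFontaine.intervalPair p F hπ I).IsComplete) ∧
    ∃ α : FarguesFontaine.intervalSystem p F hπ ⟶
        (Functor.const FarguesFontaine.ClosedInterval).obj (FarguesFontaine.Yad p hπ ϖ),
      (∀ I : FarguesFontaine.ClosedInterval,
        α.app I ≫ FarguesFontaine.Yadι p hπ ϖ =
          AdicSpaces.Spa.map (FarguesFontaine.bbPlusToInterval p F hπ I hϖ1).op) ∧
      (∀ I : FarguesFontaine.ClosedInterval, Mono (α.app I)) ∧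
      Nonempty (Limits.IsColimit (Limits.Cocone.mk (FarguesFontaine.Yad p hπ ϖ) α)) :=
  ⟨fun I => ⟨FarguesFontaine.isAffinoid_intervalPair p hπ I,
      FarguesFontaine.isComplete_intervalPair p hπ I⟩,
    (FarguesFontaine.yadCocone p hπ hϖ0 hϖ1).ι,
    FarguesFontaine.yadCocone_comp_Yadι p hπ hϖ0 hϖ1,
    FarguesFontaine.mono_yadCocone p hπ hϖ0 hϖ1,
    FarguesFontaine.nonempty_isColimit_yadCocone p hπ hϖ0 hϖ1⟩
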